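/- Let $H$ be a finite-dimensional Hopf algebra over a field $k$ with antipode $S$ (so $S$ is bijective), with Sweedler notation $\Delta h=h_1\otimes h_2$. Let $D(H)=H^{*op}\bowtie H$ be its Drinfeld double, i.e. $H^*\otimes H$ with $$(a\otimes h)(b\otimes g)=\langle Sh_1,b_1\rangle\langle h_3,b_3\rangle\, b_2a\otimes h_2g,\qquad \Delta(a\otimes h)=(a_1\otimes h_1)\otimes(a_2\otimes h_2),$$ $$S(a\otimes h)=\langle h_1,a_1\rangle\langle Sh_3,a_3\rangle\, S^{-1}a_2\otimes Sh_2 .$$ **Model.** Consider the square lattice with vertices $\mathbb Z/m\times\mathbb Z/n$ ($m,n\ne 1$; $m=0$ or $n=0$ means no periodicity, so $m=n=0$ is the lattice $\mathbb Z^2$ in the plane), with all arrows pointing right or up, and $\mathcal H=\bigotimes_{\text{arrows}}H$. A site $s=(v,p)$ is a vertex $v$ and a face $p$ having $v$ on its boundary; two sites are disjoint if they share neither vertex nor face. A *dual triangle* goes from $(v,p)$ to $(v,p')$, where $p'$ is the next face anticlockwise around $v$; its operator ${}^{(\pm)}L^h$ acts on the crossed arrow by $g\mapsto hg$ if that arrow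 is outward at $v$ and by $g\mapsto g\,S^{\pm1}(h)$ if it is inward. A *direct triangle* goes from $(v,p)$ to $(v',p)$, where $v'$ is the next vertex clockwise around $p$; its operator $T^a$ ($a\in H^*$) acts on the arrow between $v$ and $v'$ by $g\mapsto \langle a,g_1\rangle g_2$ if that arrow points from $v$ to $v'$ and by $g\mapsto\langle a,Sg_2\rangle g_1$ otherwise. At a site $s=(v,p)$ let $$h\triangleright_s=L^{h_4}L^{h_3}L^{h_2}L^{h_1}\ \text{(anticlockwise around $v$, starting from $p$)},\qquad a\triangleright_s=T^{a_4}T^{a_3}T^{a_2}T^{a_1}\ \text{(clockwise around $p$, starting from $v$)},$$ $(a\otimes h)\triangleright_s=(a\triangleright_s)\circ(h\triangleright_s)$, where the four factors $L$ use signs $\varepsilon=(\varepsilon_0,\varepsilon_1,\varepsilon_2,\varepsilon_3)$ with $\varepsilon_0=-$, $\varepsilon_3=+$ and $\varepsilon_1,\varepsilon_2$ free ("admissible" signs; $(-,+,+,+)$ is the default choice). **Ribbons.** A ribbon $\xi$ with sites $s_0,s_1,\dots,s_N$, $s_i=(v_i,p_i)$, is a sequence of $N$ triangles (direct or dual), the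 $j$-th one ($0\le j<N$) from $s_j$ to $s_{j+1}$. It is *strongly open* if $s_0,s_N$ are disjoint and, for $i<l<j$, $v_i=v_j$ implies $v_l=v_i$ and $p_i=p_j$ implies $p_l=p_i$. Given a sign $\sigma_j$ for each dual triangle, put, with $D(H)^*=H\otimes H^*$, $$\tilde F_\tau^{h\otimes a}=\epsilon(h)T_\tau^a,\qquad \tilde F_{\tau^*}^{h\otimes a}=\epsilon(a)\,{}^{(\sigma_j)}L_{\tau^*}^{S^{-1}h},\qquad \tilde F_{\xi'\circ\xi}^{\phi}=\tilde F_{\xi'}^{\phi_2}\circ\tilde F_{\xi}^{\phi_1},$$ the last with the coproduct of $D(H)^*$ dual to the product of $D(H)$. Iterating defines $\tilde F_\xi: D(H)^*\to\mathrm{End}(\mathcal H)$. **Proposition.** Let $\xi$ be a strongly open ribbon from $s_0$ to $s_N$, with any signs $\sigma$. 1. For any admissible signs $\varepsilon$ at $s_0$, $\tilde F_\xi$ is a left $D(H)$-module map, $$\tilde F_\xi^{d\triangleright\phi}=(d_1\triangleright_{s_0})\circ\tilde F_\xi^{\phi}\circ(Sd_2\triangleright_{s_0}),\qquad d\triangleright\phi=\langle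 Sd,\phi_1\rangle\phi_2,$$ provided that $S^2=\mathrm{id}$ or the signs are compatible at the start: $\sigma=-$ at the first dual triangle (if its arrow is inward at its vertex) and, for every $j$ with $v_j=v_0$ for which the arrow of the $j$-th triangle is inward at $v_0$: $\sigma_j=\varepsilon_j$ if the triangle is dual, $\varepsilon_j=-$ if it is direct. 2. For any admissible signs $\varepsilon$ at $s_N$, $\tilde F_\xi$ is a right $D(H)$-module map, $$\tilde F_\xi^{\phi\triangleleft d}=(Sd_1\triangleright_{s_N})\circ\tilde F_\xi^{\phi}\circ(d_2\triangleright_{s_N}),\qquad \phi\triangleleft d=\phi_1\langle Sd,\phi_2\rangle,$$ provided that $S^2=\mathrm{id}$ or the signs are compatible at the end: $\sigma=+$ at the last dual triangle (if its arrow is inward at its vertex) and, for every $j$ with $v_{j+1}=v_N$ for which the arrow of the $j$-th triangle is inward at $v_N$: $\sigma_j=\varepsilon_{j+4-N}$ if the triangle is dual, $\varepsilon_{j+4-N}=+$ if it is direct. 3. Let $\Lambda\in H$ and $\int\in H^*$ be (left or right) integrals that are cocommutative, $\Lambda_1\otimes\Lambda_2=\Lambda_2\otimes\Lambda_1$ and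 $\int_1\otimes\int_2=\int_2\otimes\int_1$. Then $\tilde F_\xi^\phi$ commutes with $A(t)=\Lambda\triangleright_t$ and $B(t)=\int\triangleright_t$ for all $\phi\in D(H)^*$ and all sites $t$ disjoint from $s_0$ and from $s_N$ (with any signs $\sigma$ and any admissible signs in $\triangleright_t$). -/

import Mathlib

open scoped TensorProduct

noncomputable section

namespace HopfKitaev

/-! ### The Drinfeld double of a finite-dimensional Hopf algebra -/

section Double

variable (k H : Type*) [Field k] [Ring H] [HopfAlgebra k H] [FiniteDimensional k H]

/-- The antipode `S` as an element of the ring `End_k H`. -/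
def antip : Module.End k H := HopfAlgebra.antipode k

/-- The inverse `S⁻¹` of the antipode, the inverse being taken in the ring `End_k H`
(the antipode of a finite-dimensional Hopf algebra is bijective). -/
def antipInv : Module.End k H := Ring.inverse (antip k H)

/-- The coproduct of `C^*` dual to a product `μ` on a finite-dimensional space `C`,
`⟨φ₁, x⟩ ⟨φ₂, y⟩ = ⟨φ, x y⟩`. -/
def dualComul {k C : Type*} [Field k] [AddCommGroup C] [Module k C] [FiniteDimensional k C]
    (μ : C ⊗[k] C →ₗ[k] C) :
    Module.Dual k C →ₗ[k] Module.Dual k C ⊗[k] Module.Dual k C :=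
  (TensorProduct.dualDistribEquiv k C C).symm.toLinearMap ∘ₗ μ.dualMap

/-- The product of `H^*`, `⟨a b, x⟩ = ⟨a, x₁⟩ ⟨b, x₂⟩`. -/
def dualMul : Module.Dual k H ⊗[k] Module.Dual k H →ₗ[k] Module.Dual k H :=
  (Coalgebra.comul (R := k) (A := H)).dualMap ∘ₗ TensorProduct.dualDistrib k H H

/-- The trilinear map `(b, u, w) ↦ ⟨b₁, u⟩ b₂ ⟨b₃, w⟩`, that is, the functional
`x ↦ ⟨b, u x w⟩`. -/
def sandwich : Module.Dual k H →ₗ[k] H →ₗ[k] H →ₗ[k] Module.Dual k H :=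
  LinearMap.mk₂ k
    (fun b u =>
      { toFun := fun w => b ∘ₗ LinearMap.mulLeft k u ∘ₗ LinearMap.mulRight k w
        map_add' := fun w w' => by ext x; simp [mul_add]
        map_smul' := fun c w => by ext x; simp })
    (fun b b' u => by ext w x; simp)
    (fun c b u => by ext w x; simp)
    (fun b u u' => by ext w x; simp [add_mul])
    (fun c b u => by ext w x; simp)

/-- `h ↦ (h₁ ⊗ h₃) ⊗ h₂`. -/
def outerMiddle : H →ₗ[k] (H ⊗[k] H) ⊗[k] H :=
  (TensorProduct.assoc k H H H).symm.toLinearMap ∘ₗ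
    (TensorProduct.comm k H H).toLinearMap.lTensor H ∘ₗ
    (Coalgebra.comul (R := k) (A := H)).lTensor H ∘ₗ Coalgebra.comul

/-- The vector space `H^* ⊗ H` underlying the Drinfeld double `D(H) = H^{*op} ⋈ H`. -/
abbrev Double : Type _ := Module.Dual k H ⊗[k] H

/-- For linear `f g : H → H`, the map
`(b, h) ↦ ⟨b₁, f h₁⟩ ⟨b₃, g h₃⟩ b₂ ⊗ h₂` on `H^* ⊗ H`. -/
def coadjoint (f g : Module.End k H) : Double k H →ₗ[k] Double k H :=
  TensorProduct.lift
    (LinearMap.mk₂ k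
      (fun b h =>
        (TensorProduct.lift ((sandwich k H b).compl₁₂ f g)).rTensor H (outerMiddle k H h))
      (fun b b' h => by
        rw [← LinearMap.add_apply, ← LinearMap.rTensor_add]
        congr 2
        ext u w x
        simp)
      (fun c b h => by
        rw [← LinearMap.smul_apply, ← LinearMap.rTensor_smul]
        congr 2
        ext u w x
        simp)
      (fun b h h' => by simp)
      (fun c b h => by simp))

/-- The product of the Drinfeld double,
`(a ⊗ h)(b ⊗ g) = ⟨S h₁, b₁⟩ ⟨h₃, b₃⟩ b₂ a ⊗ h₂ g`. -/
def doubleMul : Double k H ⊗[k] Double k H →ₗ[k] Double k H :=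
  (dualMul k H ∘ₗ (TensorProduct.comm k _ _).toLinearMap).rTensor H ∘ₗ
    (TensorProduct.assoc k _ _ _).symm.toLinearMap ∘ₗ
    ((LinearMap.mul' k H).lTensor (Module.Dual k H) ∘ₗ
        (TensorProduct.assoc k _ _ _).toLinearMap ∘ₗ
        (coadjoint k H (antip k H) LinearMap.id ∘ₗ
          (TensorProduct.comm k _ _).toLinearMap).rTensor H ∘ₗ
        (TensorProduct.assoc k _ _ _).symm.toLinearMap).lTensor (Module.Dual k H) ∘ₗ
    (TensorProduct.assoc k _ _ _).toLinearMap

/-- The coproduct of the Drinfeld double, `Δ(a ⊗ h) = (a₁ ⊗ h₁) ⊗ (a₂ ⊗ h₂)`. -/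
def doubleComul : Double k H →ₗ[k] Double k H ⊗[k] Double k H :=
  (TensorProduct.tensorTensorTensorComm k _ _ _ _).toLinearMap ∘ₗ
    TensorProduct.map (dualComul (LinearMap.mul' k H)) Coalgebra.comul

/-- The antipode of the Drinfeld double,
`S(a ⊗ h) = ⟨h₁, a₁⟩ ⟨S h₃, a₃⟩ S⁻¹ a₂ ⊗ S h₂`. -/
def doubleAntip : Double k H →ₗ[k] Double k H :=
  TensorProduct.map (antipInv k H).dualMap (antip k H) ∘ₗ
    coadjoint k H LinearMap.id (antip k H)

/-- The unit `ε ⊗ 1` of the Drinfeld double. -/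
def doubleOne : Double k H := Coalgebra.counit (R := k) (A := H) ⊗ₜ[k] (1 : H)

/-- The identification `H ⊗ H^* ≃ D(H)^*`, `⟨h ⊗ a, b ⊗ g⟩ = ⟨b, h⟩ ⟨a, g⟩`. -/
def doubleDualEquiv : H ⊗[k] Module.Dual k H ≃ₗ[k] Module.Dual k (Double k H) :=
  TensorProduct.congr (Module.evalEquiv k H) (LinearEquiv.refl k (Module.Dual k H)) ≪≫ₗ
    TensorProduct.dualDistribEquiv k (Module.Dual k H) H

variable {k H}

/-- The left coregular action of `D(H)` on `D(H)^*`: `d ▷ φ = ⟨S d, φ₁⟩ φ₂`, that is,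
`(d ▷ φ)(x) = φ((S d) x)`. -/
def coregLeft (d : Double k H) (φ : Module.Dual k (Double k H)) :
    Module.Dual k (Double k H) :=
  φ ∘ₗ doubleMul k H ∘ₗ TensorProduct.mk k _ _ (doubleAntip k H d)

/-- The right coregular action of `D(H)` on `D(H)^*`: `φ ◁ d = φ₁ ⟨S d, φ₂⟩`, that is,
`(φ ◁ d)(x) = φ(x (S d))`. -/
def coregRight (φ : Module.Dual k (Double k H)) (d : Double k H) :
    Module.Dual k (Double k H) :=
  φ ∘ₗ doubleMul k H ∘ₗ (TensorProduct.mk k _ _).flip (doubleAntip k H d)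

variable {V : Type*} [AddCommGroup V] [Module k V]

/-- The left action of `D(H)` on `End V` induced by an action `ρ` on `V`:
`d ▷ L = ρ(d₁) ∘ L ∘ ρ(S d₂)`. -/
def endLeft (ρ : Double k H →ₗ[k] Module.End k V) (d : Double k H) (L : Module.End k V) :
    Module.End k V :=
  LinearMap.mul' k (Module.End k V)
    (TensorProduct.map ρ (LinearMap.mulLeft k L ∘ₗ ρ ∘ₗ doubleAntip k H) (doubleComul k H d))

/-- The right action of `D(H)` on `End V` induced by an action `ρ` on `V`:
`L ◁ d = ρ(S d₁) ∘ L ∘ ρ(d₂)`. -/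
def endRight (ρ : Double k H →ₗ[k] Module.End k V) (L : Module.End k V) (d : Double k H) :
    Module.End k V :=
  LinearMap.mul' k (Module.End k V)
    (TensorProduct.map (ρ ∘ₗ doubleAntip k H) (LinearMap.mulLeft k L ∘ₗ ρ) (doubleComul k H d))

/-- The convolution-composition `c ↦ F''(c₂) ∘ F'(c₁)` with respect to a coproduct `Δ`. -/
def convComp {C : Type*} [AddCommGroup C] [Module k C] (Δ : C →ₗ[k] C ⊗[k] C)
    (F'' F' : C →ₗ[k] Module.End k V) : C →ₗ[k] Module.End k V :=
  LinearMap.mul' k (Module.End k V) ∘ₗ TensorProduct.map F'' F' ∘ₗ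
    (TensorProduct.comm k C C).toLinearMap ∘ₗ Δ

/-- `Λ` is a left or a right integral element of `H`. -/
def IsIntegralElement (Λ : H) : Prop :=
  (∀ h : H, h * Λ = Coalgebra.counit (R := k) h • Λ) ∨
    (∀ h : H, Λ * h = Coalgebra.counit (R := k) h • Λ)

/-- `I ∈ H^*` is a right-invariant, `I(h₁) h₂ = I(h) 1`, or a left-invariant,
`h₁ I(h₂) = I(h) 1`, integral on `H`. -/
def IsIntegralFunctional (I : Module.Dual k H) : Prop :=
  (∀ h : H, TensorProduct.lid k H (I.rTensor H (Coalgebra.comul h)) = I h • (1 : H)) ∨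
    (∀ h : H, TensorProduct.rid k H (I.lTensor H (Coalgebra.comul h)) = I h • (1 : H))

/-- `c₁ ⊗ c₂ = c₂ ⊗ c₁` with respect to a coproduct `Δ`. -/
def IsCocommutativeElement {C : Type*} [AddCommGroup C] [Module k C]
    (Δ : C →ₗ[k] C ⊗[k] C) (c : C) : Prop :=
  TensorProduct.comm k C C (Δ c) = Δ c

end Double

/-! ### The oriented square lattice, sites and ribbons -/

/-- Vertices of the square lattice with periods `m` and `n`; since `ZMod 0 = ℤ`, period `0` means
no identification in that direction, so `m = n = 0` is the lattice `ℤ²` in the plane. -/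
abbrev Vertex (m n : ℕ) : Type := ZMod m × ZMod n

/-- A face (unit square) is named by its lower left corner. -/
abbrev Face (m n : ℕ) : Type := ZMod m × ZMod n

/-- Arrows of the lattice, with the cartesian orientation. -/
inductive Arrow (m n : ℕ) : Type
  /-- the arrow `(x, y) → (x + 1, y)` -/
  | horizontal (x : ZMod m) (y : ZMod n) : Arrow m n
  /-- the arrow `(x, y) → (x, y + 1)` -/
  | vertical (x : ZMod m) (y : ZMod n) : Arrow m n
  deriving DecidableEq

/-- The four positions of a face relative to a vertex on its boundary. -/
inductive Corner : Type
  | upperRight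
  | upperLeft
  | lowerLeft
  | lowerRight
  deriving DecidableEq

/-- A site: a vertex together with a face having this vertex on its boundary. -/
structure Site (m n : ℕ) : Type where
  /-- the vertex of the site -/
  vertex : Vertex m n
  /-- where the face lies as seen from the vertex -/
  corner : Corner

namespace Site

variable {m n : ℕ}

/-- The face of a site. -/
def face : Site m n → Face m n
  | ⟨(x, y), .upperRight⟩ => (x, y)
  | ⟨(x, y), .upperLeft⟩ => (x - 1, y)
  | ⟨(x, y), .lowerLeft⟩ => (x - 1, y - 1)
  | ⟨(x, y), .lowerRight⟩ => (x, y - 1)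

/-- For a site `(v, p)`, the arrow at `v` met first when turning anticlockwise about `v`
starting from `p`. It is also the first arrow met when going clockwise around the boundary of `p`
starting from `v`. -/
def arrow : Site m n → Arrow m n
  | ⟨(x, y), .upperRight⟩ => .vertical x y
  | ⟨(x, y), .upperLeft⟩ => .horizontal (x - 1) y
  | ⟨(x, y), .lowerLeft⟩ => .vertical x (y - 1)
  | ⟨(x, y), .lowerRight⟩ => .horizontal x y

/-- Whether `arrow` points away from the vertex of the site; equivalently, whether it points in the
direction of the clockwise motion around the face of the site. -/
def Outward (s : Site m n) : Prop :=
  s.corner = .upperRight ∨ s.corner = .lowerRight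

instance (s : Site m n) : Decidable s.Outward := by
  unfold Outward; infer_instance

/-- Keep the vertex and turn anticlockwise about it to the next face, crossing `arrow`. -/
def turn : Site m n → Site m n
  | ⟨v, .upperRight⟩ => ⟨v, .upperLeft⟩
  | ⟨v, .upperLeft⟩ => ⟨v, .lowerLeft⟩
  | ⟨v, .lowerLeft⟩ => ⟨v, .lowerRight⟩
  | ⟨v, .lowerRight⟩ => ⟨v, .upperRight⟩

/-- Keep the face and go clockwise along its boundary to the next vertex, along `arrow`. -/
def move : Site m n → Site m n
  | ⟨(x, y), .upperRight⟩ => ⟨(x, y + 1), .lowerRight⟩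
  | ⟨(x, y), .lowerRight⟩ => ⟨(x + 1, y), .lowerLeft⟩
  | ⟨(x, y), .lowerLeft⟩ => ⟨(x, y - 1), .upperLeft⟩
  | ⟨(x, y), .upperLeft⟩ => ⟨(x - 1, y), .upperRight⟩

/-- Two sites are disjoint if they share neither the vertex nor the face. -/
def Disjoint (s t : Site m n) : Prop := s.vertex ≠ t.vertex ∧ s.face ≠ t.face

end Site

/-- The two kinds of triangles. A direct triangle goes from a site `s` to `s.move`, along `s.arrow`;
a dual triangle goes from `s` to `s.turn`, across `s.arrow`. -/
inductive Triangle : Type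
  | direct
  | dual
  deriving DecidableEq

/-- The end site of the triangle of the given kind starting at `s`. -/
def Triangle.target {m n : ℕ} (τ : Triangle) (s : Site m n) : Site m n :=
  match τ with
  | .direct => s.move
  | .dual => s.turn

/-- A ribbon: a sequence of triangles, each starting at the site where the previous one ends. All
its vertices lie on the left-hand side of the strip and all its faces on the right-hand side. -/
structure Ribbon (m n : ℕ) : Type where
  /-- the initial site -/
  source : Site m n
  /-- the kinds of the successive triangles -/
  triangles : List Triangle

namespace Ribbon

variable {m n : ℕ} (ξ : Ribbon m n)

/-- The number of triangles. -/
def length : ℕ := ξ.triangles.length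

/-- The `i`-th site of the ribbon, for `0 ≤ i ≤ length`. -/
def site (i : ℕ) : Site m n := (ξ.triangles.take i).foldl (fun s τ => τ.target s) ξ.source

/-- The final site. -/
def target : Site m n := ξ.site ξ.length

/-- The `j`-th triangle (from the site `j` to the site `j + 1`) is a dual triangle. -/
def IsDual (j : ℕ) : Prop := ξ.triangles[j]? = some .dual

/-- The `j`-th triangle (from the site `j` to the site `j + 1`) is a direct triangle. -/
def IsDirect (j : ℕ) : Prop := ξ.triangles[j]? = some .direct

/-- A ribbon is open if its end sites are disjoint. -/
def IsOpen : Prop := ξ.source.Disjoint ξ.target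

/-- A ribbon is strongly open if it is open and if two of its sites have the same vertex (face) only
when all the sites between them have that same vertex (face) as well. -/
def StronglyOpen : Prop :=
  ξ.IsOpen ∧
    ∀ i l j : ℕ, i < l → l < j → j ≤ ξ.length →
      ((ξ.site i).vertex = (ξ.site j).vertex → (ξ.site l).vertex = (ξ.site i).vertex) ∧
      ((ξ.site i).face = (ξ.site j).face → (ξ.site l).face = (ξ.site i).face)

end Ribbon

/-! ### Choices between the antipode and its inverse -/

/-- A choice of `S` (`plus`) or `S⁻¹` (`minus`). -/
inductive Sgn : Type
  | plus
  | minus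
  deriving DecidableEq

/-- The choices of `S` or `S⁻¹` used in a vertex action at the four arrows met when turning
anticlockwise about the vertex (relevant for inward arrows only) are admissible if the first one is
`S⁻¹` and the last one is `S`; the two intermediate choices are free. -/
def AdmissibleSigns (ε : Fin 4 → Sgn) : Prop := ε 0 = .minus ∧ ε 3 = .plus

namespace Ribbon

variable {m n : ℕ} (ξ : Ribbon m n)

/-- Compatibility at the initial site of the choices `σ` (`σ j` for the `j`-th triangle, if dual) of
a ribbon with those of the action at that site: the first dual triangle uses `S⁻¹`; the dual
triangles at the initial vertex make the same choices as the site action at the respective arrows;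
and if the first direct triangle leaves the initial vertex along an arrow, then the site action uses
`S⁻¹` at it. All this is required for arrows that point to the vertex concerned only. -/
def LeftCompatible (σ : ℕ → Sgn) (ε : Fin 4 → Sgn) : Prop :=
  (∀ j, ξ.IsDual j → (∀ i, i < j → ¬ ξ.IsDual i) → ¬ (ξ.site j).Outward → σ j = .minus) ∧
  (∀ j : Fin 4, (ξ.site j).vertex = ξ.source.vertex → ¬ (ξ.site j).Outward →
    (ξ.IsDual j → σ j = ε j) ∧ (ξ.IsDirect j → ε j = .minus))

/-- Compatibility at the final site: the last dual triangle uses `S`; the dual triangles at the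
final vertex make the same choices as the site action at the respective arrows; and if the last
direct triangle reaches the final vertex along an arrow, then the site action uses `S` at it. All
this is required for arrows that point to the vertex concerned only. The `j`-th triangle of a ribbon
with `N` triangles, if it ends at the final vertex, has the arrow that is number `j + 4 - N`
(counting from `0`) in the anticlockwise order from the final site. -/
def RightCompatible (σ : ℕ → Sgn) (ε : Fin 4 → Sgn) : Prop :=
  (∀ j, ξ.IsDual j → (∀ i, j < i → ¬ ξ.IsDual i) → ¬ (ξ.site j).Outward → σ j = .plus) ∧
  (∀ (j : ℕ) (i : Fin 4), j + 4 = ξ.length + i → (ξ.site (j + 1)).vertex = ξ.target.vertex →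
    (ξ.IsDual j → ¬ (ξ.site j).Outward → σ j = ε i) ∧
    (ξ.IsDirect j → (ξ.site j).Outward → ε i = .plus))

end Ribbon

/-! ### The model -/

section Model

variable (k H : Type*) [Field k] [Ring H] [HopfAlgebra k H] [FiniteDimensional k H] (m n : ℕ)

/-- The state space: the tensor product of one copy of `H` for each arrow. -/
abbrev Hilb : Type _ := ⨂[k] _ : Arrow m n, H

variable {m n}

/-- `f : H → H` acting at the arrow `e`, and the identity at all other arrows. -/
def onArrow (e : Arrow m n) : Module.End k H →ₗ[k] Module.End k (Hilb k H m n) :=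
  (PiTensorProduct.mapMultilinear k (fun _ : Arrow m n => H) (fun _ : Arrow m n => H)).toLinearMap
    (fun _ => LinearMap.id) e

/-- `S` or `S⁻¹`. -/
def antipSgn : Sgn → Module.End k H
  | .plus => antip k H
  | .minus => antipInv k H

/-- The dual triangle operator `^{(±)}L^h` of the dual triangle starting at `s`:
`g ↦ h g` if the crossed arrow points away from the vertex, `g ↦ g S^{±1}(h)` otherwise. -/
def dualTriangle (ς : Sgn) (s : Site m n) : H →ₗ[k] Module.End k (Hilb k H m n) :=
  onArrow k H s.arrow ∘ₗ
    if s.Outward then LinearMap.mul k H else (LinearMap.mul k H).flip ∘ₗ antipSgn k H ς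

/-- The action `a ▷ g = ⟨a, g₁⟩ g₂` of `H^*` on `H`. -/
def coactAlong : Module.Dual k H →ₗ[k] Module.End k H where
  toFun a := (TensorProduct.lid k H).toLinearMap ∘ₗ a.rTensor H ∘ₗ Coalgebra.comul
  map_add' a b := by ext g; simp [LinearMap.rTensor_add]
  map_smul' c a := by ext g; simp [LinearMap.rTensor_smul]

/-- The action `a ▷ g = ⟨a, S g₂⟩ g₁` of `H^*` on `H`. -/
def coactAgainst : Module.Dual k H →ₗ[k] Module.End k H where
  toFun a := (TensorProduct.rid k H).toLinearMap ∘ₗ (a ∘ₗ antip k H).lTensor H ∘ₗ Coalgebra.comul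
  map_add' a b := by ext g; simp [LinearMap.add_comp, LinearMap.lTensor_add]
  map_smul' c a := by ext g; simp [LinearMap.smul_comp, LinearMap.lTensor_smul]

/-- The direct triangle operator `T^a` of the direct triangle starting at `s`: `g ↦ ⟨a, g₁⟩ g₂` if
the arrow points in the direction of motion, `g ↦ ⟨a, S g₂⟩ g₁` otherwise. -/
def directTriangle (s : Site m n) : Module.Dual k H →ₗ[k] Module.End k (Hilb k H m n) :=
  onArrow k H s.arrow ∘ₗ if s.Outward then coactAlong k H else coactAgainst k H

/-- The action of `H` at the vertex of a site: `h₁, h₂, h₃, h₄` act at the four arrows of the vertex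
in anticlockwise order starting from the face of the site. -/
def vertexAction (ε : Fin 4 → Sgn) (s : Site m n) : H →ₗ[k] Module.End k (Hilb k H m n) :=
  convComp Coalgebra.comul (dualTriangle k H (ε 3) s.turn.turn.turn) <|
  convComp Coalgebra.comul (dualTriangle k H (ε 2) s.turn.turn) <|
  convComp Coalgebra.comul (dualTriangle k H (ε 1) s.turn)
    (dualTriangle k H (ε 0) s)

/-- The action of `H^{*op}` at the face of a site: `a₁, a₂, a₃, a₄` act at the four arrows of the
face in clockwise order starting from the vertex of the site. -/
def faceAction (s : Site m n) : Module.Dual k H →ₗ[k] Module.End k (Hilb k H m n) :=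
  convComp (dualComul (LinearMap.mul' k H)) (directTriangle k H s.move.move.move) <|
  convComp (dualComul (LinearMap.mul' k H)) (directTriangle k H s.move.move) <|
  convComp (dualComul (LinearMap.mul' k H)) (directTriangle k H s.move)
    (directTriangle k H s)

/-- The action of `D(H)` at a site, `(a ⊗ h) ▷ = (a ▷) ∘ (h ▷)`. -/
def siteAction (ε : Fin 4 → Sgn) (s : Site m n) :
    Double k H →ₗ[k] Module.End k (Hilb k H m n) :=
  LinearMap.mul' k _ ∘ₗ TensorProduct.map (faceAction k H s) (vertexAction k H ε s)

/-- A triangle operator viewed as a ribbon operator on `D(H)^* = H ⊗ H^*`: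
`F̃_τ^{h ⊗ a} = ε(h) T_τ^a` and `^{(±)}F̃_{τ^*}^{h ⊗ a} = ε(a) ^{(±)}L_{τ^*}^{S⁻¹ h}`. -/
def triangleRibbon (ς : Sgn) (τ : Triangle) (s : Site m n) :
    Module.Dual k (Double k H) →ₗ[k] Module.End k (Hilb k H m n) :=
  (match τ with
    | .direct =>
        (TensorProduct.lid k _).toLinearMap ∘ₗ
          TensorProduct.map (Coalgebra.counit (R := k) (A := H)) (directTriangle k H s)
    | .dual =>
        (TensorProduct.rid k _).toLinearMap ∘ₗ
          TensorProduct.map (dualTriangle k H ς s ∘ₗ antipInv k H)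
            (Module.Dual.eval k H (1 : H))) ∘ₗ
  (doubleDualEquiv k H).symm.toLinearMap

/-- The ribbon operator of the sequence `w` of triangles starting at `s`, with the choice `σ j` of
`S` or `S⁻¹` in the `j`-th triangle, by iterated convolution-composition
`F̃_{ξ'∘ξ}^φ = F̃_{ξ'}^{φ₂} ∘ F̃_ξ^{φ₁}` with the coproduct of `D(H)^*`. The value on the empty
sequence is the unit of this composition. -/
def ribbonOpAux : (σ : ℕ → Sgn) → (w : List Triangle) → (s : Site m n) →
    (Module.Dual k (Double k H) →ₗ[k] Module.End k (Hilb k H m n))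
  | _, [], _ => (Module.Dual.eval k (Double k H) (doubleOne k H)).smulRight 1
  | σ, τ :: w, s =>
      convComp (dualComul (C := Double k H) (doubleMul k H)) (ribbonOpAux (fun j => σ (j + 1)) w (τ.target s))
        (triangleRibbon k H (σ 0) τ s)

/-- The ribbon operator `F̃_ξ : D(H)^* → End(ℋ)`. -/
def ribbonOp (σ : ℕ → Sgn) (ξ : Ribbon m n) :
    Module.Dual k (Double k H) →ₗ[k] Module.End k (Hilb k H m n) :=
  ribbonOpAux k H σ ξ.triangles ξ.source

end Model

end HopfKitaev

end

set_option linter.unusedSectionVars false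
open scoped TensorProduct

noncomputable section
namespace HopfKitaev
open Coalgebra WithConv MulOpposite

/-! ### Convolution algebras and constants in them. -/

section Convolution

variable {k K A B : Type*} [Field k] [AddCommGroup K] [Module k K] [Coalgebra k K]
  [Ring A] [Algebra k A] [Ring B] [Algebra k B]

/-! All three claims become statements about moving letters through words in one ring. Let R be the
convolution ring of linear maps from `D(H)^*` to `(End V)ᵐᵒᵖ` (`DoubleConv`). The opposite
multiplication makes the order of factors the order in which triangles are applied, so a ribbon
operator is the ordered product in R of its triangle operators (`toOp_ribbonOp`). An element x of
the double also lives in R, as φ ↦ φ(x) 1. Multiplying by it on the left or on the right precomposes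
φ with left or right multiplication by x, so coregular actions are products too. A second
convolution ring, of maps from `H` (or `H^*`) to R, contains the vertex (or face) action w, which is
itself a product of four triangle factors. It also contains the constants and the embedding i of `H`
(or `H^*`) in the double, which is convolution invertible and whose values commute with those of w.

Let p be a triangle factor of w and f a ribbon triangle. The two commute unless they act at the same
arrow in one of three critical positions: p f i = i f p if the ribbon triangle stays at the vertex
(or face), p f = i f p if it leaves, and f p = p f i if it arrives. Leaving an inward arrow requires
S⁻¹ and arriving requires S; while staying at a vertex the two signs must agree. This is exactly
what the compatibility conditions record. A strongly open ribbon stays for fewer than four triangles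
at its initial centre, leaves it and never returns, and symmetrically at its end. Multiplying the
local relations gives w F = i F w at the start and F w = w F i at the end (`pathProd_start`,
`pathProd_end`).

From w F = i F w, Hopf algebra cancellation gives w(h₁) F w(S h₂) = F ∘ (left multiplication by S h)
(`sum_sandwich_left`), and likewise on the right. The versions for `H` and `H^*` combine to the
double because S(a ⊗ h) = (ε ⊗ S h)(S⁻¹a ⊗ 1), provided that the site action is multiplicative on
the double. This last fact is the same path argument, applied to the closed loop around the face
(`vertexAction_loop`).

For the last claim, a nonzero cocommutative integral forces S² = id (`antip_antip_of_integral`,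
`antip_antip_of_integral_dual`), so all signs become irrelevant. At a cocommutative element the loop
operator does not depend on where the loop begins, so it may be started where the ribbon first
reaches the vertex or face. Cutting the ribbon there as F = Y Z gives w Z = i Z w and Y w = w Y i,
and at a cocommutative element the two factors i cancel (`commute_apply_of_middle`).

The definition of S⁻¹ as a ring inverse also requires the bijectivity of the antipode, proved in
`antip_isUnit`. -/

theorem conv_apply (f g : WithConv (K →ₗ[k] A)) {c : K} {ι : Type*} (r : Repr k c ι) :
    (f * g) c = ∑ i ∈ r.index, f (r.left i) * g (r.right i) :=
  r.convMul_apply f g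

/-- Postcomposition with an algebra homomorphism, as a ring homomorphism of convolution rings. -/
def convMap (h : A →ₐ[k] B) : WithConv (K →ₗ[k] A) →+* WithConv (K →ₗ[k] B) where
  toFun f := toConv (h.toLinearMap ∘ₗ f.ofConv)
  map_one' := by ext c; simp
  map_mul' f g := by
    apply WithConv.ext
    exact LinearMap.algHom_comp_convMul_distrib h f g
  map_zero' := by ext c; simp
  map_add' f g := by ext c; simp

@[simp] theorem convMap_apply (h : A →ₐ[k] B) (f : WithConv (K →ₗ[k] A)) (c : K) :
    convMap h f c = h (f c) := rfl

variable (k K) in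
/-- The embedding of an algebra in a convolution algebra by multiples of the counit. -/
def convConst : A →ₐ[k] WithConv (K →ₗ[k] A) :=
  AlgHom.ofLinearMap
    { toFun := fun a => toConv ((counit (R := k) (A := K)).smulRight a)
      map_add' := fun a b => by ext c; simp
      map_smul' := fun r a => by ext c; exact smul_comm _ _ _ }
    (by ext c; simp [Algebra.algebraMap_eq_smul_one])
    (fun a b => by
      ext c
      refine Eq.trans ?_ (conv_apply _ _ (ℛ k c)).symm
      change counit (R := k) c • (a * b) = ∑ i ∈ (ℛ k c).index,
        (counit (R := k) ((ℛ k c).left i) • a) * (counit (R := k) ((ℛ k c).right i) • b)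
      simp only [smul_mul_smul_comm, ← Finset.sum_smul]
      have := congrArg (counit (R := k)) (sum_counit_smul (ℛ k c))
      simp only [map_sum, map_smul, smul_eq_mul] at this
      rw [this])

@[simp] theorem convConst_apply (a : A) (c : K) :
    convConst k K a c = counit (R := k) c • a := rfl

theorem convConst_mul_apply (a : A) (f : WithConv (K →ₗ[k] A)) (c : K) :
    (convConst k K a * f) c = a * f c := by
  rw [conv_apply _ _ (ℛ k c)]
  conv_rhs => rw [← sum_counit_smul (ℛ k c)]
  simp [Finset.mul_sum]

theorem mul_convConst_apply (a : A) (f : WithConv (K →ₗ[k] A)) (c : K) :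
    (f * convConst k K a) c = f c * a := by
  have h : ∑ i ∈ (ℛ k c).index, counit (R := k) ((ℛ k c).right i) • (ℛ k c).left i = c := by
    have := congrArg (TensorProduct.rid k K) (sum_tmul_counit_eq (R := k) (ℛ k c))
    rw [map_sum] at this
    simpa only [TensorProduct.rid_tmul, one_smul] using this
  rw [conv_apply _ _ (ℛ k c)]
  conv_rhs => rw [← h]
  simp [Finset.sum_mul]

theorem conv_sandwich_apply (f g h : WithConv (K →ₗ[k] A)) (a : A) {c : K} {ι κ : Type*}
    (r : Repr k c ι) (r' : ∀ i, Repr k (r.right i) κ) :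
    (f * (convConst k K a * (g * h))) c = ∑ i ∈ r.index, ∑ j ∈ (r' i).index,
      f (r.left i) * (a * (g ((r' i).left j) * h ((r' i).right j))) := by
  rw [conv_apply _ _ r]
  refine Finset.sum_congr rfl fun i _ => ?_
  rw [convConst_mul_apply, conv_apply _ _ (r' i), Finset.mul_sum, Finset.mul_sum]

/-- The nesting of the coproducts is the one produced by straightening in the double and then
letting the middle leg of the coproduct act once more. -/
theorem conv_nested_sandwich_apply (f g h l p : WithConv (K →ₗ[k] A)) (a : A) {c : K}
    {ι κ μ ν : Type*} (r : Repr k c ι) (r' : ∀ i, Repr k (r.right i) κ)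
    (s : ∀ i j, Repr k ((r' i).left j) μ) (s' : ∀ i j l, Repr k ((s i j).right l) ν) :
    (f * ((g * (convConst k K a * (h * l))) * p)) c =
      ∑ i ∈ r.index, ∑ j ∈ (r' i).index, ∑ x ∈ (s i j).index, ∑ y ∈ (s' i j x).index,
        f (r.left i) * ((g ((s i j).left x) *
          (a * (h ((s' i j x).left y) * l ((s' i j x).right y)))) * p ((r' i).right j)) := by
  rw [conv_apply _ _ r]
  refine Finset.sum_congr rfl fun i _ => ?_
  rw [conv_apply _ _ (r' i), Finset.mul_sum]
  refine Finset.sum_congr rfl fun j _ => ?_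
  rw [conv_sandwich_apply _ _ _ _ (s i j) (s' i j)]
  simp only [Finset.mul_sum, Finset.sum_mul]

/-- Two convolution factors with commuting values may be exchanged at a cocommutative element. -/
theorem conv_comm_apply {c : K} (hc : IsCocommutativeElement (k := k) comul c)
    (f g : WithConv (K →ₗ[k] A)) (h : ∀ x y, Commute (f x) (g y)) : (f * g) c = (g * f) c := by
  rw [conv_apply _ _ (ℛ k c)]
  unfold IsCocommutativeElement at hc
  rw [LinearMap.convMul_apply, ← hc, ← (ℛ k c).eq]
  simp only [map_sum, TensorProduct.comm_tmul, TensorProduct.map_tmul, LinearMap.mul'_apply]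
  exact Finset.sum_congr rfl fun i _ => h _ _

end Convolution

/-! ### The antipode: comultiplication and bijectivity. -/

section Antipode

variable {k H A : Type*} [Field k] [Ring H] [HopfAlgebra k H] [Ring A] [Algebra k A]

open HopfAlgebra

theorem antip_mul (x y : H) : antip k H (x * y) = antip k H y * antip k H x :=
  antipode_mul_antidistrib x y

@[simp] theorem antip_one : antip k H 1 = 1 := antipode_one

@[simp] theorem counit_antip (x : H) : counit (R := k) (antip k H x) = counit (R := k) x :=
  counit_antipode x

theorem antip_conv (f : H →ₐ[k] A) :
    toConv (f.toLinearMap ∘ₗ antip k H) * toConv f.toLinearMap = 1 := by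
  have := congrArg (convMap f) (LinearMap.antipode_mul_id (R := k) (C := H))
  rwa [map_mul, map_one] at this

theorem conv_antip (f : H →ₐ[k] A) :
    toConv f.toLinearMap * toConv (f.toLinearMap ∘ₗ antip k H) = 1 := by
  have := congrArg (convMap f) (LinearMap.id_mul_antipode (R := k) (C := H))
  rwa [map_mul, map_one] at this

-- Both sides, as functions of `x`, are convolution inverse to Δ, which is the convolution product
-- of the two inclusions of `H` in `H ⊗ H`.
open Algebra.TensorProduct in
theorem comul_antip (x : H) :
    comul (R := k) (antip k H x) =
      TensorProduct.comm k H H (TensorProduct.map (antip k H) (antip k H) (comul x)) := by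
  let l : H →ₐ[k] H ⊗[k] H := includeLeft
  let r : H →ₐ[k] H ⊗[k] H := includeRight
  let D := Bialgebra.comulAlgHom k H
  have hD : toConv l.toLinearMap * toConv r.toLinearMap = toConv D.toLinearMap := by
    ext c
    rw [conv_apply _ _ (ℛ k c)]
    simp [l, r, D, ← (ℛ k c).eq]
  have h1 : toConv (r.toLinearMap ∘ₗ antip k H) * toConv (l.toLinearMap ∘ₗ antip k H) *
      toConv D.toLinearMap = 1 := by
    rw [← hD, mul_assoc, ← mul_assoc (toConv (l.toLinearMap ∘ₗ antip k H)), antip_conv, one_mul,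
      antip_conv]
  have h2 := left_inv_eq_right_inv h1 (conv_antip D)
  have h3 := LinearMap.congr_fun (congrArg ofConv h2) x
  rw [conv_apply _ _ (ℛ k x)] at h3
  simp [l, r, D] at h3
  rw [← h3, ← (ℛ k x).eq]
  simp

/-- A representation of `Δ (S x)`. -/
@[simps] def antipRepr {x : H} {ι : Type*} (r : Repr k x ι) : Repr k (antip k H x) ι where
  index := r.index
  left i := antip k H (r.right i)
  right i := antip k H (r.left i)
  eq := by
    rw [comul_antip, ← r.eq]
    simp

theorem antip_pow_even_comul (n : ℕ) (x : H) :
    comul (R := k) (((antip k H) ^ (2 * n)) x) =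
      TensorProduct.map ((antip k H) ^ (2 * n)) ((antip k H) ^ (2 * n)) (comul x) := by
  induction n generalizing x with
  | zero => simp [Module.End.one_eq_id]
  | succ n ih =>
    rw [mul_add, mul_one, pow_add, pow_two, Module.End.mul_apply, ih, Module.End.mul_apply,
      comul_antip, comul_antip, ← (ℛ k x).eq]
    simp

theorem counit_antip_pow (n : ℕ) (x : H) :
    counit (R := k) (((antip k H) ^ n) x) = counit (R := k) x := by
  induction n generalizing x with
  | zero => simp
  | succ n ih => rw [pow_succ, Module.End.mul_apply, ih, counit_antip]

/-- Every power of the antipode is multiplicative or anti-multiplicative, so its value on a product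
depends only on its values on the factors. -/
theorem antip_pow_conv_congr (n : ℕ) {f f' g g' : WithConv (H →ₗ[k] H)}
    (hf : (antip k H ^ n) ∘ₗ f.ofConv = (antip k H ^ n) ∘ₗ f'.ofConv)
    (hg : (antip k H ^ n) ∘ₗ g.ofConv = (antip k H ^ n) ∘ₗ g'.ofConv) :
    (antip k H ^ n) ∘ₗ (f * g).ofConv = (antip k H ^ n) ∘ₗ (f' * g').ofConv := by
  have key : ∀ n : ℕ, (∀ x y : H, (antip k H ^ n) (x * y) = (antip k H ^ n) x * (antip k H ^ n) y) ∨
      (∀ x y : H, (antip k H ^ n) (x * y) = (antip k H ^ n) y * (antip k H ^ n) x) := by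
    intro n
    induction n with
    | zero => left; simp
    | succ n ih =>
      rcases ih with h | h
      · right; intro x y; simp [pow_succ, antip_mul, h]
      · left; intro x y; simp [pow_succ, antip_mul, h]
  have hf' := LinearMap.congr_fun hf
  have hg' := LinearMap.congr_fun hg
  simp only [LinearMap.comp_apply] at hf' hg'
  ext x
  simp only [LinearMap.comp_apply]
  erw [conv_apply f g (ℛ k x), conv_apply f' g' (ℛ k x)]
  rw [map_sum, map_sum]
  refine Finset.sum_congr rfl fun i _ => ?_
  rcases key n with h | h <;> rw [h, h, hf', hg']

/-- The commutative algebra k[f] is Artinian, so the ideals generated by powers of f stabilise. The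
witness `g` is a polynomial in `f`, whence the commutation. -/
theorem exists_fitting {V : Type*} [AddCommGroup V] [Module k V] [FiniteDimensional k V]
    (f : Module.End k V) : ∃ (n : ℕ) (g : Module.End k V), f * g = g * f ∧ f ^ (n + 1) * g = f ^ n := by
  let a : Algebra.adjoin k {f} := ⟨f, Algebra.self_mem_adjoin_singleton k f⟩
  have : IsArtinianRing (Algebra.adjoin k {f}) := IsArtinianRing.of_finite k _
  have : IsMulCommutative (Algebra.adjoin k {f}) := Algebra.isMulCommutative_adjoin k (by simp)
  obtain ⟨n, y, hy⟩ := IsArtinian.exists_pow_succ_smul_dvd a (1 : Algebra.adjoin k {f})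
  refine ⟨n, y, ?_, ?_⟩
  · exact congrArg Subtype.val (mul_comm' a y)
  · simpa using congrArg Subtype.val hy

-- Fitting's lemma for S² yields π with S²ⁿ π = S²ⁿ, and π turns out to be a coalgebra map. Then S ∘
-- π is convolution inverse to π, and powers of S can be stripped from S²ⁿ π = S²ⁿ one at a time
-- until π = id, which makes S²ⁿ invertible.
variable (k H) in
theorem antip_isUnit [FiniteDimensional k H] : IsUnit (antip k H) := by
  obtain ⟨n, g₀, hc, hn⟩ := exists_fitting (antip k H ^ 2)
  set F := antip k H ^ (2 * n) with hF
  have hFn : F = (antip k H ^ 2) ^ n := by rw [hF, pow_mul]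
  set G := g₀ ^ n with hG
  set π : Module.End k H := F * G with hπ
  have hcomm : Commute (antip k H ^ 2) g₀ := hc
  have hFG : Commute F G := by rw [hFn, hG]; exact hcomm.pow_pow n n
  have hpow : ∀ j, (antip k H ^ 2) ^ (n + j) * g₀ ^ j = F := by
    intro j
    induction j with
    | zero => simp [hFn]
    | succ j ih =>
      have : (antip k H ^ 2) ^ (n + (j + 1)) * g₀ ^ (j + 1) =
          (antip k H ^ 2) ^ j * ((antip k H ^ 2) ^ (n + 1) * g₀) * g₀ ^ j := by
        rw [show n + (j + 1) = j + (n + 1) by ring, pow_add _ j, pow_succ' g₀]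
        simp only [mul_assoc]
      rw [this, hn, ← pow_add, add_comm j n, ih]
  have hFπ : F * π = F := by
    rw [hπ, ← mul_assoc, hG]
    conv_lhs => rw [hFn, ← pow_add]
    exact hpow n
  have hπF : π * F = F := by rw [hπ, mul_assoc, ← hFG.eq]; exact hFπ
  have hΔF : comul (R := k) ∘ₗ F = TensorProduct.map F F ∘ₗ comul :=
    LinearMap.ext fun x => antip_pow_even_comul n x
  -- Although `G` need not be comultiplicative, both sides equal (π ⊗ π) Δ π. One uses F π = F after
  -- writing π ⊗ π through `G` and `F`, the other uses π F = F after writing Δ π as (F ⊗ F) Δ G.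
  have hΔπ : comul (R := k) ∘ₗ π = TensorProduct.map π π ∘ₗ comul := by
    have e1 : TensorProduct.map π π ∘ₗ comul (R := k) =
        TensorProduct.map π π ∘ₗ comul ∘ₗ π := by
      have h1 : TensorProduct.map π π ∘ₗ comul (R := k) = TensorProduct.map G G ∘ₗ comul ∘ₗ F := by
        rw [hΔF, ← LinearMap.comp_assoc, ← TensorProduct.map_comp, ← Module.End.mul_eq_comp,
          ← hFG.eq]
      rw [← LinearMap.comp_assoc, h1, LinearMap.comp_assoc, LinearMap.comp_assoc,
        ← Module.End.mul_eq_comp F π, hFπ]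
    have e2 : comul (R := k) ∘ₗ π = TensorProduct.map π π ∘ₗ comul ∘ₗ π := by
      have h1 : comul (R := k) ∘ₗ π = TensorProduct.map F F ∘ₗ comul ∘ₗ G := by
        rw [hπ, Module.End.mul_eq_comp, ← LinearMap.comp_assoc, hΔF, LinearMap.comp_assoc]
      rw [h1, ← LinearMap.comp_assoc _ _ (TensorProduct.map π π), ← TensorProduct.map_comp,
        ← Module.End.mul_eq_comp, hπF]
    rw [e2, ← e1]
  have hεF : ∀ x, counit (R := k) (F x) = counit (R := k) x := counit_antip_pow (2 * n)
  have hεπ : ∀ x, counit (R := k) (π x) = counit (R := k) x := fun x => by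
    rw [← hεF (π x), ← Module.End.mul_apply, hFπ, hεF]
  have hπS : toConv π * toConv (antip k H ∘ₗ π) = 1 := by
    apply WithConv.ext
    have h1 := congrArg ofConv (LinearMap.id_mul_antipode (R := k) (C := H))
    have h2 := congrArg (· ∘ₗ π) h1
    simp only [LinearMap.convMul_def, LinearMap.convOne_def, LinearMap.comp_assoc] at h2 ⊢
    rw [hΔπ, ← LinearMap.comp_assoc _ _ (TensorProduct.map _ _), ← TensorProduct.map_comp] at h2
    refine h2.trans ?_
    ext x
    simp [hεπ]
  have hid : toConv π * (toConv (antip k H ∘ₗ π) * toConv LinearMap.id) = toConv LinearMap.id := by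
    rw [← mul_assoc, hπS, one_mul]
  -- If S^(j+1) π = S^(j+1), then S^j does not distinguish (S ∘ π) * id from S * id = 1. Convolving
  -- with π on the left turns the former into id and the latter into π, so S^j = S^j π.
  have hdown : ∀ j, (antip k H ^ j) ∘ₗ π = antip k H ^ j → π = 1 := by
    intro j
    induction j with
    | zero => intro h; simpa [Module.End.one_eq_id] using h
    | succ j ih =>
      intro h
      apply ih
      have h1 : (antip k H ^ j) ∘ₗ (toConv (antip k H ∘ₗ π) * toConv LinearMap.id).ofConv =
          (antip k H ^ j) ∘ₗ (1 : WithConv (H →ₗ[k] H)).ofConv := by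
        rw [← LinearMap.antipode_mul_id]
        apply antip_pow_conv_congr
        · rw [pow_succ] at h
          exact h
        · rfl
      have h2 := antip_pow_conv_congr j (f := toConv π) (f' := toConv π) rfl h1
      rw [hid, mul_one] at h2
      exact h2.symm
  have hπ1 : π = 1 := hdown (2 * n) hFπ
  -- For n = 0 the power S²ⁿ is the identity and carries no information, but then the Fitting
  -- relation itself says that S² has the inverse `g₀`.
  by_cases h0 : n = 0
  · subst h0
    have h3 : antip k H ^ 2 * g₀ = 1 := by simpa using hn
    have h4 : g₀ * antip k H ^ 2 = 1 := hc ▸ h3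
    have : IsUnit (antip k H ^ 2) := ⟨⟨_, _, h3, h4⟩, rfl⟩
    exact (isUnit_pow_iff two_ne_zero).1 this
  · have : IsUnit F := ⟨⟨F, G, hπ1, hFG.eq ▸ hπ1⟩, rfl⟩
    exact (isUnit_pow_iff (by omega)).1 this

section Inverse

variable [FiniteDimensional k H]

@[simp] theorem antip_antipInv (x : H) : antip k H (antipInv k H x) = x := by
  rw [← Module.End.mul_apply, antipInv, Ring.mul_inverse_cancel _ (antip_isUnit k H),
    Module.End.one_apply]

@[simp] theorem antipInv_antip (x : H) : antipInv k H (antip k H x) = x := by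
  rw [← Module.End.mul_apply, antipInv, Ring.inverse_mul_cancel _ (antip_isUnit k H),
    Module.End.one_apply]

theorem antip_injective : Function.Injective (antip k H) :=
  Function.LeftInverse.injective antipInv_antip

theorem antipInv_mul (x y : H) : antipInv k H (x * y) = antipInv k H y * antipInv k H x :=
  antip_injective (k := k) (by simp [antip_mul])

@[simp] theorem antipInv_one : antipInv k H 1 = 1 := antip_injective (k := k) (by simp)

theorem comul_antipInv (x : H) :
    comul (R := k) (antipInv k H x) =
      TensorProduct.comm k H H (TensorProduct.map (antipInv k H) (antipInv k H) (comul x)) := by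
  have h := comul_antip (k := k) (antipInv k H x)
  rw [antip_antipInv] at h
  rw [h, ← (ℛ k (antipInv k H x)).eq]
  simp

/-- A representation of `Δ (S⁻¹ x)`. -/
@[simps] def antipInvRepr {x : H} {ι : Type*} (r : Repr k x ι) : Repr k (antipInv k H x) ι where
  index := r.index
  left i := antipInv k H (r.right i)
  right i := antipInv k H (r.left i)
  eq := by
    rw [comul_antipInv, ← r.eq]
    simp

end Inverse

end Antipode

/-! ### The coalgebra dual to a finite-dimensional algebra. -/

section DualCoalgebra

variable {k C M : Type*} [Field k] [AddCommGroup C] [Module k C] [FiniteDimensional k C]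
  [AddCommMonoid M] [Module k M]

/-- Evaluation of the left factor, `a ⊗ z ↦ a(y) z`. -/
def evalLeft (y : C) : Module.Dual k C ⊗[k] M →ₗ[k] M :=
  (TensorProduct.lid k M).toLinearMap ∘ₗ (Module.Dual.eval k C y).rTensor M

@[simp] theorem evalLeft_tmul (y : C) (a : Module.Dual k C) (z : M) :
    evalLeft y (a ⊗ₜ[k] z) = a y • z := by
  simp [evalLeft]

/-- Expansion in a dual basis recovers a tensor from its evaluations. Identities in tensor powers of
a dual space are checked this way throughout. -/
theorem evalLeft_ext {t t' : Module.Dual k C ⊗[k] M} (h : ∀ y, evalLeft y t = evalLeft y t') :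
    t = t' := by
  let b := Module.finBasis k C
  have key : ∀ t : Module.Dual k C ⊗[k] M, t = ∑ i, b.coord i ⊗ₜ[k] evalLeft (b i) t := by
    intro t
    induction t with
    | zero => simp
    | add x y hx hy =>
      conv_lhs => rw [hx, hy]
      simp [TensorProduct.tmul_add, Finset.sum_add_distrib]
    | tmul a z =>
      simp only [evalLeft_tmul, ← TensorProduct.smul_tmul, ← TensorProduct.sum_tmul]
      congr 1
      apply b.ext
      intro j
      simp
  rw [key t, key t']
  simp only [h]

theorem dualDistrib_dualComul (μ : C ⊗[k] C →ₗ[k] C) (φ : Module.Dual k C) (z : C ⊗[k] C) :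
    TensorProduct.dualDistrib k C C (dualComul μ φ) z = φ (μ z) := by
  have : TensorProduct.dualDistribEquiv k C C (dualComul μ φ) = φ ∘ₗ μ := by
    simp only [dualComul, LinearMap.comp_apply, LinearEquiv.coe_coe, LinearEquiv.apply_symm_apply]
    rfl
  exact LinearMap.congr_fun this z

/-- Evaluating one leg of the dual coproduct is translation by an element, so coalgebra identities
for the dual reduce to algebra identities. -/
theorem evalLeft_dualComul (μ : C ⊗[k] C →ₗ[k] C) (φ : Module.Dual k C) (x : C) :
    evalLeft x (dualComul μ φ) = φ ∘ₗ μ ∘ₗ TensorProduct.mk k C C x := by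
  ext y
  have h := dualDistrib_dualComul μ φ (x ⊗ₜ y)
  simp only [LinearMap.comp_apply, TensorProduct.mk_apply]
  rw [← h]
  generalize dualComul μ φ = t
  induction t with
  | zero => simp
  | add a b ha hb => simp [ha, hb]
  | tmul a b => simp

theorem evalLeft_lTensor {N : Type*} [AddCommMonoid N] [Module k N] (f : M →ₗ[k] N) (y : C)
    (t : Module.Dual k C ⊗[k] M) : evalLeft y (f.lTensor _ t) = f (evalLeft y t) := by
  induction t with
  | zero => simp
  | add a b ha hb => simp [ha, hb]
  | tmul a b => simp

/-- The coalgebra dual to a finite-dimensional algebra with product `μ` and unit `e`. -/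
@[reducible] def dualCoalgebra (μ : C ⊗[k] C →ₗ[k] C) (e : C)
    (assoc : ∀ x y z, μ (μ (x ⊗ₜ y) ⊗ₜ z) = μ (x ⊗ₜ μ (y ⊗ₜ z)))
    (one_mul : ∀ x, μ (e ⊗ₜ x) = x) (mul_one : ∀ x, μ (x ⊗ₜ e) = x) :
    Coalgebra k (Module.Dual k C) where
  comul := dualComul μ
  counit := Module.Dual.eval k C e
  coassoc := by
    ext φ : 1
    apply evalLeft_ext
    intro x
    apply evalLeft_ext
    intro y
    ext z
    simp only [LinearMap.comp_apply, LinearEquiv.coe_coe]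
    rw [evalLeft_lTensor, evalLeft_dualComul, evalLeft_dualComul]
    have h1 : ∀ t : Module.Dual k C ⊗[k] Module.Dual k C,
        evalLeft y (evalLeft x (TensorProduct.assoc k _ _ _ ((dualComul μ).rTensor _ t))) z =
          evalLeft (μ (x ⊗ₜ y)) t z := by
      intro t
      induction t with
      | zero => simp
      | add a b ha hb => simp [ha, hb]
      | tmul a b =>
        have : evalLeft y (evalLeft x (TensorProduct.assoc k _ _ _ (dualComul μ a ⊗ₜ[k] b))) =
            (evalLeft x (dualComul μ a)) y • b := by
          generalize dualComul μ a = s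
          induction s with
          | zero => simp
          | add p q hp hq => simp [TensorProduct.add_tmul, hp, hq, add_smul]
          | tmul p q => simp [mul_smul]
        simp only [LinearMap.rTensor_tmul, this, evalLeft_dualComul, evalLeft_tmul]
        simp
    rw [h1, evalLeft_dualComul]
    simp [assoc]
  rTensor_counit_comp_comul := by
    ext φ
    apply (TensorProduct.lid k _).injective
    have := evalLeft_dualComul μ φ e
    simp only [evalLeft, LinearMap.comp_apply, LinearEquiv.coe_coe] at this
    simp only [LinearMap.comp_apply, this]
    ext x
    simp [one_mul]
  lTensor_counit_comp_comul := by
    ext φ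
    apply evalLeft_ext
    intro x
    simp only [LinearMap.comp_apply, evalLeft_lTensor, evalLeft_dualComul]
    simp [mul_one]

end DualCoalgebra

/-! ### Explicit formulas for the structure maps of the double. -/

section Double

variable {k H : Type*} [Field k] [Ring H] [HopfAlgebra k H] [FiniteDimensional k H]

variable (k H) in
/-- The coalgebra structure of `H^*` dual to the product of `H`. -/
@[reducible] def hopfDualCoalgebra : Coalgebra k (Module.Dual k H) :=
  dualCoalgebra (LinearMap.mul' k H) 1 (by simp [mul_assoc]) (by simp) (by simp)

@[simp] theorem sandwich_apply (b : Module.Dual k H) (u w x : H) :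
    sandwich k H b u w x = b (u * (x * w)) := rfl

theorem outerMiddle_eq {h : H} {ι κ : Type*} (r : Repr k h ι) (r' : ∀ i, Repr k (r.right i) κ) :
    outerMiddle k H h = ∑ i ∈ r.index, ∑ j ∈ (r' i).index,
      (r.left i ⊗ₜ[k] (r' i).right j) ⊗ₜ[k] (r' i).left j := by
  simp only [outerMiddle, LinearMap.comp_apply, LinearEquiv.coe_coe, ← r.eq, map_sum,
    LinearMap.lTensor_tmul, ← (r' _).eq, TensorProduct.tmul_sum, TensorProduct.comm_tmul,
    TensorProduct.assoc_symm_tmul]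

theorem coadjoint_tmul (f g : Module.End k H) (b : Module.Dual k H) {h : H} {ι κ : Type*}
    (r : Repr k h ι) (r' : ∀ i, Repr k (r.right i) κ) :
    coadjoint k H f g (b ⊗ₜ h) = ∑ i ∈ r.index, ∑ j ∈ (r' i).index,
      sandwich k H b (f (r.left i)) (g ((r' i).right j)) ⊗ₜ[k] (r' i).left j := by
  simp only [coadjoint, TensorProduct.lift.tmul, LinearMap.mk₂_apply, outerMiddle_eq r r', map_sum,
    LinearMap.rTensor_tmul, LinearMap.compl₁₂_apply]

theorem doubleMul_tmul (a b : Module.Dual k H) (h g : H) :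
    doubleMul k H ((a ⊗ₜ h) ⊗ₜ (b ⊗ₜ g)) =
      TensorProduct.map (dualMul k H ∘ₗ (TensorProduct.mk k _ _).flip a) (LinearMap.mulRight k g)
        (coadjoint k H (antip k H) LinearMap.id (b ⊗ₜ h)) := by
  simp only [doubleMul, LinearMap.comp_apply, LinearEquiv.coe_coe, TensorProduct.assoc_tmul,
    LinearMap.lTensor_tmul, TensorProduct.assoc_symm_tmul, LinearMap.rTensor_tmul,
    TensorProduct.comm_tmul]
  generalize coadjoint k H (antip k H) LinearMap.id (b ⊗ₜ h) = t
  induction t using TensorProduct.induction_on with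
  | zero => simp
  | add x y hx hy => simp only [TensorProduct.add_tmul, TensorProduct.tmul_add, map_add, hx, hy]
  | tmul c x => simp

theorem dualMul_tmul_apply (a b : Module.Dual k H) {x : H} {ι : Type*} (r : Repr k x ι) :
    dualMul k H (a ⊗ₜ b) x = ∑ i ∈ r.index, a (r.left i) * b (r.right i) := by
  simp [dualMul, ← r.eq]

end Double

/-! ### Associativity, unit and antipode formula of the double. -/

section DoubleProduct

variable {k H : Type*} [Field k] [Ring H] [HopfAlgebra k H] [FiniteDimensional k H]

theorem dualMul_tmul (a b : Module.Dual k H) :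
    dualMul k H (a ⊗ₜ b) = (toConv a * toConv b).ofConv := by
  ext x
  rw [dualMul_tmul_apply a b (ℛ k x)]
  exact (conv_apply (toConv a) (toConv b) (ℛ k x)).symm

theorem dualMul_assoc (a b c : Module.Dual k H) :
    dualMul k H (dualMul k H (a ⊗ₜ b) ⊗ₜ c) = dualMul k H (a ⊗ₜ dualMul k H (b ⊗ₜ c)) := by
  simp only [dualMul_tmul, toConv_ofConv, mul_assoc]

theorem toConv_counit : toConv (counit (R := k) (A := H)) = 1 := by
  ext x
  simp

theorem dualMul_counit (a : Module.Dual k H) : dualMul k H (a ⊗ₜ counit) = a := by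
  rw [dualMul_tmul, toConv_counit, mul_one]

theorem counit_dualMul (a : Module.Dual k H) : dualMul k H (counit ⊗ₜ a) = a := by
  rw [dualMul_tmul, toConv_counit, one_mul]

theorem doubleMul_tmul_repr (a b : Module.Dual k H) (g : H) {h : H} {ι κ : Type*}
    (r : Repr k h ι) (r' : ∀ i, Repr k (r.right i) κ) :
    doubleMul k H ((a ⊗ₜ h) ⊗ₜ (b ⊗ₜ g)) = ∑ i ∈ r.index, ∑ j ∈ (r' i).index,
      dualMul k H (sandwich k H b (antip k H (r.left i)) ((r' i).right j) ⊗ₜ a) ⊗ₜ[k]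
        ((r' i).left j * g) := by
  rw [doubleMul_tmul, coadjoint_tmul _ _ _ r r']
  simp

variable {E : Type*} [Semiring E] [Algebra k E]

/-- The linear map `a ⊗ h ↦ B(a) V(h)` on the double. -/
def doubleRep (B : Module.Dual k H →ₗ[k] E) (V : H →ₗ[k] E) : Double k H →ₗ[k] E :=
  LinearMap.mul' k E ∘ₗ TensorProduct.map B V

@[simp] theorem doubleRep_tmul (B : Module.Dual k H →ₗ[k] E) (V : H →ₗ[k] E) (a : Module.Dual k H)
    (h : H) : doubleRep B V (a ⊗ₜ h) = B a * V h := by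
  simp [doubleRep]

/-- The only nontrivial move in (a ⊗ h)(b ⊗ g) is to straighten h past b. A pair of
(anti)multiplicative maps that obeys this single rule therefore respects the whole product. It is
used for the left regular representation, giving associativity, and for site actions. -/
theorem doubleRep_doubleMul (B : Module.Dual k H →ₗ[k] E) (V : H →ₗ[k] E)
    (hB : ∀ a b, B (dualMul k H (a ⊗ₜ b)) = B b * B a) (hV : ∀ g h, V (g * h) = V g * V h)
    (hc : ∀ a h, doubleRep B V (coadjoint k H (antip k H) LinearMap.id (a ⊗ₜ h)) = V h * B a)
    (x y : Double k H) :
    doubleRep B V (doubleMul k H (x ⊗ₜ y)) = doubleRep B V x * doubleRep B V y := by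
  induction x using TensorProduct.induction_on with
  | zero => simp
  | add x x' hx hx' => simp only [TensorProduct.add_tmul, map_add, hx, hx', add_mul]
  | tmul a h =>
    induction y using TensorProduct.induction_on with
    | zero => simp
    | add y y' hy hy' => simp only [TensorProduct.tmul_add, map_add, hy, hy', mul_add]
    | tmul b g =>
      have h1 := hc b h
      let r := ℛ k h
      let r' := fun i => ℛ k (r.right i)
      rw [doubleMul_tmul_repr a b g r r']
      rw [coadjoint_tmul _ _ _ r r'] at h1
      simp only [map_sum, doubleRep_tmul, LinearMap.id_apply] at h1 ⊢
      rw [mul_assoc, ← mul_assoc (V h), ← h1]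
      simp only [Finset.sum_mul, Finset.mul_sum, hB, hV, mul_assoc]

variable (k H) in
/-- Left multiplication in the double by elements of `H^*`. -/
def doubleLeftDual : Module.Dual k H →ₗ[k] Module.End k (Double k H) where
  toFun a := (dualMul k H ∘ₗ (TensorProduct.mk k _ _).flip a).rTensor H
  map_add' a b := by
    rw [← LinearMap.rTensor_add]
    congr 1
    ext c : 1
    simp
  map_smul' c a := by
    rw [RingHom.id_apply, ← LinearMap.rTensor_smul]
    congr 1
    ext c : 1
    simp

variable (k H) in
/-- Left multiplication in the double by elements of `H`. -/
def doubleLeft : H →ₗ[k] Module.End k (Double k H) :=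
  TensorProduct.curry (doubleMul k H) ∘ₗ TensorProduct.mk k _ _ counit

theorem doubleLeftDual_tmul (a b : Module.Dual k H) (g : H) :
    doubleLeftDual k H a (b ⊗ₜ g) = dualMul k H (b ⊗ₜ a) ⊗ₜ g := rfl

theorem doubleLeft_tmul (b : Module.Dual k H) (g : H) {h : H} {ι κ : Type*}
    (r : Repr k h ι) (r' : ∀ i, Repr k (r.right i) κ) :
    doubleLeft k H h (b ⊗ₜ g) = ∑ i ∈ r.index, ∑ j ∈ (r' i).index,
      sandwich k H b (antip k H (r.left i)) ((r' i).right j) ⊗ₜ[k] ((r' i).left j * g) := by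
  change doubleMul k H ((counit ⊗ₜ h) ⊗ₜ (b ⊗ₜ g)) = _
  rw [doubleMul_tmul_repr _ _ _ r r']
  simp only [dualMul_counit]

theorem doubleRep_doubleLeft (x y : Double k H) :
    doubleRep (doubleLeftDual k H) (doubleLeft k H) x y = doubleMul k H (x ⊗ₜ y) := by
  induction x using TensorProduct.induction_on with
  | zero => simp
  | add x x' hx hx' => simp only [TensorProduct.add_tmul, map_add, LinearMap.add_apply, hx, hx']
  | tmul a h =>
    induction y using TensorProduct.induction_on with
    | zero => simp
    | add y y' hy hy' => simp only [TensorProduct.tmul_add, map_add, hy, hy']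
    | tmul b g =>
      let r := ℛ k h
      let r' := fun i => ℛ k (r.right i)
      rw [doubleMul_tmul_repr a b g r r', doubleRep_tmul,
        Module.End.mul_apply, doubleLeft_tmul b g r r']
      simp only [map_sum, doubleLeftDual_tmul]

theorem doubleLeftDual_mul (a b : Module.Dual k H) :
    doubleLeftDual k H (dualMul k H (a ⊗ₜ b)) = doubleLeftDual k H b * doubleLeftDual k H a := by
  apply TensorProduct.ext'
  intro c g
  simp only [Module.End.mul_apply, doubleLeftDual_tmul, dualMul_assoc]

theorem doubleLeft_mul (g h : H) :
    doubleLeft k H (g * h) = doubleLeft k H g * doubleLeft k H h := by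
  apply TensorProduct.ext'
  intro b x
  let r := ℛ k g
  let r' := fun i => ℛ k (r.right i)
  let s := ℛ k h
  let s' := fun i => ℛ k (s.right i)
  rw [Module.End.mul_apply, doubleLeft_tmul b x s s',
    doubleLeft_tmul b x (r.mul s) fun i => (r' i.1).mul (s' i.2)]
  simp only [map_sum, doubleLeft_tmul _ _ r r']
  simp only [Repr.mul_index, Repr.mul_left, Repr.mul_right, Finset.sum_product, antip_mul]
  rw [Finset.sum_comm]
  refine Finset.sum_congr rfl fun i _ => ?_
  conv_rhs => rw [Finset.sum_comm]
  refine Finset.sum_congr rfl fun i' _ => ?_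
  rw [Finset.sum_comm]
  refine Finset.sum_congr rfl fun j _ => Finset.sum_congr rfl fun j' _ => ?_
  rw [mul_assoc]
  congr 1
  ext z
  simp [mul_assoc]

theorem dualDistrib_sandwich (a b : Module.Dual k H) (u u' w w' : H) (t : H ⊗[k] H) :
    TensorProduct.dualDistrib k H H (sandwich k H b u w ⊗ₜ sandwich k H a u' w') t =
      TensorProduct.dualDistrib k H H (b ⊗ₜ a) (u ⊗ₜ u' * (t * w ⊗ₜ w')) := by
  induction t with
  | zero => simp
  | add x y hx hy => simp only [map_add, hx, hy, add_mul, mul_add]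
  | tmul x y => simp

theorem dualMul_apply (a b : Module.Dual k H) (x : H) :
    dualMul k H (a ⊗ₜ b) x = TensorProduct.dualDistrib k H H (a ⊗ₜ b) (comul x) := rfl

/-- The straightening rule for left multiplications. It amounts to expanding Δ(S(h₁) y h₃), using
that Δ is multiplicative and that Δ S reverses the two legs. The third tensor factor carries the
middle leg of h. -/
theorem doubleLeft_mul_doubleLeftDual (a : Module.Dual k H) (h : H) :
    doubleRep (doubleLeftDual k H) (doubleLeft k H)
      (coadjoint k H (antip k H) LinearMap.id (a ⊗ₜ h)) =
      doubleLeft k H h * doubleLeftDual k H a := by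
  apply TensorProduct.ext'
  intro b g
  let i₁ : H →ₐ[k] (H ⊗[k] H) ⊗[k] H :=
    Algebra.TensorProduct.includeLeft.comp Algebra.TensorProduct.includeLeft
  let i₂ : H →ₐ[k] (H ⊗[k] H) ⊗[k] H :=
    Algebra.TensorProduct.includeLeft.comp Algebra.TensorProduct.includeRight
  let i₃ : H →ₐ[k] (H ⊗[k] H) ⊗[k] H := Algebra.TensorProduct.includeRight
  let D : H →ₐ[k] (H ⊗[k] H) ⊗[k] H :=
    Algebra.TensorProduct.includeLeft.comp (Bialgebra.comulAlgHom k H)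
  have hD : toConv D.toLinearMap = toConv i₁.toLinearMap * toConv i₂.toLinearMap := by
    ext c
    rw [conv_apply _ _ (ℛ k c)]
    simp [i₁, i₂, D, ← (ℛ k c).eq]
  have hS : toConv (D.toLinearMap ∘ₗ antip k H) =
      toConv (i₂.toLinearMap ∘ₗ antip k H) * toConv (i₁.toLinearMap ∘ₗ antip k H) := by
    ext c
    rw [conv_apply _ _ (ℛ k c)]
    simp [i₁, i₂, D, ← (antipRepr (ℛ k c)).eq]
  let r := ℛ k h
  let r' := fun i => ℛ k (r.right i)
  let s := fun i j => ℛ k ((r' i).left j)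
  let s' := fun i j l => ℛ k ((s i j).right l)
  apply evalLeft_ext
  intro y
  let Y : (H ⊗[k] H) ⊗[k] H := comul y ⊗ₜ 1
  let F : (H ⊗[k] H) ⊗[k] H →ₗ[k] H := LinearMap.mulRight k g ∘ₗ
    (TensorProduct.lid k H).toLinearMap ∘ₗ (TensorProduct.dualDistrib k H H (b ⊗ₜ a)).rTensor H
  let S₁ := toConv (i₁.toLinearMap ∘ₗ antip k H)
  let S₂ := toConv (i₂.toLinearMap ∘ₗ antip k H)
  let c := convConst k H Y
  -- Here Δ = i₁ * i₂ and Δ S = (i₂ S) * (i₁ S), so the two sides differ only in bracketing. Applied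
  -- to h, they expand to the two sides of the goal.
  have key : S₂ * ((S₁ * (c * (toConv i₃.toLinearMap * toConv i₁.toLinearMap))) *
      toConv i₂.toLinearMap) = toConv (D.toLinearMap ∘ₗ antip k H) *
        (c * (toConv i₃.toLinearMap * toConv D.toLinearMap)) := by
    rw [hD, hS]
    simp only [mul_assoc, S₁, S₂]
  have key' := congrArg F (DFunLike.congr_fun (congrArg ofConv key) h)
  simp only [S₁, S₂, c] at key'
  rw [conv_nested_sandwich_apply _ _ _ _ _ _ r r' s s', conv_sandwich_apply _ _ _ _ r r'] at key'
  rw [Module.End.mul_apply, doubleLeftDual_tmul, doubleLeft_tmul _ _ r r',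
    coadjoint_tmul _ _ _ r r']
  simp only [map_sum, LinearMap.sum_apply, doubleRep_tmul,
    Module.End.mul_apply, fun i j => doubleLeft_tmul b g (s i j) (s' i j), doubleLeftDual_tmul,
    evalLeft_tmul, dualMul_apply, dualDistrib_sandwich, sandwich_apply, Bialgebra.comul_mul]
  have hm : ∀ (t : H ⊗[k] H) (x z : H), t * x ⊗ₜ[k] 1 * 1 ⊗ₜ[k] z = t * x ⊗ₜ[k] z := by
    intro t x z
    rw [mul_assoc, Algebra.TensorProduct.tmul_mul_tmul, mul_one, one_mul]
  simpa [Y, F, i₁, i₂, i₃, D, ← mul_assoc, hm] using key'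

/-- Left multiplication by x is the image of x under the pair of regular actions, and this pair is
multiplicative, so associativity follows by evaluating at z. -/
theorem doubleMul_assoc (x y z : Double k H) :
    doubleMul k H (doubleMul k H (x ⊗ₜ y) ⊗ₜ z) = doubleMul k H (x ⊗ₜ doubleMul k H (y ⊗ₜ z)) := by
  simp only [← doubleRep_doubleLeft]
  have h := doubleRep_doubleMul (doubleLeftDual k H) (doubleLeft k H) doubleLeftDual_mul doubleLeft_mul
    doubleLeft_mul_doubleLeftDual x y
  have h' := LinearMap.congr_fun h z
  rw [Module.End.mul_apply] at h'
  rw [← h', doubleRep_doubleLeft x]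

/-- A representation of `Δ 1`. -/
@[simps] def oneRepr : Repr k (1 : H) Unit where
  index := {()}
  left _ := 1
  right _ := 1
  eq := by simp [Algebra.TensorProduct.one_def]

theorem doubleOne_mul (x : Double k H) : doubleMul k H (doubleOne k H ⊗ₜ x) = x := by
  change doubleLeft k H 1 x = x
  induction x using TensorProduct.induction_on with
  | zero => simp
  | add x y hx hy => rw [map_add, hx, hy]
  | tmul b g =>
    rw [doubleLeft_tmul b g oneRepr fun _ => oneRepr]
    simp only [oneRepr_index, oneRepr_left, oneRepr_right, Finset.sum_singleton, antip_one, one_mul]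
    congr 1
    ext y
    simp

theorem sandwich_counit (u w : H) :
    sandwich k H counit u w = (counit (R := k) u * counit (R := k) w) • counit := by
  ext x
  simp only [sandwich_apply, Bialgebra.counit_mul, LinearMap.smul_apply, smul_eq_mul]
  ring

theorem coadjoint_counit_tmul (h : H) :
    coadjoint k H (antip k H) LinearMap.id (counit ⊗ₜ h) = counit ⊗ₜ[k] h := by
  let r := ℛ k h
  let r' := fun i => ℛ k (r.right i)
  rw [coadjoint_tmul _ _ _ r r']
  simp only [sandwich_counit, TensorProduct.smul_tmul, counit_antip, LinearMap.id_apply, mul_smul,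
    ← TensorProduct.tmul_sum]
  congr 1
  conv_rhs => rw [← sum_counit_smul r]
  refine Finset.sum_congr rfl fun i _ => ?_
  simp only [smul_comm _ (counit (R := k) (r.left i)), ← Finset.smul_sum]
  congr 1
  have := congrArg (TensorProduct.rid k H) (sum_tmul_counit_eq (R := k) (r' i))
  rw [map_sum] at this
  simpa only [TensorProduct.rid_tmul, one_smul] using this

theorem doubleMul_one (x : Double k H) : doubleMul k H (x ⊗ₜ doubleOne k H) = x := by
  induction x using TensorProduct.induction_on with
  | zero => simp
  | add x y hx hy => rw [TensorProduct.add_tmul, map_add, hx, hy]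
  | tmul a h =>
    rw [doubleOne, doubleMul_tmul, coadjoint_counit_tmul]
    simp [counit_dualMul]

variable (k H) in
/-- The coalgebra structure of `D(H)^*` dual to the product of the double. -/
@[reducible] def doubleDualCoalgebra : Coalgebra k (Module.Dual k (Double k H)) :=
  dualCoalgebra (doubleMul k H) (doubleOne k H) doubleMul_assoc doubleOne_mul doubleMul_one

theorem doubleMul_counit_tmul (a : Module.Dual k H) (g h : H) :
    doubleMul k H ((a ⊗ₜ g) ⊗ₜ (counit ⊗ₜ h)) = a ⊗ₜ (g * h) := by
  rw [doubleMul_tmul, coadjoint_counit_tmul]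
  simp [counit_dualMul]

theorem doubleMul_tmul_one (a b : Module.Dual k H) (h : H) :
    doubleMul k H ((a ⊗ₜ 1) ⊗ₜ (b ⊗ₜ h)) = dualMul k H (b ⊗ₜ a) ⊗ₜ h := by
  rw [← doubleRep_doubleLeft, doubleRep_tmul, Module.End.mul_apply]
  change doubleLeftDual k H a (doubleMul k H (doubleOne k H ⊗ₜ (b ⊗ₜ h))) = _
  rw [doubleOne_mul, doubleLeftDual_tmul]

/-- The antipode of the double is anti-multiplicative on `a ⊗ h = (a ⊗ 1)(ε ⊗ h)`. -/
theorem doubleAntip_tmul (a : Module.Dual k H) (h : H) :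
    doubleAntip k H (a ⊗ₜ h) =
      doubleMul k H ((counit ⊗ₜ antip k H h) ⊗ₜ ((a ∘ₗ antipInv k H) ⊗ₜ 1)) := by
  let r := ℛ k h
  let r' := fun i => ℛ k (r.right i)
  let s := fun i => ℛ k (r.left i)
  rw [doubleMul_tmul, doubleAntip, LinearMap.comp_apply, coadjoint_tmul _ _ _ r r',
    coadjoint_tmul _ _ _ (antipRepr r) fun i => antipRepr (s i)]
  -- The two sides use the two bracketings of the iterated coproduct of h, since the coproduct of S
  -- h exchanges the legs. `N` is the common trilinear expression to which coassociativity is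
  -- applied.
  let N : H ⊗[k] (H ⊗[k] H) →ₗ[k] Double k H :=
    TensorProduct.map (antipInv k H).dualMap (antip k H) ∘ₗ
      (TensorProduct.lift ((sandwich k H a).compl₁₂ LinearMap.id (antip k H))).rTensor H ∘ₗ
      (TensorProduct.assoc k H H H).symm.toLinearMap ∘ₗ
      (TensorProduct.comm k H H).toLinearMap.lTensor H
  have hN := congrArg N (sum_tmul_tmul_eq r s r')
  simp only [map_sum, antipRepr_index, antipRepr_left, antipRepr_right, TensorProduct.map_tmul]
  simp only [N, map_sum, LinearMap.comp_apply, LinearMap.lTensor_tmul, LinearEquiv.coe_coe,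
    TensorProduct.comm_tmul, TensorProduct.assoc_symm_tmul, LinearMap.rTensor_tmul,
    TensorProduct.lift.tmul, LinearMap.compl₁₂_apply, TensorProduct.map_tmul] at hN
  rw [← hN]
  refine Finset.sum_congr rfl fun i _ => Finset.sum_congr rfl fun j _ => ?_
  rw [LinearMap.comp_apply, LinearMap.flip_apply, TensorProduct.mk_apply, dualMul_counit,
    LinearMap.mulRight_apply, mul_one]
  congr 1
  ext y
  simp [LinearMap.dualMap_apply, antipInv_mul, mul_assoc]

end DoubleProduct

/-! ### An algebra embedded in the convolution ring on its dual. -/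

section DualEmb

variable {k C A : Type*} [Field k] [AddCommGroup C] [Module k C] [FiniteDimensional k C]
  [Ring A] [Algebra k A]

variable (k A) in
/-- The embedding `c ↦ (φ ↦ φ(c) 1)` of a finite-dimensional algebra in a convolution algebra on its
dual. -/
def dualEmb : C →ₗ[k] WithConv (Module.Dual k C →ₗ[k] A) where
  toFun c := toConv ((Module.Dual.eval k C c).smulRight 1)
  map_add' c d := by ext φ; simp [add_smul]
  map_smul' r c := by ext φ; simp [mul_smul]

@[simp] theorem dualEmb_apply (c : C) (φ : Module.Dual k C) :
    dualEmb k A c φ = φ c • (1 : A) := rfl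

theorem evalLeft_comm_dualComul (μ : C ⊗[k] C →ₗ[k] C) (φ : Module.Dual k C) (x : C) :
    evalLeft x (TensorProduct.comm k _ _ (dualComul μ φ)) =
      φ ∘ₗ μ ∘ₗ (TensorProduct.mk k C C).flip x := by
  ext y
  have h := dualDistrib_dualComul μ φ (y ⊗ₜ x)
  simp only [LinearMap.comp_apply, TensorProduct.mk_apply, LinearMap.flip_apply]
  rw [← h]
  generalize dualComul μ φ = t
  induction t with
  | zero => simp
  | add a b ha hb => simp [ha, hb]
  | tmul a b => simp [mul_comm]

variable [Coalgebra k (Module.Dual k C)] {μ : C ⊗[k] C →ₗ[k] C}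

/-- This turns the left coregular action into multiplication in the convolution ring. -/
theorem dualEmb_mul_apply (hμ : comul (R := k) (A := Module.Dual k C) = dualComul μ) (c : C)
    (X : WithConv (Module.Dual k C →ₗ[k] A)) (φ : Module.Dual k C) :
    (dualEmb k A c * X) φ = X (φ ∘ₗ μ ∘ₗ TensorProduct.mk k C C c) := by
  rw [← evalLeft_dualComul, LinearMap.convMul_apply, hμ]
  generalize dualComul μ φ = t
  induction t with
  | zero => simp
  | add a b ha hb => simp only [map_add, ha, hb]
  | tmul a b => simp

theorem mul_dualEmb_apply (hμ : comul (R := k) (A := Module.Dual k C) = dualComul μ) (c : C)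
    (X : WithConv (Module.Dual k C →ₗ[k] A)) (φ : Module.Dual k C) :
    (X * dualEmb k A c) φ = X (φ ∘ₗ μ ∘ₗ (TensorProduct.mk k C C).flip c) := by
  rw [← evalLeft_comm_dualComul, LinearMap.convMul_apply, hμ]
  generalize dualComul μ φ = t
  induction t with
  | zero => simp
  | add a b ha hb => simp only [map_add, ha, hb]
  | tmul a b => simp

theorem dualEmb_mul (hμ : comul (R := k) (A := Module.Dual k C) = dualComul μ) (c d : C) :
    dualEmb k A (μ (c ⊗ₜ d)) = dualEmb k A c * dualEmb k A d := by
  ext φ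
  rw [dualEmb_mul_apply hμ]
  simp

theorem convConst_commute_dualEmb (a : A) (c : C) :
    Commute (convConst k (Module.Dual k C) a) (dualEmb k A c) := by
  ext φ
  rw [convConst_mul_apply, mul_convConst_apply]
  simp

end DualEmb

/-! ### Endomorphism-valued maps in a convolution ring with opposite product. -/

section Op

variable {k K C V : Type*} [Field k] [AddCommGroup K] [Module k K] [Coalgebra k K]
  [AddCommGroup C] [Module k C] [Coalgebra k C] [AddCommGroup V] [Module k V]

/-- A linear map to endomorphisms viewed in a convolution ring in which products are composed from
right to left. -/
def toOp (F : K →ₗ[k] Module.End k V) : WithConv (K →ₗ[k] (Module.End k V)ᵐᵒᵖ) :=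
  toConv ((opLinearEquiv k).toLinearMap ∘ₗ F)

@[simp] theorem toOp_apply (F : K →ₗ[k] Module.End k V) (c : K) : toOp F c = op (F c) := rfl

/-- The convolution-composition applies F' first although it is written last. In the opposite ring
the earlier operation stands on the left, so words are read along the ribbon. -/
theorem toOp_convComp (F'' F' : K →ₗ[k] Module.End k V) :
    toOp (convComp comul F'' F') = toOp F' * toOp F'' := by
  ext c
  rw [conv_apply _ _ (ℛ k c)]
  simp [convComp, ← (ℛ k c).eq]

variable (C) in
/-- A linear map to endomorphisms as a map to constants of a convolution ring. -/
def constOp (F : K →ₗ[k] Module.End k V) :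
    WithConv (K →ₗ[k] WithConv (C →ₗ[k] (Module.End k V)ᵐᵒᵖ)) :=
  convMap (convConst k C) (toOp F)

theorem constOp_apply (F : K →ₗ[k] Module.End k V) (c : K) :
    constOp C F c = convConst k C (op (F c)) := rfl

theorem constOp_convComp (F'' F' : K →ₗ[k] Module.End k V) :
    constOp C (convComp comul F'' F') = constOp C F' * constOp C F'' := by
  rw [constOp, toOp_convComp, map_mul]
  rfl

end Op

/-! ### From exchange relations to module map identities. -/

section Sandwich

variable {k K A : Type*} [Field k] [AddCommGroup K] [Module k K] [Coalgebra k K]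
  [Ring A] [Algebra k A]

/-- The exchange relation gives X v(c₁) = i(s c₁) v(c₂) X. In v(s c₃) i(s c₁) v(c₂) X the factor i
moves to the front, and v(s c₃) v(c₂) collapses to a counit. Here `s` plays the role of the antipode
of `K`, for instance S on `H` and the transpose of S⁻¹ on `H^*`. -/
theorem sum_sandwich_left {s : Module.End k K} {v i : WithConv (K →ₗ[k] A)} {X : A}
    (hvi : ∀ x y, Commute (v x) (i y))
    (hi : toConv (i.ofConv ∘ₗ s) * i = 1)
    (hv : ∀ (c : K) (r : Repr k c (K × K)),
      ∑ j ∈ r.index, v (s (r.right j)) * v (r.left j) = algebraMap k A (counit c))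
    (h : v * convConst k K X = i * convConst k K X * v) {c : K} (r : Repr k c (K × K)) :
    ∑ j ∈ r.index, v (s (r.right j)) * X * v (r.left j) = i (s c) * X := by
  have h1 : convConst k K X * v = toConv (i.ofConv ∘ₗ s) * v * convConst k K X := by
    rw [mul_assoc, h, ← mul_assoc, ← mul_assoc, hi, one_mul]
  have h2 : ∀ x (q : Repr k x (K × K)),
      X * v x = ∑ j ∈ q.index, i (s (q.left j)) * v (q.right j) * X := by
    intro x q
    have := DFunLike.congr_fun (congrArg ofConv h1) x
    rw [convConst_mul_apply, mul_convConst_apply, conv_apply _ _ q, Finset.sum_mul] at this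
    exact this
  let q := fun j => ℛ k (r.left j)
  let q' := fun j => ℛ k (r.right j)
  let N : K ⊗[k] (K ⊗[k] K) →ₗ[k] A := TensorProduct.lift
    (((LinearMap.mul k A).flip.flip ∘ₗ i.ofConv ∘ₗ s).compl₂
      (LinearMap.mulRight k X ∘ₗ LinearMap.mul' k A ∘ₗ
        TensorProduct.map (v.ofConv ∘ₗ s) v.ofConv ∘ₗ (TensorProduct.comm k K K).toLinearMap))
  have hN : ∀ x y z, N (x ⊗ₜ (y ⊗ₜ z)) = i (s x) * (v (s z) * v y * X) := fun x y z => rfl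
  have e := congrArg N (sum_tmul_tmul_eq r q q')
  simp only [map_sum, hN] at e
  calc _ = ∑ j ∈ r.index, ∑ l ∈ (q j).index,
        i (s ((q j).left l)) * (v (s (r.right j)) * v ((q j).right l) * X) := by
        refine Finset.sum_congr rfl fun j _ => ?_
        rw [mul_assoc, h2 _ (q j), Finset.mul_sum]
        refine Finset.sum_congr rfl fun l _ => ?_
        rw [mul_assoc, mul_assoc, ← mul_assoc (v _), (hvi _ _).eq, mul_assoc]
    _ = _ := by
        rw [e]
        simp only [← Finset.mul_sum, ← Finset.sum_mul, hv]
        simp only [← Algebra.smul_def, mul_smul_comm]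
        have := congrArg (TensorProduct.rid k K) (sum_tmul_counit_eq (R := k) r)
        rw [map_sum] at this
        simp only [TensorProduct.rid_tmul, one_smul] at this
        conv_rhs => rw [← this]
        simp only [map_sum, map_smul, Finset.sum_mul, smul_mul_assoc]

/-- Mirror image of `sum_sandwich_left`: here v(c₃) v(s c₂)-type pairs collapse to the left of i,
which ends up on the right of `X`. -/
theorem sum_sandwich_right {s : Module.End k K} {v i : WithConv (K →ₗ[k] A)} {X : A}
    (hvi : ∀ x y, Commute (v x) (i y))
    (hi : i * toConv (i.ofConv ∘ₗ s) = 1)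
    (hv : ∀ (c : K) (r : Repr k c (K × K)),
      ∑ j ∈ r.index, v (r.right j) * v (s (r.left j)) = algebraMap k A (counit c))
    (h : convConst k K X * v = v * convConst k K X * i) {c : K} (r : Repr k c (K × K)) :
    ∑ j ∈ r.index, v (r.right j) * X * v (s (r.left j)) = X * i (s c) := by
  have h1 : v * convConst k K X = convConst k K X * (v * toConv (i.ofConv ∘ₗ s)) := by
    rw [← mul_assoc, h, mul_assoc, hi, mul_one]
  have h2 : ∀ x (q : Repr k x (K × K)),
      v x * X = ∑ j ∈ q.index, X * (v (q.left j) * i (s (q.right j))) := by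
    intro x q
    have := DFunLike.congr_fun (congrArg ofConv h1) x
    rw [convConst_mul_apply, mul_convConst_apply, conv_apply _ _ q, Finset.mul_sum] at this
    exact this
  let q := fun j => ℛ k (r.left j)
  let q' := fun j => ℛ k (r.right j)
  let N : K ⊗[k] (K ⊗[k] K) →ₗ[k] A := LinearMap.mulLeft k X ∘ₗ LinearMap.mul' k A ∘ₗ
    TensorProduct.map (LinearMap.mul' k A ∘ₗ
        TensorProduct.map v.ofConv (v.ofConv ∘ₗ s) ∘ₗ (TensorProduct.comm k K K).toLinearMap)
      (i.ofConv ∘ₗ s) ∘ₗ (TensorProduct.assoc k K K K).symm.toLinearMap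
  have hN : ∀ x y z, N (x ⊗ₜ (y ⊗ₜ z)) = X * (v y * v (s x) * i (s z)) := fun x y z => rfl
  have e := congrArg N (sum_tmul_tmul_eq r q q')
  simp only [map_sum, hN] at e
  calc _ = ∑ j ∈ r.index, ∑ l ∈ (q' j).index,
        X * (v ((q' j).left l) * v (s (r.left j)) * i (s ((q' j).right l))) := by
        refine Finset.sum_congr rfl fun j _ => ?_
        rw [h2 _ (q' j), Finset.sum_mul]
        refine Finset.sum_congr rfl fun l _ => ?_
        rw [mul_assoc, mul_assoc, mul_assoc, (hvi _ _).eq]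
    _ = _ := by
        rw [← e]
        simp only [← Finset.mul_sum, ← Finset.sum_mul, hv]
        simp only [← Algebra.smul_def]
        have := sum_counit_smul (R := k) r
        conv_rhs => rw [← this]
        simp only [map_sum, map_smul, Finset.mul_sum]

end Sandwich

/-! ### Passing one ordered product through another. -/

section Path

variable {R : Type*} [Monoid R]

/-- The product `f a * f (a + 1) * ⋯ * f (a + n - 1)`. -/
def pathProd (f : ℕ → R) : ℕ → ℕ → R
  | _, 0 => 1
  | a, n + 1 => f a * pathProd f (a + 1) n

theorem pathProd_succ (f : ℕ → R) (a n : ℕ) :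
    pathProd f a (n + 1) = f a * pathProd f (a + 1) n := rfl

theorem pathProd_add (f : ℕ → R) (a m n : ℕ) :
    pathProd f a (m + n) = pathProd f a m * pathProd f (a + m) n := by
  induction m generalizing a with
  | zero => simp [pathProd]
  | succ m ih =>
    rw [Nat.succ_add, pathProd_succ, ih, pathProd_succ, mul_assoc, Nat.succ_add_eq_add_succ]

theorem pathProd_shift (f : ℕ → R) (a b n : ℕ) :
    pathProd (fun j => f (j + b)) a n = pathProd f (a + b) n := by
  induction n generalizing a with
  | zero => rfl
  | succ n ih => rw [pathProd_succ, pathProd_succ, ih, Nat.add_right_comm]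

theorem pathProd_congr {f g : ℕ → R} {a n : ℕ} (h : ∀ j, a ≤ j → j < a + n → f j = g j) :
    pathProd f a n = pathProd g a n := by
  induction n generalizing a with
  | zero => rfl
  | succ n ih =>
    rw [pathProd_succ, pathProd_succ, h a le_rfl (by omega),
      ih fun j hj hj' => h j (by omega) (by omega)]

theorem commute_pathProd {x : R} {f : ℕ → R} {a n : ℕ}
    (h : ∀ j, a ≤ j → j < a + n → Commute x (f j)) : Commute x (pathProd f a n) := by
  induction n generalizing a with
  | zero => exact Commute.one_right x
  | succ n ih =>
    exact (h a le_rfl (by omega)).mul_right (ih fun j hj hj' => h j (by omega) (by omega))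

theorem op_pathProd (f : ℕ → R) (n : ℕ) :
    op (pathProd f 0 n) = pathProd (fun j => op (f (n - 1 - j))) 0 n := by
  induction n with
  | zero => rfl
  | succ n ih =>
    have h : pathProd (fun j => op (f (n - j))) 1 n = pathProd (fun j => op (f (n - 1 - j))) 0 n := by
      rw [← zero_add 1, ← pathProd_shift]
      exact pathProd_congr fun j _ _ => by rw [Nat.add_comm j 1, Nat.sub_sub]
    rw [pathProd_add, op_mul, ih]
    conv_rhs => rw [pathProd_succ, zero_add, Nat.add_sub_cancel, Nat.sub_zero, h]
    simp [pathProd]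

/-- Passing a product of site factors `p` along a path that makes `k` triangles about the initial
centre, leaves it by the next triangle, and never comes back. -/
theorem pathProd_start {p f : ℕ → R} {i : R} {k a n r : ℕ} (hr : k < r) (hn : k < n)
    (hstay : ∀ j, a ≤ j → j < a + k → p j * f j * i = i * f j * p j)
    (hstart : p (a + k) * f (a + k) = i * f (a + k) * p (a + k))
    (hcomm : ∀ j t, a ≤ j → j < a + n → a ≤ t → t < a + r → ¬ (j = t ∧ j ≤ a + k) →
      Commute (p t) (f j)) :
    pathProd p a r * pathProd f a n = i * pathProd f a n * pathProd p a r := by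
  induction k generalizing a n r with
  | zero =>
    obtain ⟨r, rfl⟩ := Nat.exists_eq_succ_of_ne_zero hr.ne'
    obtain ⟨n, rfl⟩ := Nat.exists_eq_succ_of_ne_zero hn.ne'
    have h1 : Commute (pathProd p (a + 1) r) (f a) := (commute_pathProd fun t ht ht' =>
      (hcomm a t le_rfl (by omega) (by omega) (by omega) (by omega)).symm).symm
    have h2 : Commute (p a * pathProd p (a + 1) r) (pathProd f (a + 1) n) :=
      commute_pathProd fun j hj hj' => ((hcomm j a (by omega) (by omega) le_rfl (by omega)
        (by omega)).symm.mul_right (commute_pathProd fun t ht ht' =>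
          (hcomm j t (by omega) (by omega) (by omega) (by omega) (by omega)).symm)).symm
    rw [add_zero] at hstart
    simp only [Nat.succ_eq_add_one, pathProd_succ]
    calc _ = p a * (pathProd p (a + 1) r * f a) * pathProd f (a + 1) n := by simp only [mul_assoc]
      _ = i * f a * ((p a * pathProd p (a + 1) r) * pathProd f (a + 1) n) := by
        rw [h1.eq, ← mul_assoc, hstart]; simp only [mul_assoc]
      _ = _ := by rw [h2.eq]; simp only [mul_assoc]
  | succ k ih =>
    obtain ⟨r, rfl⟩ := Nat.exists_eq_succ_of_ne_zero (by omega : r ≠ 0)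
    obtain ⟨n, rfl⟩ := Nat.exists_eq_succ_of_ne_zero (by omega : n ≠ 0)
    have h1 : Commute (pathProd p (a + 1) r) (f a) := (commute_pathProd fun t ht ht' =>
      (hcomm a t le_rfl (by omega) (by omega) (by omega) (by omega)).symm).symm
    have h2 : Commute (p a) (pathProd f (a + 1) n) := commute_pathProd fun j hj hj' =>
      hcomm j a (by omega) (by omega) le_rfl (by omega) (by omega)
    -- Passing the tail produces a factor `i` in front of it, just behind `p a * f a`. The relation
    -- for a staying triangle then carries this factor to the front.
    have h3 := ih (a := a + 1) (n := n) (r := r) (by omega) (by omega)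
      (fun j hj hj' => hstay j (by omega) (by omega))
      (by rw [show a + 1 + k = a + (k + 1) by omega]; exact hstart)
      (fun j t hj hj' ht ht' h => hcomm j t (by omega) (by omega) (by omega) (by omega) (by omega))
    simp only [Nat.succ_eq_add_one, pathProd_succ]
    calc _ = p a * (pathProd p (a + 1) r * f a) * pathProd f (a + 1) n := by simp only [mul_assoc]
      _ = p a * f a * (pathProd p (a + 1) r * pathProd f (a + 1) n) := by
        rw [h1.eq]; simp only [mul_assoc]
      _ = (p a * f a * i) * (pathProd f (a + 1) n * pathProd p (a + 1) r) := by
        rw [h3]; simp only [mul_assoc]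
      _ = i * f a * (p a * pathProd f (a + 1) n) * pathProd p (a + 1) r := by
        rw [hstay a le_rfl (by omega)]; simp only [mul_assoc]
      _ = _ := by rw [h2.eq]; simp only [mul_assoc]

/-- Passing a product of site factors `p` along a path of `n` factors that reaches the final centre
by a triangle, after which `k` triangles about this centre follow. -/
theorem pathProd_end {p f : ℕ → R} {i : R} {k n r : ℕ} (hr : k < r) (hn : k < n)
    (hstay : ∀ j, j < k → p (r - 1 - j) * f (n - 1 - j) * i = i * f (n - 1 - j) * p (r - 1 - j))
    (hend : f (n - 1 - k) * p (r - 1 - k) = p (r - 1 - k) * f (n - 1 - k) * i)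
    (hcomm : ∀ j t, j < n → t < r → ¬ (j = t ∧ j ≤ k) →
      Commute (p (r - 1 - t)) (f (n - 1 - j))) :
    pathProd f 0 n * pathProd p 0 r = pathProd p 0 r * pathProd f 0 n * i := by
  -- In the opposite monoid both products are reversed and arriving becomes leaving, so the
  -- statement is `pathProd_start`.
  apply op_injective
  simp only [op_mul, op_pathProd]
  rw [← mul_assoc]
  refine pathProd_start (k := k) hr hn (fun j _ hj => ?_) ?_ (fun j t _ hj _ ht h => ?_)
  · rw [zero_add] at hj
    simp only [← op_mul, ← mul_assoc]
    rw [hstay j hj]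
  · simp only [zero_add, ← op_mul, ← mul_assoc]
    rw [hend]
  · rw [zero_add] at hj ht h
    exact (hcomm j t hj ht h).op

end Path

/-! ### Exchange relations between multiplications and coactions on one arrow. -/

section Relations

variable {k H : Type*} [Field k] [Ring H] [HopfAlgebra k H] [FiniteDimensional k H]

section Rel
variable {E : Type*} [Semiring E] [Algebra k E]

/-- Commutation of a left module structure `L` with a triangle operator `T` leaving the vertex. -/
def StartRel (L : H →ₗ[k] E) (T : Module.Dual k H →ₗ[k] E) : Prop :=
  ∀ (a : Module.Dual k H) (c : H) (r : Repr k c (H × H)),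
    T a * L c = ∑ i ∈ r.index, L (r.right i) * T (a ∘ₗ LinearMap.mulLeft k (r.left i))

/-- Commutation of a left module structure `L` with a triangle operator `T` reaching the vertex. -/
def EndRel (L : H →ₗ[k] E) (T : Module.Dual k H →ₗ[k] E) : Prop :=
  ∀ (a : Module.Dual k H) (c : H) (r : Repr k c (H × H)),
    T a * L c = ∑ i ∈ r.index,
      L (r.left i) * T (a ∘ₗ LinearMap.mulRight k (antip k H (r.right i)))

theorem StartRel.map {E' : Type*} [Semiring E'] [Algebra k E'] {L : H →ₗ[k] E}
    {T : Module.Dual k H →ₗ[k] E} (h : StartRel L T) (φ : E →ₐ[k] E') :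
    StartRel (φ.toLinearMap ∘ₗ L) (φ.toLinearMap ∘ₗ T) := by
  intro a c r
  simpa using congrArg φ (h a c r)

theorem EndRel.map {E' : Type*} [Semiring E'] [Algebra k E'] {L : H →ₗ[k] E}
    {T : Module.Dual k H →ₗ[k] E} (h : EndRel L T) (φ : E →ₐ[k] E') :
    EndRel (φ.toLinearMap ∘ₗ L) (φ.toLinearMap ∘ₗ T) := by
  intro a c r
  simpa using congrArg φ (h a c r)
end Rel

theorem coactAlong_apply (a : Module.Dual k H) (g : H) :
    coactAlong k H a g = TensorProduct.lid k H (a.rTensor H (comul g)) := rfl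

theorem coactAgainst_apply (a : Module.Dual k H) (g : H) :
    coactAgainst k H a g = TensorProduct.rid k H ((a ∘ₗ antip k H).lTensor H (comul g)) := rfl

theorem startRel_mul_coactAlong : StartRel (k := k) (LinearMap.mul k H) (coactAlong k H) := by
  intro a c r
  ext g
  rw [Module.End.mul_apply, LinearMap.mul_apply', coactAlong_apply, Bialgebra.comul_mul, ← r.eq]
  simp only [Finset.sum_mul, map_sum, LinearMap.sum_apply, Module.End.mul_apply,
    LinearMap.mul_apply', coactAlong_apply]
  refine Finset.sum_congr rfl fun i _ => ?_
  generalize comul (R := k) g = t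
  induction t with
  | zero => simp
  | add x y hx hy => simp only [mul_add, map_add, hx, hy]
  | tmul x y => simp

/-- For an inward arrow the coaction evaluates a at S(g₂ S⁻¹(c₁)) = c₁ S(g₂). The S⁻¹ is essential:
right multiplication by S(c) would leave S²(c₁) here. -/
theorem startRel_flip_coactAgainst :
    StartRel (k := k) ((LinearMap.mul k H).flip ∘ₗ antipInv k H) (coactAgainst k H) := by
  intro a c r
  ext g
  rw [Module.End.mul_apply, LinearMap.comp_apply, LinearMap.flip_apply, LinearMap.mul_apply',
    coactAgainst_apply, Bialgebra.comul_mul, ← (antipInvRepr r).eq]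
  simp only [Finset.mul_sum, map_sum, LinearMap.sum_apply, Module.End.mul_apply, antipInvRepr_left,
    LinearMap.mul_apply', coactAgainst_apply, LinearMap.flip_apply, LinearMap.comp_apply,
    antipInvRepr_right, antipInvRepr_index]
  refine Finset.sum_congr rfl fun i _ => ?_
  generalize comul (R := k) g = t
  induction t with
  | zero => simp
  | add x y hx hy => simp only [add_mul, map_add, hx, hy]
  | tmul x y => simp [antip_mul]

/-- The coproduct of g S(c) is g₁ S(c₂) ⊗ g₂ S(c₁), so a picks up right multiplication by S(c₂)
while S(c₁) stays on the arrow. Here S, not S⁻¹, is the sign that fits. -/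
theorem endRel_flip_coactAlong :
    EndRel (k := k) ((LinearMap.mul k H).flip ∘ₗ antip k H) (coactAlong k H) := by
  intro a c r
  ext g
  rw [Module.End.mul_apply, LinearMap.comp_apply, LinearMap.flip_apply, LinearMap.mul_apply',
    coactAlong_apply, Bialgebra.comul_mul, ← (antipRepr r).eq]
  simp only [Finset.mul_sum, map_sum, LinearMap.sum_apply, Module.End.mul_apply, antipRepr_left,
    LinearMap.mul_apply', coactAlong_apply, LinearMap.flip_apply, LinearMap.comp_apply,
    antipRepr_right, antipRepr_index]
  refine Finset.sum_congr rfl fun i _ => ?_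
  generalize comul (R := k) g = t
  induction t with
  | zero => simp
  | add x y hx hy => simp only [add_mul, map_add, hx, hy]
  | tmul x y => simp

theorem endRel_mul_coactAgainst : EndRel (k := k) (LinearMap.mul k H) (coactAgainst k H) := by
  intro a c r
  ext g
  rw [Module.End.mul_apply, LinearMap.mul_apply', coactAgainst_apply, Bialgebra.comul_mul, ← r.eq]
  simp only [Finset.sum_mul, map_sum, LinearMap.sum_apply, Module.End.mul_apply,
    LinearMap.mul_apply', coactAgainst_apply]
  refine Finset.sum_congr rfl fun i _ => ?_
  generalize comul (R := k) g = t
  induction t with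
  | zero => simp
  | add x y hx hy => simp only [mul_add, map_add, hx, hy]
  | tmul x y => simp [antip_mul]

theorem coactAlong_repr (a : Module.Dual k H) {g : H} {ι : Type*} (r : Repr k g ι) :
    coactAlong k H a g = ∑ i ∈ r.index, a (r.left i) • r.right i := by
  simp [coactAlong_apply, ← r.eq]

theorem coactAgainst_repr (a : Module.Dual k H) {g : H} {ι : Type*} (r : Repr k g ι) :
    coactAgainst k H a g = ∑ i ∈ r.index, a (antip k H (r.right i)) • r.left i := by
  simp [coactAgainst_apply, ← r.eq]

theorem coactAlong_dualMul (a b : Module.Dual k H) :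
    coactAlong k H (dualMul k H (a ⊗ₜ b)) = coactAlong k H b * coactAlong k H a := by
  ext g
  let r := ℛ k g
  let q := fun i => ℛ k (r.left i)
  let q' := fun i => ℛ k (r.right i)
  have e := congrArg ((TensorProduct.lid k H).toLinearMap ∘ₗ TensorProduct.map a
    ((TensorProduct.lid k H).toLinearMap ∘ₗ b.rTensor H)) (sum_tmul_tmul_eq r q q')
  simp only [map_sum, LinearMap.comp_apply, TensorProduct.map_tmul, LinearMap.rTensor_tmul,
    LinearEquiv.coe_coe, TensorProduct.lid_tmul] at e
  rw [Module.End.mul_apply, coactAlong_repr a r, map_sum, coactAlong_repr _ r]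
  simp only [map_smul, coactAlong_repr b (q' _), dualMul_tmul_apply a b (q _), Finset.smul_sum,
    Finset.sum_smul, mul_smul, e]

theorem coactAgainst_dualMul (a b : Module.Dual k H) :
    coactAgainst k H (dualMul k H (a ⊗ₜ b)) = coactAgainst k H b * coactAgainst k H a := by
  ext g
  let r := ℛ k g
  let q := fun i => ℛ k (r.left i)
  let q' := fun i => ℛ k (r.right i)
  have e := congrArg ((TensorProduct.rid k H).toLinearMap ∘ₗ TensorProduct.map LinearMap.id
    ((TensorProduct.lid k k).toLinearMap ∘ₗ TensorProduct.map (b ∘ₗ antip k H) (a ∘ₗ antip k H)))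
      (sum_tmul_tmul_eq r q q')
  simp only [map_sum, LinearMap.comp_apply, TensorProduct.map_tmul, LinearMap.id_apply,
    LinearEquiv.coe_coe, TensorProduct.lid_tmul, TensorProduct.rid_tmul, smul_eq_mul] at e
  rw [Module.End.mul_apply, coactAgainst_repr a r, map_sum, coactAgainst_repr _ r]
  simp only [map_smul, coactAgainst_repr b (q _), dualMul_tmul_apply a b (antipRepr (q' _)),
    antipRepr_index, antipRepr_left, antipRepr_right, Finset.smul_sum, Finset.sum_smul,
    ← mul_smul]
  simp only [mul_comm (a _), e]

theorem coactAlong_counit : coactAlong k H counit = 1 := by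
  ext g
  simp [coactAlong_apply]

theorem coactAgainst_counit : coactAgainst k H counit = 1 := by
  ext g
  have : counit ∘ₗ antip k H = counit (R := k) := by ext; simp
  simp [coactAgainst_apply, this]

/-- One coaction strips the left leg of the coproduct and the other the right leg, so this is
coassociativity. -/
theorem commute_coactAlong_coactAgainst (a b : Module.Dual k H) :
    Commute (coactAlong k H a) (coactAgainst k H b) := by
  ext g
  let r := ℛ k g
  let q := fun i => ℛ k (r.left i)
  let q' := fun i => ℛ k (r.right i)
  have e := congrArg ((TensorProduct.lid k H).toLinearMap ∘ₗ TensorProduct.map a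
    ((TensorProduct.rid k H).toLinearMap ∘ₗ TensorProduct.map LinearMap.id (b ∘ₗ antip k H)))
      (sum_tmul_tmul_eq r q q')
  simp only [map_sum, LinearMap.comp_apply, TensorProduct.map_tmul, LinearMap.id_apply,
    LinearEquiv.coe_coe, TensorProduct.lid_tmul, TensorProduct.rid_tmul] at e
  rw [Module.End.mul_apply, Module.End.mul_apply, coactAlong_repr a r, coactAgainst_repr b r,
    map_sum, map_sum]
  simp only [map_smul, coactAgainst_repr b (q' _), coactAlong_repr a (q _), Finset.smul_sum]
  rw [← e]
  exact Finset.sum_congr rfl fun i _ => Finset.sum_congr rfl fun j _ => smul_comm _ _ _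

end Relations

/-! ### Restricting functionals on the double to its two factors. -/

section DoubleDual

attribute [local instance] hopfDualCoalgebra doubleDualCoalgebra

variable {k H : Type*} [Field k] [Ring H] [HopfAlgebra k H] [FiniteDimensional k H]

theorem dual_sum_left {a : Module.Dual k H} {ι : Type*} (r : Repr k a ι) (h : H) :
    ∑ i ∈ r.index, r.left i h • r.right i = a ∘ₗ LinearMap.mulLeft k h := by
  have e := evalLeft_dualComul (LinearMap.mul' k H) a h
  rw [show dualComul (LinearMap.mul' k H) a = comul (R := k) a from rfl, ← r.eq] at e
  simp only [map_sum, evalLeft_tmul] at e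
  rw [e]
  ext x
  simp

theorem dual_sum_right {a : Module.Dual k H} {ι : Type*} (r : Repr k a ι) (h : H) :
    ∑ i ∈ r.index, r.right i h • r.left i = a ∘ₗ LinearMap.mulRight k h := by
  have e := evalLeft_comm_dualComul (LinearMap.mul' k H) a h
  rw [show dualComul (LinearMap.mul' k H) a = comul (R := k) a from rfl, ← r.eq] at e
  simp only [map_sum, evalLeft_tmul, TensorProduct.comm_tmul] at e
  rw [e]
  ext x
  simp

/-- `φ ↦ ⟨φ, · ⊗ h⟩` as an element of `H`. -/
def dualLeft (h : H) : Module.Dual k (Double k H) →ₗ[k] H :=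
  (Module.evalEquiv k H).symm.toLinearMap ∘ₗ
    ((TensorProduct.mk k (Module.Dual k H) H).flip h).dualMap

@[simp] theorem apply_dualLeft (b : Module.Dual k H) (h : H) (φ : Module.Dual k (Double k H)) :
    b (dualLeft h φ) = φ (b ⊗ₜ h) := by
  simp [dualLeft, Module.apply_evalEquiv_symm_apply]

/-- `φ ↦ ⟨φ, a ⊗ ·⟩`. -/
def dualRight (a : Module.Dual k H) : Module.Dual k (Double k H) →ₗ[k] Module.Dual k H :=
  (TensorProduct.mk k (Module.Dual k H) H a).dualMap

@[simp] theorem dualRight_apply (a : Module.Dual k H) (φ : Module.Dual k (Double k H)) (h : H) :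
    dualRight a φ h = φ (a ⊗ₜ h) := rfl

theorem dual_ext {x y : H} (h : ∀ b : Module.Dual k H, b x = b y) : x = y :=
  (Module.evalEquiv k H).injective (LinearMap.ext h)

theorem conv_ext {K A : Type*} [AddCommMonoid K] [Module k K] [AddCommMonoid A]
    [Module k A] {f g : WithConv (K →ₗ[k] A)} (h : ∀ c, f c = g c) : f = g :=
  WithConv.ext (LinearMap.ext h)

/-- Left multiplication by `x` in the double. -/
def lmulDual (x : Double k H) (φ : Module.Dual k (Double k H)) : Module.Dual k (Double k H) :=
  φ ∘ₗ doubleMul k H ∘ₗ TensorProduct.mk k _ _ x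

/-- Right multiplication by `x` in the double. -/
def rmulDual (x : Double k H) (φ : Module.Dual k (Double k H)) : Module.Dual k (Double k H) :=
  φ ∘ₗ doubleMul k H ∘ₗ (TensorProduct.mk k _ _).flip x

theorem lmulDual_apply (x y : Double k H) (φ : Module.Dual k (Double k H)) :
    lmulDual x φ y = φ (doubleMul k H (x ⊗ₜ y)) := rfl

theorem rmulDual_apply (x y : Double k H) (φ : Module.Dual k (Double k H)) :
    rmulDual x φ y = φ (doubleMul k H (y ⊗ₜ x)) := rfl

theorem dualRight_counit_lmulDual (h : H) (φ : Module.Dual k (Double k H)) :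
    dualRight counit (lmulDual (counit ⊗ₜ h) φ) = dualRight counit φ ∘ₗ LinearMap.mulLeft k h := by
  ext x
  simp [lmulDual_apply, doubleMul_counit_tmul]

theorem dualRight_counit_rmulDual (h : H) (φ : Module.Dual k (Double k H)) :
    dualRight counit (rmulDual (counit ⊗ₜ h) φ) = dualRight counit φ ∘ₗ LinearMap.mulRight k h := by
  ext x
  simp [rmulDual_apply, doubleMul_counit_tmul]

theorem dualRight_counit_lmulDual_one (a : Module.Dual k H) (φ : Module.Dual k (Double k H)) :
    dualRight counit (lmulDual (a ⊗ₜ 1) φ) = dualRight a φ := by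
  ext x
  simp [lmulDual_apply, doubleMul_counit_tmul]

theorem dualLeft_one_rmulDual_counit (h : H) (φ : Module.Dual k (Double k H)) :
    dualLeft 1 (rmulDual (counit ⊗ₜ h) φ) = dualLeft h φ := by
  refine dual_ext (k := k) fun b => ?_
  simp [rmulDual_apply, doubleMul_counit_tmul]

theorem dualLeft_one_lmulDual (q : Module.Dual k H) (φ : Module.Dual k (Double k H)) {ι : Type*}
    (r : Repr k (dualLeft (k := k) 1 φ) ι) :
    dualLeft 1 (lmulDual (q ⊗ₜ 1) φ) = ∑ i ∈ r.index, q (r.right i) • r.left i := by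
  refine dual_ext (k := k) fun b => ?_
  simp only [apply_dualLeft, lmulDual_apply, doubleMul_tmul_one, map_sum, map_smul]
  rw [← apply_dualLeft, dualMul_tmul_apply _ _ r]
  simp [mul_comm]

theorem dualLeft_one_rmulDual (q : Module.Dual k H) (φ : Module.Dual k (Double k H)) {ι : Type*}
    (r : Repr k (dualLeft (k := k) 1 φ) ι) :
    dualLeft 1 (rmulDual (q ⊗ₜ 1) φ) = ∑ i ∈ r.index, q (r.left i) • r.right i := by
  refine dual_ext (k := k) fun b => ?_
  simp only [apply_dualLeft, rmulDual_apply, doubleMul_tmul_one, map_sum, map_smul]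
  rw [← apply_dualLeft, dualMul_tmul_apply _ _ r]
  simp

theorem dualLeft_one_lmulDual_counit (φ : Module.Dual k (Double k H)) {h : H} {ι κ : Type*}
    (r : Repr k h ι) (r' : ∀ i, Repr k (r.right i) κ) :
    dualLeft 1 (lmulDual (counit ⊗ₜ h) φ) = ∑ i ∈ r.index, ∑ j ∈ (r' i).index,
      antip k H (r.left i) * (dualLeft ((r' i).left j) φ * (r' i).right j) := by
  refine dual_ext (k := k) fun b => ?_
  simp only [apply_dualLeft, lmulDual_apply, map_sum]
  rw [doubleMul_tmul_repr _ _ _ r r']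
  simp only [map_sum, dualMul_counit, mul_one, ← apply_dualLeft, sandwich_apply]

theorem dualRight_counit_rmulDual_one (q : Module.Dual k H) (φ : Module.Dual k (Double k H))
    {h : H} {ι κ : Type*} (r : Repr k h ι) (r' : ∀ i, Repr k (r.right i) κ) :
    dualRight counit (rmulDual (q ⊗ₜ 1) φ) h = ∑ i ∈ r.index, ∑ j ∈ (r' i).index,
      φ (sandwich k H q (antip k H (r.left i)) ((r' i).right j) ⊗ₜ (r' i).left j) := by
  simp only [dualRight_apply, rmulDual_apply, doubleMul_tmul_repr _ _ _ r r', map_sum,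
    dualMul_counit, mul_one]

end DoubleDual

/-! ### The convolution ring containing the ribbon operators. -/

section ConvRelations

attribute [local instance] hopfDualCoalgebra doubleDualCoalgebra

variable (k H V : Type*) [Field k] [Ring H] [HopfAlgebra k H] [FiniteDimensional k H]
  [AddCommGroup V] [Module k V]

/-- Linear maps `D(H)^* → End V` with the convolution-composition product. -/
abbrev DoubleConv : Type _ := WithConv (Module.Dual k (Double k H) →ₗ[k] (Module.End k V)ᵐᵒᵖ)

/-- The embedding `h ↦ ε ⊗ h` of `H` in the double as a map to the convolution ring. -/
def vertexEmb : WithConv (H →ₗ[k] DoubleConv k H V) :=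
  toConv (dualEmb k (C := Double k H) (Module.End k V)ᵐᵒᵖ ∘ₗ TensorProduct.mk k _ _ counit)

/-- The embedding `a ↦ a ⊗ 1` of `H^*` in the double as a map to the convolution ring. -/
def faceEmb : WithConv (Module.Dual k H →ₗ[k] DoubleConv k H V) :=
  toConv (dualEmb k (C := Double k H) (Module.End k V)ᵐᵒᵖ ∘ₗ (TensorProduct.mk k _ _).flip 1)

variable {k H V}

theorem comul_doubleDual : comul (R := k) (A := Module.Dual k (Double k H)) =
    dualComul (C := Double k H) (doubleMul k H) := rfl

theorem dualEmb_double_mul_apply (x : Double k H) (X : DoubleConv k H V)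
    (φ : Module.Dual k (Double k H)) :
    (dualEmb k (C := Double k H) (Module.End k V)ᵐᵒᵖ x * X) φ = X (lmulDual x φ) := by
  have h := dualEmb_mul_apply (A := (Module.End k V)ᵐᵒᵖ) (C := Double k H) (μ := doubleMul k H)
    comul_doubleDual x X φ
  exact h

theorem mul_dualEmb_double_apply (x : Double k H) (X : DoubleConv k H V)
    (φ : Module.Dual k (Double k H)) :
    (X * dualEmb k (C := Double k H) (Module.End k V)ᵐᵒᵖ x) φ = X (rmulDual x φ) := by
  have h := mul_dualEmb_apply (A := (Module.End k V)ᵐᵒᵖ) (C := Double k H) (μ := doubleMul k H)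
    comul_doubleDual x X φ
  exact h

theorem vertexEmb_apply (h : H) :
    vertexEmb k H V h = dualEmb k (C := Double k H) (Module.End k V)ᵐᵒᵖ (counit ⊗ₜ h) := rfl

theorem faceEmb_apply (a : Module.Dual k H) :
    faceEmb k H V a = dualEmb k (C := Double k H) (Module.End k V)ᵐᵒᵖ (a ⊗ₜ 1) := rfl

theorem vertexEmb_mul_apply (h : H) (X : DoubleConv k H V) (φ : Module.Dual k (Double k H)) :
    (vertexEmb k H V h * X) φ = X (lmulDual (counit ⊗ₜ h) φ) :=
  dualEmb_double_mul_apply _ _ _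

theorem faceEmb_mul_apply (a : Module.Dual k H) (X : DoubleConv k H V)
    (φ : Module.Dual k (Double k H)) :
    (faceEmb k H V a * X) φ = X (lmulDual (a ⊗ₜ 1) φ) :=
  dualEmb_double_mul_apply _ _ _

theorem mul_vertexEmb_apply (h : H) (X : DoubleConv k H V) (φ : Module.Dual k (Double k H)) :
    (X * vertexEmb k H V h) φ = X (rmulDual (counit ⊗ₜ h) φ) :=
  mul_dualEmb_double_apply _ _ _

theorem mul_faceEmb_apply (a : Module.Dual k H) (X : DoubleConv k H V)
    (φ : Module.Dual k (Double k H)) :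
    (X * faceEmb k H V a) φ = X (rmulDual (a ⊗ₜ 1) φ) :=
  mul_dualEmb_double_apply _ _ _

theorem constOp_mul_apply {K : Type*} [AddCommGroup K] [Module k K] [Coalgebra k K]
    (F : K →ₗ[k] Module.End k V) (c : K) (X : DoubleConv k H V) (φ : Module.Dual k (Double k H)) :
    (constOp (Module.Dual k (Double k H)) F c * X) φ = op (F c) * X φ :=
  convConst_mul_apply _ _ _

theorem mul_constOp_apply {K : Type*} [AddCommGroup K] [Module k K] [Coalgebra k K]
    (F : K →ₗ[k] Module.End k V) (c : K) (X : DoubleConv k H V) (φ : Module.Dual k (Double k H)) :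
    (X * constOp (Module.Dual k (Double k H)) F c) φ = X φ * op (F c) :=
  mul_convConst_apply _ _ _

theorem double_commute_constOp {K : Type*} [AddCommGroup K] [Module k K] [Coalgebra k K]
    (F : K →ₗ[k] Module.End k V) (c : K) (x : Double k H) :
    Commute (constOp (Module.Dual k (Double k H)) F c)
      (dualEmb k (C := Double k H) (Module.End k V)ᵐᵒᵖ x) :=
  convConst_commute_dualEmb _ _

theorem vertexEmb_mul (g h : H) :
    vertexEmb k H V (g * h) = vertexEmb k H V g * vertexEmb k H V h := by
  simp only [vertexEmb_apply]
  rw [← dualEmb_mul (C := Double k H) (μ := doubleMul k H) comul_doubleDual, doubleMul_counit_tmul]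

theorem vertexEmb_one : vertexEmb k H V 1 = 1 := by
  refine conv_ext fun φ => ?_
  rw [← mul_one (vertexEmb k H V 1), vertexEmb_mul_apply]
  exact congrArg _ (LinearMap.ext fun x => congrArg φ (doubleOne_mul x))

theorem faceEmb_mul (a b : Module.Dual k H) :
    faceEmb k H V (dualMul k H (a ⊗ₜ b)) = faceEmb k H V b * faceEmb k H V a := by
  simp only [faceEmb_apply]
  rw [← dualEmb_mul (C := Double k H) (μ := doubleMul k H) comul_doubleDual, doubleMul_tmul_one]

theorem faceEmb_counit : faceEmb k H V counit = 1 := vertexEmb_one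

end ConvRelations

/-! ### The local relations: leaving, arriving and staying. -/

section TriangleRelations

attribute [local instance] hopfDualCoalgebra doubleDualCoalgebra

variable {k H V : Type*} [Field k] [Ring H] [HopfAlgebra k H] [FiniteDimensional k H]
  [AddCommGroup V] [Module k V]

/-- A direct triangle operator as an element of the convolution ring. -/
def directElt (T : Module.Dual k H →ₗ[k] Module.End k V) : DoubleConv k H V :=
  toOp (T ∘ₗ dualRight counit)

/-- A dual triangle operator as an element of the convolution ring. -/
def dualElt (L : H →ₗ[k] Module.End k V) : DoubleConv k H V :=
  toOp (L ∘ₗ antipInv k H ∘ₗ dualLeft 1)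

theorem directElt_apply (T : Module.Dual k H →ₗ[k] Module.End k V)
    (φ : Module.Dual k (Double k H)) : directElt T φ = op (T (dualRight counit φ)) := rfl

theorem dualElt_apply (L : H →ₗ[k] Module.End k V)
    (φ : Module.Dual k (Double k H)) :
    dualElt L φ = op (L (antipInv k H (dualLeft 1 φ))) := rfl

theorem exists_dualRight (a : Module.Dual k H) :
    ∃ φ : Module.Dual k (Double k H), dualRight counit φ = a := by
  refine ⟨TensorProduct.dualDistrib k (Module.Dual k H) H (Module.Dual.eval k H 1 ⊗ₜ a), ?_⟩
  ext x
  simp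

theorem eq_mul_of_mul_eq_mul_inv {M : Type*} [Monoid M] {p x i j : M} (e : p * x = x * (p * j))
    (h : j * i = 1) : x * p = p * x * i := by
  rw [e, mul_assoc, mul_assoc, h, mul_one]

theorem eq_inv_mul_of_mul_eq {M : Type*} [Monoid M] {p x i j : M} (e : p * x = i * x * p)
    (h : j * i = 1) : x * p = j * (p * x) := by
  rw [e, mul_assoc, ← mul_assoc j, h, one_mul]

variable {L : H →ₗ[k] Module.End k V} {T : Module.Dual k H →ₗ[k] Module.End k V}

/-- Replacing a by a(c₁ ·) in the direct triangle operator is left multiplication by ε ⊗ c₁ in the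
double, which is the factor `vertexEmb`. -/
theorem StartRel.vertex (h : StartRel L T) :
    constOp _ L * convConst k H (directElt T) =
      vertexEmb k H V * convConst k H (directElt T) * constOp _ L := by
  refine conv_ext fun c => conv_ext fun φ => ?_
  rw [mul_convConst_apply, constOp_mul_apply, directElt_apply, ← op_mul, h _ c (ℛ k c),
    conv_apply _ _ (ℛ k c)]
  simp only [mul_convConst_apply, ofConv_sum, LinearMap.sum_apply, Finset.op_sum, mul_constOp_apply,
    vertexEmb_mul_apply, directElt_apply, dualRight_counit_lmulDual, op_mul]

theorem conv_antip_vertexEmb :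
    vertexEmb k H V * toConv ((vertexEmb k H V).ofConv ∘ₗ antip k H) = 1 := by
  exact conv_antip (AlgHom.ofLinearMap (vertexEmb k H V).ofConv vertexEmb_one vertexEmb_mul)

theorem antip_conv_vertexEmb :
    toConv ((vertexEmb k H V).ofConv ∘ₗ antip k H) * vertexEmb k H V = 1 := by
  exact antip_conv (AlgHom.ofLinearMap (vertexEmb k H V).ofConv vertexEmb_one vertexEmb_mul)

theorem constOp_commute_vertexEmb {K : Type*} [AddCommGroup K] [Module k K] [Coalgebra k K]
    (F : K →ₗ[k] Module.End k V) (c : K) (h : H) :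
    Commute (constOp (Module.Dual k (Double k H)) F c) (vertexEmb k H V h) :=
  double_commute_constOp _ _ _

theorem constOp_commute_faceEmb {K : Type*} [AddCommGroup K] [Module k K] [Coalgebra k K]
    (F : K →ₗ[k] Module.End k V) (c : K) (a : Module.Dual k H) :
    Commute (constOp (Module.Dual k (Double k H)) F c) (faceEmb k H V a) :=
  double_commute_constOp _ _ _

/-- The relation naturally contains S(c₂), that is, the convolution inverse of `vertexEmb`.
Multiplying by `vertexEmb` on the right removes it. -/
theorem EndRel.vertex (h : EndRel L T) :
    convConst k H (directElt T) * constOp _ L =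
      constOp _ L * convConst k H (directElt T) * vertexEmb k H V := by
  have e : constOp _ L * convConst k H (directElt T) = convConst k H (directElt T) *
      (constOp _ L * toConv ((vertexEmb k H V).ofConv ∘ₗ antip k H)) := by
    refine conv_ext fun c => conv_ext fun φ => ?_
    rw [mul_convConst_apply, constOp_mul_apply, directElt_apply, ← op_mul, h _ c (ℛ k c),
      convConst_mul_apply, conv_apply _ _ (ℛ k c), Finset.mul_sum]
    have e' : ∀ x y, constOp (Module.Dual k (Double k H)) L x *
        (toConv ((vertexEmb k H V).ofConv ∘ₗ antip k H)) y =
        vertexEmb k H V (antip k H y) * constOp (Module.Dual k (Double k H)) L x :=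
      fun x y => (constOp_commute_vertexEmb L x (antip k H y)).eq
    simp only [e', ← mul_assoc, ofConv_sum, LinearMap.sum_apply, Finset.op_sum, mul_constOp_apply,
      mul_vertexEmb_apply, directElt_apply, dualRight_counit_rmulDual, op_mul]
  exact eq_mul_of_mul_eq_mul_inv e antip_conv_vertexEmb

/-- The start relation is solved for the opposite order by cancelling the invertible factor
`vertexEmb`. -/
theorem StartRel.symm (h : StartRel L T) (a : Module.Dual k H) {c : H} (r : Repr k c (H × H)) :
    L c * T a = ∑ i ∈ r.index,
      T (a ∘ₗ LinearMap.mulLeft k (antip k H (r.left i))) * L (r.right i) := by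
  obtain ⟨φ, rfl⟩ := exists_dualRight a
  have e : convConst k H (directElt T) * constOp _ L =
      toConv ((vertexEmb k H V).ofConv ∘ₗ antip k H) *
        (constOp _ L * convConst k H (directElt T)) :=
    eq_inv_mul_of_mul_eq h.vertex antip_conv_vertexEmb
  have e' := DFunLike.congr_fun (congrArg ofConv e) c
  rw [convConst_mul_apply, conv_apply _ _ r] at e'
  have e2 := DFunLike.congr_fun (congrArg ofConv e') φ
  apply op_injective
  have e3 : ∀ x, (toConv ((vertexEmb k H V).ofConv ∘ₗ antip k H)) x =
    vertexEmb k H V (antip k H x) := fun x => rfl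
  simp only [e3, mul_convConst_apply, ofConv_sum, LinearMap.sum_apply, mul_constOp_apply,
    vertexEmb_mul_apply, constOp_mul_apply, directElt_apply, dualRight_counit_lmulDual] at e2
  simpa only [op_mul, Finset.op_sum] using e2

/-- The same exchange relation, read with the direct triangle as part of a face action and the dual
triangle as part of the ribbon. The S⁻¹ built into the ribbon operator of a dual triangle cancels
the S of `StartRel.symm`. -/
theorem StartRel.face (h : StartRel L T) :
    constOp _ T * convConst k (Module.Dual k H) (dualElt L) =
      faceEmb k H V * convConst k (Module.Dual k H) (dualElt L) * constOp _ T := by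
  refine conv_ext fun a => conv_ext fun φ => ?_
  let r := ℛ k (dualLeft (k := k) 1 φ)
  rw [mul_convConst_apply, constOp_mul_apply, dualElt_apply, ← op_mul, h.symm a (antipInvRepr r),
    conv_apply _ _ (ℛ k a)]
  simp only [mul_convConst_apply, ofConv_sum, LinearMap.sum_apply, Finset.op_sum, mul_constOp_apply,
    faceEmb_mul_apply, dualElt_apply, dualLeft_one_lmulDual _ φ r, antipInvRepr_index,
    antipInvRepr_left, antipInvRepr_right, antip_antipInv, ← dual_sum_left (ℛ k a), map_sum,
    map_smul, Finset.sum_mul, op_mul, op_smul, smul_mul_assoc]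
  exact Finset.sum_comm

theorem EndRel.face (h : EndRel L T) :
    convConst k (Module.Dual k H) (dualElt L) * constOp _ T =
      constOp _ T * convConst k (Module.Dual k H) (dualElt L) * faceEmb k H V := by
  refine conv_ext fun a => conv_ext fun φ => ?_
  let r := ℛ k (dualLeft (k := k) 1 φ)
  rw [convConst_mul_apply, mul_constOp_apply, dualElt_apply, ← op_mul, h a _ (antipInvRepr r),
    conv_apply _ _ (ℛ k a)]
  simp only [mul_convConst_apply, ofConv_sum, LinearMap.sum_apply, Finset.op_sum, constOp_mul_apply, mul_assoc,
    mul_faceEmb_apply, dualElt_apply, dualLeft_one_rmulDual _ φ r, antipInvRepr_index,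
    antipInvRepr_left, antipInvRepr_right, antip_antipInv, ← dual_sum_right (ℛ k a), map_sum,
    map_smul, Finset.mul_sum, op_mul, op_smul, mul_smul_comm]
  exact Finset.sum_comm

/-- Left multiplication by ε ⊗ c conjugates the `H`-component of φ by S(c₁) and c₃. After applying
S⁻¹ and multiplicativity of L, one of these factors cancels against L(c), and both sides become the
same product. -/
theorem stay_vertex (hL : ∀ g h, L (g * h) = L g * L h) :
    constOp _ L * convConst k H (dualElt L) * vertexEmb k H V =
      vertexEmb k H V * convConst k H (dualElt L) * constOp _ L := by
  refine conv_ext fun c => conv_ext fun φ => ?_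
  let r := ℛ k c
  let I : WithConv (H →ₗ[k] Hᵐᵒᵖ) := toConv (opLinearEquiv k).toLinearMap
  -- In the opposite algebra it is S⁻¹, rather than S, that is convolution inverse to the identity.
  let S : WithConv (H →ₗ[k] Hᵐᵒᵖ) := toConv ((opLinearEquiv k).toLinearMap ∘ₗ antipInv k H)
  let t : H →ₗ[k] H :=
    { toFun := fun h => antipInv k H (dualLeft h φ)
      map_add' := fun x y => by
        rw [← map_add]; congr 1; exact dual_ext (k := k) fun b => by simp [TensorProduct.tmul_add]
      map_smul' := fun x y => by
        rw [← map_smul]; congr 1; exact dual_ext (k := k) fun b => by simp }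
  let θ : WithConv (H →ₗ[k] Hᵐᵒᵖ) := toConv ((opLinearEquiv k).toLinearMap ∘ₗ t)
  have hI : ∀ x, I x = op x := fun x => rfl
  have hS : ∀ x, S x = op (antipInv k H x) := fun x => rfl
  have hθ : ∀ x, θ x = op (antipInv k H (dualLeft x φ)) := fun x => rfl
  have hSI : S * I = 1 := by
    refine conv_ext fun x => ?_
    rw [conv_apply _ _ (ℛ k x)]
    apply unop_injective
    apply antip_injective (k := k)
    have := HopfAlgebra.sum_mul_antipode_eq_algebraMap_counit (R := k) (ℛ k x)
    simp only [hS, hI, ← op_mul, ← Finset.op_sum, unop_op, map_sum, antip_mul, antip_antipInv]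
    rw [show (1 : WithConv (H →ₗ[k] Hᵐᵒᵖ)) x = algebraMap k _ (counit (R := k) x) from rfl]
    simp only [Algebra.algebraMap_eq_smul_one, unop_smul, unop_one, map_smul, antip_one] at this ⊢
    exact this
  -- The left side encodes the effect of left multiplication in the double, the right side that of
  -- right multiplication.
  have key : I * (θ * S) * I = I * θ := by rw [mul_assoc, mul_assoc, hSI, mul_one]
  have key' := congrArg (fun x => op (L (unop x))) (DFunLike.congr_fun (congrArg ofConv key) c)
  have h1 : ∀ x, antipInv k H (dualLeft 1 (lmulDual (counit ⊗ₜ x) φ)) =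
      unop ((I * (θ * S)) x) := by
    intro x
    let r := ℛ k x
    let r' := fun i => ℛ k (r.right i)
    rw [dualLeft_one_lmulDual_counit φ r r', conv_apply _ _ r]
    simp only [conv_apply _ _ (r' _), hI, hS, hθ, map_sum, antipInv_mul, antipInv_antip, Finset.mul_sum,
      Finset.unop_sum, unop_mul, unop_op, mul_assoc]
  rw [conv_apply _ _ r, conv_apply _ _ r] at key' ⊢
  simp only [mul_convConst_apply, ofConv_sum, LinearMap.sum_apply, constOp_mul_apply, mul_assoc,
    mul_vertexEmb_apply, dualElt_apply, dualLeft_one_rmulDual_counit, mul_constOp_apply,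
    vertexEmb_mul_apply, h1]
  simp only [Finset.unop_sum, unop_mul, hI, hθ, unop_op, map_sum, hL, Finset.op_sum, op_mul] at key'
  exact key'.symm

/-- Anti-multiplicativity of T reduces the claim to an equality of functionals on `H`. At x both
equal φ(a(· x₂) ⊗ x₁): on one side immediately, on the other after x₁ S(x₂) collapses. -/
theorem stay_face (hT : ∀ a b, T (dualMul k H (a ⊗ₜ b)) = T b * T a) :
    constOp _ T * convConst k (Module.Dual k H) (directElt T) * faceEmb k H V =
      faceEmb k H V * convConst k (Module.Dual k H) (directElt T) * constOp _ T := by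
  refine conv_ext fun a => conv_ext fun φ => ?_
  let r := ℛ k a
  rw [conv_apply _ _ r, conv_apply _ _ r]
  simp only [mul_convConst_apply, ofConv_sum, LinearMap.sum_apply, constOp_mul_apply, mul_assoc,
    mul_faceEmb_apply, directElt_apply, mul_constOp_apply, faceEmb_mul_apply,
    dualRight_counit_lmulDual_one, ← op_mul, ← Finset.op_sum, ← hT]
  rw [← map_sum T, ← map_sum T]
  congr 2
  ext x
  let q := ℛ k x
  let s := fun i => ℛ k (q.left i)
  let s' := fun i => ℛ k (q.right i)
  let M : H ⊗[k] H →ₗ[k] k := φ ∘ₗ (TensorProduct.lift (sandwich k H a)).rTensor H ∘ₗ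
    (TensorProduct.assoc k H H H).symm.toLinearMap ∘ₗ
    ((TensorProduct.comm k H H).toLinearMap ∘ₗ comul).lTensor H
  have hM : ∀ u y, ∀ p : Repr k y (H × H), M (u ⊗ₜ y) = ∑ j ∈ p.index,
      φ (sandwich k H a u (p.right j) ⊗ₜ p.left j) := by
    intro u y p
    simp [M, ← p.eq, TensorProduct.tmul_sum]
  have e := congrArg (M ∘ₗ (LinearMap.mul' k H ∘ₗ (antip k H).lTensor H).rTensor H ∘ₗ
    (TensorProduct.assoc k H H H).symm.toLinearMap) (sum_tmul_tmul_eq q s s')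
  simp only [map_sum, LinearMap.comp_apply, LinearEquiv.coe_coe, TensorProduct.assoc_symm_tmul,
    LinearMap.rTensor_tmul, LinearMap.lTensor_tmul, LinearMap.mul'_apply] at e
  have e1 : ∀ i, ∑ j ∈ (s i).index, (s i).left j * antip k H ((s i).right j) =
    counit (R := k) (q.left i) • 1 := fun i => by
      have := HopfAlgebra.sum_mul_antipode_eq_algebraMap_counit (R := k) (s i)
      rwa [Algebra.algebraMap_eq_smul_one] at this
  -- Inserts x₁ S(x₂) in place of a counit, so that the result matches the expansion of the product
  -- with the face embedding.
  have e2 : M (1 ⊗ₜ x) = ∑ i ∈ q.index, ∑ j ∈ (s' i).index,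
      M ((q.left i * antip k H ((s' i).left j)) ⊗ₜ (s' i).right j) := by
    rw [← e]
    simp only [← map_sum, ← TensorProduct.sum_tmul, e1, TensorProduct.smul_tmul,
      ← TensorProduct.tmul_sum, sum_counit_smul]
  simp only [LinearMap.sum_apply, dualMul_tmul_apply _ _ q]
  rw [Finset.sum_comm, Finset.sum_comm (s := r.index)]
  calc _ = M (1 ⊗ₜ x) := by
        rw [e2]
        refine Finset.sum_congr rfl fun i _ => ?_
        have e3 : ∀ u p w, ∑ j ∈ r.index, r.left j u • sandwich k H (r.right j) p w =
            sandwich k H a (u * p) w := by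
          intro u p w
          ext y
          have := congrArg (fun f => f (p * (y * w))) (dual_sum_left r u)
          simpa [mul_assoc] using this
        simp only [dualRight_counit_rmulDual_one _ φ (s' i) fun j => ℛ k ((s' i).right j),
          hM _ _ (ℛ k _), ← e3, TensorProduct.sum_tmul, map_sum, ← TensorProduct.smul_tmul',
          map_smul, smul_eq_mul, Finset.mul_sum]
        rw [Finset.sum_comm]
        refine Finset.sum_congr rfl fun j _ => ?_
        rw [Finset.sum_comm]
    _ = _ := by
        rw [hM _ _ q]
        refine Finset.sum_congr rfl fun i _ => ?_
        have e3 : ∑ j ∈ r.index, r.right j (q.right i) • r.left j =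
            sandwich k H a 1 (q.right i) := by
          rw [dual_sum_right]
          ext y
          simp
        rw [← e3, TensorProduct.sum_tmul, map_sum]
        simp [← TensorProduct.smul_tmul', mul_comm]

end TriangleRelations

/-! ### Triangle operators on the lattice, and ribbon operators as products. -/

section Triangles

attribute [local instance] hopfDualCoalgebra doubleDualCoalgebra

variable {k H : Type*} [Field k] [Ring H] [HopfAlgebra k H] [FiniteDimensional k H] {m n : ℕ}

theorem onArrow_apply (e : Arrow m n) (f : Module.End k H) :
    onArrow k H e f = PiTensorProduct.map (Function.update (fun _ => LinearMap.id) e f) := rfl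

theorem onArrow_mul (e : Arrow m n) (f g : Module.End k H) :
    onArrow k H e (f * g) = onArrow k H e f * onArrow k H e g := by
  simp only [onArrow_apply]
  rw [← PiTensorProduct.map_mul]
  congr 1
  funext i
  by_cases h : i = e
  · subst h; simp
  · simp [h]; rfl

theorem onArrow_one (e : Arrow m n) : onArrow k H e 1 = 1 := by
  rw [onArrow_apply, Module.End.one_eq_id, Function.update_eq_self]
  exact PiTensorProduct.map_one

variable (k H) in
/-- `onArrow` as a homomorphism of algebras. -/
def onArrowHom (e : Arrow m n) : Module.End k H →ₐ[k] Module.End k (Hilb k H m n) :=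
  AlgHom.ofLinearMap (onArrow k H e) (onArrow_one e) (onArrow_mul e)

theorem onArrow_commute {e e' : Arrow m n} (h : e ≠ e') (f g : Module.End k H) :
    Commute (onArrow k H e f) (onArrow k H e' g) := by
  simp only [Commute, SemiconjBy, onArrow_apply]
  rw [← PiTensorProduct.map_mul, ← PiTensorProduct.map_mul]
  congr 1
  funext i
  by_cases h1 : i = e
  · subst h1; simp [h]; rfl
  · by_cases h2 : i = e'
    · subst h2; simp [h1]; rfl
    · simp [h1, h2]

theorem onArrow_commute_of_commute (e : Arrow m n) {f g : Module.End k H} (h : Commute f g) :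
    Commute (onArrow k H e f) (onArrow k H e g) :=
  h.map (onArrowHom k H e)

/-! ### Dual triangles -/

theorem antipSgn_mul (ς : Sgn) (x y : H) :
    antipSgn k H ς (x * y) = antipSgn k H ς y * antipSgn k H ς x := by
  cases ς
  · exact antip_mul x y
  · exact antipInv_mul x y

theorem antipSgn_one (ς : Sgn) : antipSgn k H ς 1 = 1 := by
  cases ς
  · exact antip_one
  · exact antipInv_one

theorem dualTriangle_of_outward (ς : Sgn) {s : Site m n} (h : s.Outward) :
    dualTriangle k H ς s = onArrow k H s.arrow ∘ₗ LinearMap.mul k H := by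
  rw [dualTriangle, if_pos h]

theorem dualTriangle_of_not_outward (ς : Sgn) {s : Site m n} (h : ¬ s.Outward) :
    dualTriangle k H ς s =
      onArrow k H s.arrow ∘ₗ (LinearMap.mul k H).flip ∘ₗ antipSgn k H ς := by
  rw [dualTriangle, if_neg h]

theorem dualTriangle_congr {ς ς' : Sgn} {s : Site m n}
    (h : ¬ s.Outward → antipSgn k H ς = antipSgn k H ς') :
    dualTriangle k H ς s = dualTriangle k H ς' s := by
  by_cases hs : s.Outward
  · rw [dualTriangle_of_outward _ hs, dualTriangle_of_outward _ hs]
  · rw [dualTriangle_of_not_outward _ hs, dualTriangle_of_not_outward _ hs, h hs]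

theorem dualTriangle_mul (ς : Sgn) (s : Site m n) (g h : H) :
    dualTriangle k H ς s (g * h) = dualTriangle k H ς s g * dualTriangle k H ς s h := by
  by_cases hs : s.Outward
  · rw [dualTriangle_of_outward _ hs]
    simp only [LinearMap.comp_apply]
    rw [← onArrow_mul]
    congr 1
    ext x
    simp [mul_assoc]
  · rw [dualTriangle_of_not_outward _ hs]
    simp only [LinearMap.comp_apply]
    rw [← onArrow_mul]
    congr 1
    ext x
    simp [mul_assoc, antipSgn_mul]

theorem dualTriangle_one (ς : Sgn) (s : Site m n) : dualTriangle k H ς s 1 = 1 := by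
  by_cases hs : s.Outward
  · rw [dualTriangle_of_outward _ hs, LinearMap.comp_apply, ← onArrow_one s.arrow]
    congr 1
    ext x
    simp
  · rw [dualTriangle_of_not_outward _ hs, LinearMap.comp_apply, ← onArrow_one s.arrow]
    congr 1
    ext x
    simp [antipSgn_one]

/-- If the two triangles cross the same arrow from its two ends, one multiplies on the left and the
other on the right. This holds for all choices of signs. -/
theorem dualTriangle_commute_of_opposite (ς ς' : Sgn) {s t : Site m n}
    (h : s.Outward ↔ ¬ t.Outward) (x y : H) :
    Commute (dualTriangle k H ς s x) (dualTriangle k H ς' t y) := by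
  by_cases ha : s.arrow = t.arrow
  · by_cases hs : s.Outward
    · rw [dualTriangle_of_outward _ hs, dualTriangle_of_not_outward _ (h.1 hs), ha]
      refine onArrow_commute_of_commute _ (LinearMap.ext fun g => ?_)
      simp [mul_assoc]
    · rw [dualTriangle_of_not_outward _ hs, dualTriangle_of_outward _ (not_not.1 (mt h.2 hs)), ha]
      refine onArrow_commute_of_commute _ (LinearMap.ext fun g => ?_)
      simp [mul_assoc]
  · exact onArrow_commute ha _ _

/-! ### Direct triangles -/

theorem directTriangle_of_outward {s : Site m n} (h : s.Outward) :
    directTriangle k H s = onArrow k H s.arrow ∘ₗ coactAlong k H := by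
  rw [directTriangle, if_pos h]

theorem directTriangle_of_not_outward {s : Site m n} (h : ¬ s.Outward) :
    directTriangle k H s = onArrow k H s.arrow ∘ₗ coactAgainst k H := by
  rw [directTriangle, if_neg h]

theorem directTriangle_dualMul (s : Site m n) (a b : Module.Dual k H) :
    directTriangle k H s (dualMul k H (a ⊗ₜ b)) =
      directTriangle k H s b * directTriangle k H s a := by
  by_cases hs : s.Outward
  · simp only [directTriangle_of_outward hs, LinearMap.comp_apply, coactAlong_dualMul, onArrow_mul]
  · simp only [directTriangle_of_not_outward hs, LinearMap.comp_apply, coactAgainst_dualMul,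
      onArrow_mul]

theorem directTriangle_counit (s : Site m n) : directTriangle k H s counit = 1 := by
  by_cases hs : s.Outward
  · rw [directTriangle_of_outward hs, LinearMap.comp_apply, coactAlong_counit, onArrow_one]
  · rw [directTriangle_of_not_outward hs, LinearMap.comp_apply, coactAgainst_counit, onArrow_one]

theorem directTriangle_commute_of_opposite {s t : Site m n}
    (h : s.Outward ↔ ¬ t.Outward) (x y : Module.Dual k H) :
    Commute (directTriangle k H s x) (directTriangle k H t y) := by
  by_cases ha : s.arrow = t.arrow
  · by_cases hs : s.Outward
    · rw [directTriangle_of_outward hs, directTriangle_of_not_outward (h.1 hs), ha]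
      exact onArrow_commute_of_commute _ (commute_coactAlong_coactAgainst _ _)
    · rw [directTriangle_of_not_outward hs, directTriangle_of_outward (not_not.1 (mt h.2 hs)), ha]
      exact onArrow_commute_of_commute _ (commute_coactAlong_coactAgainst _ _).symm
  · exact onArrow_commute ha _ _

/-- The origin of the sign − at a triangle that leaves: an inward arrow must carry S⁻¹. -/
theorem startRel_triangle {ς : Sgn} {s : Site m n}
    (h : ¬ s.Outward → antipSgn k H ς = antipInv k H) :
    StartRel (dualTriangle k H ς s) (directTriangle k H s) := by
  by_cases hs : s.Outward
  · rw [dualTriangle_of_outward _ hs, directTriangle_of_outward hs]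
    exact startRel_mul_coactAlong.map (onArrowHom k H s.arrow)
  · rw [dualTriangle_of_not_outward _ hs, directTriangle_of_not_outward hs, h hs]
    exact startRel_flip_coactAgainst.map (onArrowHom k H s.arrow)

/-- The origin of the sign + at a triangle that arrives. The two sites look at the same arrow from
opposite ends, so an arrow inward for the dual triangle is traversed along its direction by the
direct one. -/
theorem endRel_triangle {ς : Sgn} {s u : Site m n} (ha : u.arrow = s.arrow)
    (ho : u.Outward ↔ ¬ s.Outward) (h : ¬ s.Outward → antipSgn k H ς = antip k H) :
    EndRel (dualTriangle k H ς s) (directTriangle k H u) := by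
  by_cases hs : s.Outward
  · rw [dualTriangle_of_outward _ hs, directTriangle_of_not_outward fun h' => ho.1 h' hs, ha]
    exact endRel_mul_coactAgainst.map (onArrowHom k H s.arrow)
  · rw [dualTriangle_of_not_outward _ hs, directTriangle_of_outward (ho.2 hs), h hs, ha]
    exact endRel_flip_coactAlong.map (onArrowHom k H s.arrow)

theorem dualTriangle_commute_directTriangle (ς : Sgn) {s u : Site m n} (h : s.arrow ≠ u.arrow)
    (x : H) (a : Module.Dual k H) :
    Commute (dualTriangle k H ς s x) (directTriangle k H u a) :=
  onArrow_commute h _ _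

/-! ### Ribbon operators as products -/

theorem toOp_triangleRibbon_direct (ς : Sgn) (s : Site m n) :
    toOp (triangleRibbon k H ς .direct s) = directElt (directTriangle k H s) := by
  refine conv_ext fun φ => ?_
  obtain ⟨t, rfl⟩ := (doubleDualEquiv k H).surjective φ
  rw [toOp_apply, directElt_apply, triangleRibbon, LinearMap.comp_apply, LinearEquiv.coe_coe,
    LinearEquiv.symm_apply_apply]
  congr 1
  induction t with
  | zero => simp
  | add x y hx hy => simp only [map_add, hx, hy]
  | tmul h a =>
    simp only [LinearMap.comp_apply, TensorProduct.map_tmul, LinearEquiv.coe_coe,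
      TensorProduct.lid_tmul, ← map_smul]
    rfl

theorem toOp_triangleRibbon_dual (ς : Sgn) (s : Site m n) :
    toOp (triangleRibbon k H ς .dual s) = dualElt (dualTriangle k H ς s) := by
  refine conv_ext fun φ => ?_
  obtain ⟨t, rfl⟩ := (doubleDualEquiv k H).surjective φ
  rw [toOp_apply, dualElt_apply, triangleRibbon, LinearMap.comp_apply, LinearEquiv.coe_coe,
    LinearEquiv.symm_apply_apply]
  congr 1
  induction t with
  | zero => simp
  | add x y hx hy => simp only [map_add, hx, hy]
  | tmul h a =>
    simp only [LinearMap.comp_apply, TensorProduct.map_tmul, LinearEquiv.coe_coe,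
      TensorProduct.rid_tmul, ← map_smul]
    congr 2
    refine dual_ext (k := k) fun b => ?_
    simp [doubleDualEquiv, mul_comm]

variable (k H) in
/-- The factor of the `j`-th triangle of a ribbon in its ribbon operator. -/
def triangleElt (σ : ℕ → Sgn) (ξ : Ribbon m n) (j : ℕ) : DoubleConv k H (Hilb k H m n) :=
  -- The default value `.dual` concerns only `j ≥ ξ.length`, where no factor enters the product.
  toOp (triangleRibbon k H (σ j) (ξ.triangles.getD j .dual) (ξ.site j))

/-- The recursion defining the ribbon operator is multiplication by one more factor on the left in
the convolution ring, starting from its unit, which is evaluation at the unit of the double. -/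
theorem toOp_ribbonOp (σ : ℕ → Sgn) (ξ : Ribbon m n) :
    toOp (ribbonOp k H σ ξ) = pathProd (triangleElt k H σ ξ) 0 ξ.length := by
  obtain ⟨s, w⟩ := ξ
  induction w generalizing s σ with
  | nil =>
    refine conv_ext fun φ => ?_
    rfl
  | cons τ w ih =>
    have e : toOp (ribbonOp k H σ ⟨s, τ :: w⟩) = toOp (triangleRibbon k H (σ 0) τ s) *
        toOp (ribbonOp k H (fun j => σ (j + 1)) ⟨τ.target s, w⟩) := toOp_convComp _ _
    rw [e, ih]
    change _ = pathProd _ 0 (w.length + 1)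
    rw [pathProd_succ, ← pathProd_shift]
    rfl

end Triangles

/-! ### Combinatorics of sites on the square lattice. -/

section Lattice

variable {m n : ℕ}

/-- The vertex of a site for dual triangles, which turn about it, and the face of a site for direct
triangles, which go around it. -/
def Triangle.centre (κ : Triangle) (s : Site m n) : ZMod m × ZMod n :=
  match κ with
  | .dual => s.vertex
  | .direct => s.face

theorem zmod_one_ne_zero {m : ℕ} (hm : m ≠ 1) : (1 : ZMod m) ≠ 0 := fun h => hm <| by
  simpa using (ZMod.natCast_eq_zero_iff 1 m).1 (by simpa using h)

@[simp] theorem Triangle.centre_target (κ : Triangle) (s : Site m n) :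
    κ.centre (κ.target s) = κ.centre s := by
  obtain ⟨⟨x, y⟩, c⟩ := s
  cases κ <;> cases c <;> simp [Triangle.centre, Triangle.target, Site.turn, Site.move, Site.face]

theorem Triangle.centre_iterate (κ : Triangle) (s : Site m n) (t : ℕ) :
    κ.centre (κ.target^[t] s) = κ.centre s := by
  induction t generalizing s with
  | zero => rfl
  | succ t ih => rw [Function.iterate_succ_apply, ih, centre_target]

/-- A triangle of the other kind shifts the centre by one unit in one coordinate. The shift is
nonzero precisely because the periods differ from 1. -/
theorem Triangle.centre_target_ne (hm : m ≠ 1) (hn : n ≠ 1) {κ κ' : Triangle} (h : κ' ≠ κ)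
    (s : Site m n) : κ.centre (κ'.target s) ≠ κ.centre s := by
  have h1 := zmod_one_ne_zero hm
  have h2 := zmod_one_ne_zero hn
  have h3 : ∀ x : ZMod m, ¬ x = x - 1 := fun x h => h1 (sub_eq_self.1 h.symm)
  have h4 : ∀ x : ZMod n, ¬ x = x - 1 := fun x h => h2 (sub_eq_self.1 h.symm)
  obtain ⟨⟨x, y⟩, c⟩ := s
  cases κ <;> cases κ' <;> cases c <;>
    simp_all [Triangle.centre, Triangle.target, Site.turn, Site.move, Site.face, sub_eq_self]

theorem Triangle.iterate_four (κ : Triangle) (s : Site m n) : κ.target^[4] s = s := by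
  obtain ⟨⟨x, y⟩, c⟩ := s
  cases κ <;> cases c <;> simp [Triangle.target, Site.turn, Site.move]

/-- An arrow is the first arrow of exactly two sites, one at each end and on opposite sides. Going
along the arrow from one of them leads to the same site as going across it from the other. -/
theorem Site.eq_of_arrow_eq {u s : Site m n} (h : u.arrow = s.arrow) : u = s ∨
    (∀ κ κ' : Triangle, κ ≠ κ' → κ.target u = κ'.target s) ∧ (u.Outward ↔ ¬ s.Outward) := by
  obtain ⟨⟨x, y⟩, c⟩ := s
  obtain ⟨⟨x', y'⟩, c'⟩ := u
  cases c <;> cases c' <;> simp [Site.arrow] at h <;> obtain ⟨h1, h2⟩ := h <;>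
    simp [Site.Outward, h1, h2, Triangle.target] <;>
    intro κ κ' hκ <;> cases κ <;> cases κ' <;>
    simp_all [Site.turn, Site.move] <;> simp [← h1, ← h2]

theorem Triangle.iterate_injective (κ : Triangle) (s : Site m n) {t t' : ℕ} (ht : t < 4)
    (ht' : t' < 4) (h : κ.target^[t] s = κ.target^[t'] s) : t = t' := by
  replace h := congrArg Site.corner h
  obtain ⟨⟨x, y⟩, c⟩ := s
  interval_cases t <;> interval_cases t' <;> try rfl
  all_goals
    cases κ <;> cases c <;> simp [Triangle.target, Site.turn, Site.move] at h

theorem Triangle.exists_iterate_eq (κ : Triangle) {s u : Site m n} (h : κ.centre u = κ.centre s) :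
    ∃ t < 4, u = κ.target^[t] s := by
  obtain ⟨⟨x, y⟩, c⟩ := s
  obtain ⟨⟨x', y'⟩, c'⟩ := u
  have : ∃ t < 4, c' = (κ.target^[t] (⟨(x, y), c⟩ : Site m n)).corner := by
    cases κ <;> cases c <;> cases c' <;>
    first
    | exact ⟨0, by decide, rfl⟩
    | exact ⟨1, by decide, rfl⟩
    | exact ⟨2, by decide, rfl⟩
    | exact ⟨3, by decide, rfl⟩
  obtain ⟨t, ht, hc⟩ := this
  refine ⟨t, ht, ?_⟩
  rw [← κ.centre_iterate ⟨(x, y), c⟩ t] at h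
  generalize κ.target^[t] (⟨(x, y), c⟩ : Site m n) = v at h hc
  obtain ⟨⟨x₁, y₁⟩, c₁⟩ := v
  simp only at hc
  subst hc
  cases κ <;> cases c' <;> simpa [Triangle.centre, Site.face] using h

/-- The loop about the vertex of a site and the loop around its face meet only at that site, because
the four vertices of a face are distinct. -/
theorem Triangle.iterate_eq_iterate (hm : m ≠ 1) (hn : n ≠ 1) {κ κ' : Triangle} (hκ : κ ≠ κ')
    (s : Site m n) {a b : ℕ} (ha : a < 4) (hb : b < 4)
    (h : κ.target^[a] s = κ'.target^[b] s) : a = 0 ∧ b = 0 := by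
  have h1 := zmod_one_ne_zero hm
  have h2 := zmod_one_ne_zero hn
  have key : ∀ a < 4, Triangle.dual.centre (Triangle.direct.target^[a] s) =
      Triangle.dual.centre s → a = 0 := by
    intro a ha h
    obtain ⟨⟨x, y⟩, c⟩ := s
    interval_cases a
    · rfl
    all_goals
      cases c <;> simp_all [Triangle.centre, Triangle.target, Site.move, sub_eq_self]
  have key2 : ∀ a b : ℕ, a < 4 → b < 4 → Triangle.direct.target^[a] s = Triangle.dual.target^[b] s →
      a = 0 ∧ b = 0 := by
    intro a b ha hb h
    have := key a ha (by rw [h, Triangle.centre_iterate])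
    subst this
    exact ⟨rfl, (Triangle.iterate_injective .dual s (by decide : 0 < 4) hb h).symm⟩
  cases κ <;> cases κ'
  · exact absurd rfl hκ
  · exact key2 a b ha hb h
  · exact (key2 b a hb ha h.symm).symm
  · exact absurd rfl hκ

end Lattice

/-! ### Strongly open paths and their passage through a vertex or a face. -/

section Paths

variable {m n : ℕ}

theorem Site.arrow_eq_of_target_eq {κ κ' : Triangle} (hκ : κ ≠ κ') {u s : Site m n}
    (h : κ.target u = κ'.target s) : u.arrow = s.arrow ∧ (u.Outward ↔ ¬ s.Outward) := by
  obtain ⟨⟨x, y⟩, c⟩ := s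
  obtain ⟨⟨x', y'⟩, c'⟩ := u
  cases κ <;> cases κ' <;> simp at hκ <;> cases c <;> cases c' <;>
    simp [Triangle.target, Site.turn, Site.move] at h <;> obtain ⟨rfl, rfl⟩ := h <;>
    simp [Site.Outward, Site.arrow]

/-- A sequence of sites joined by triangles that returns to a vertex or a face only if it has not
left it. -/
structure IsStrongPath (u : ℕ → Site m n) (τ : ℕ → Triangle) (N : ℕ) : Prop where
  step : ∀ j < N, u (j + 1) = (τ j).target (u j)
  stays : ∀ (κ : Triangle) (i l j : ℕ), i < l → l < j → j ≤ N →
    κ.centre (u i) = κ.centre (u j) → κ.centre (u l) = κ.centre (u i)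

variable {u : ℕ → Site m n} {τ : ℕ → Triangle} {N : ℕ}

theorem IsStrongPath.shift (hu : IsStrongPath u τ N) {b : ℕ} (hb : b ≤ N) :
    IsStrongPath (fun j => u (j + b)) (fun j => τ (j + b)) (N - b) where
  step j hj := by
    have := hu.step (j + b) (by omega)
    rwa [Nat.add_right_comm] at this
  stays κ i l j hil hlj hj h :=
    hu.stays κ (i + b) (l + b) (j + b) (by omega) (by omega) (by omega) h

theorem IsStrongPath.iterate (hu : IsStrongPath u τ N) {κ : Triangle} {a b : ℕ} (hb : a + b ≤ N)
    (h : ∀ j, a ≤ j → j < a + b → τ j = κ) : u (a + b) = κ.target^[b] (u a) := by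
  induction b with
  | zero => rfl
  | succ b ih =>
    rw [← add_assoc, hu.step _ (by omega), h _ (by omega) (by omega),
      ih (by omega) fun j h1 h2 => h j h1 (by omega), Function.iterate_succ_apply']

/-- Four triangles of one kind return to the same site, so the other centre recurs, although the
first of these triangles has left it. -/
theorem IsStrongPath.lt_four (hm : m ≠ 1) (hn : n ≠ 1) (hu : IsStrongPath u τ N)
    {κ κ' : Triangle} (hκ : κ ≠ κ') {a b : ℕ} (hb : a + b ≤ N)
    (h : ∀ j, a ≤ j → j < a + b → τ j = κ) : b < 4 := by
  by_contra hb4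
  have h4 := hu.iterate (a := a) (b := 4) (by omega) fun j h1 h2 => h j h1 (by omega)
  have h1 := hu.iterate (a := a) (b := 1) (by omega) fun j h1 h2 => h j h1 (by omega)
  rw [Triangle.iterate_four] at h4
  have := hu.stays κ' a (a + 1) (a + 4) (by omega) (by omega) (by omega) (by rw [h4])
  rw [h1] at this
  exact Triangle.centre_target_ne hm hn hκ _ this

/-- Here `k` counts the triangles before the first one of the other kind. That one leaves the
centre, and a later return would force the centre to be kept in between. -/
theorem IsStrongPath.exists_start (hm : m ≠ 1) (hn : n ≠ 1) (hu : IsStrongPath u τ N)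
    {κ : Triangle} (hne : κ.centre (u 0) ≠ κ.centre (u N)) :
    ∃ k < N, k < 4 ∧ τ k ≠ κ ∧ (∀ j < k, τ j = κ) ∧ (∀ j ≤ k, u j = κ.target^[j] (u 0)) ∧
      ∀ j ≤ N, κ.centre (u j) = κ.centre (u 0) → j ≤ k := by
  have hex : ∃ k, k < N ∧ τ k ≠ κ := by
    by_contra! h
    apply hne
    have := hu.iterate (κ := κ) (a := 0) (b := N) (by omega) fun j _ hj => h j (by omega)
    rw [zero_add] at this
    rw [this, Triangle.centre_iterate]
  classical
  obtain ⟨k, ⟨hkN, hk⟩, hmin⟩ : ∃ k, (k < N ∧ τ k ≠ κ) ∧ ∀ j < k, τ j = κ := by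
    refine ⟨Nat.find hex, Nat.find_spec hex, fun j hj => ?_⟩
    have := Nat.find_min hex hj
    have h2 := (Nat.find_spec hex).1
    by_contra h
    exact this ⟨by omega, h⟩
  have hit : ∀ j ≤ k, u j = κ.target^[j] (u 0) := by
    intro j hj
    have := hu.iterate (κ := κ) (a := 0) (b := j) (by omega) fun i _ hi => hmin i (by omega)
    rwa [zero_add] at this
  refine ⟨k, hkN, ?_, hk, hmin, hit, fun j hj h => ?_⟩
  · exact hu.lt_four hm hn (Ne.symm hk) (a := 0) (by omega) fun j _ hj => hmin j (by omega)
  · by_contra hjk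
    have h1 : κ.centre (u (k + 1)) = κ.centre (u 0) := by
      rcases Nat.lt_or_ge (k + 1) j with h' | h'
      · exact hu.stays κ 0 (k + 1) j (by omega) h' hj h.symm
      · rwa [show k + 1 = j by omega]
    rw [hu.step k hkN, ← Triangle.centre_iterate κ (u 0) k, ← hit k le_rfl] at h1
    exact Triangle.centre_target_ne hm hn hk _ h1

/-- Counted backwards: the last `k` triangles stay at the final centre, the one before them arrives
there, and no earlier site has this centre. -/
theorem IsStrongPath.exists_end (hm : m ≠ 1) (hn : n ≠ 1) (hu : IsStrongPath u τ N)
    {κ : Triangle} (hne : κ.centre (u 0) ≠ κ.centre (u N)) :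
    ∃ k < N, k < 4 ∧ τ (N - 1 - k) ≠ κ ∧ (∀ j < k, τ (N - 1 - j) = κ) ∧
      (∀ j ≤ k, u (N - k + j) = κ.target^[j] (u (N - k))) ∧
      ∀ j ≤ N, κ.centre (u j) = κ.centre (u N) → N - k ≤ j := by
  have hex : ∃ k, k < N ∧ τ (N - 1 - k) ≠ κ := by
    by_contra! h
    apply hne
    have := hu.iterate (κ := κ) (a := 0) (b := N) (by omega) fun j _ hj => by
      have := h (N - 1 - j) (by omega)
      rwa [show N - 1 - (N - 1 - j) = j by omega] at this
    rw [zero_add] at this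
    rw [this, Triangle.centre_iterate]
  classical
  obtain ⟨k, ⟨hkN, hk⟩, hmin⟩ :
      ∃ k, (k < N ∧ τ (N - 1 - k) ≠ κ) ∧ ∀ j < k, τ (N - 1 - j) = κ := by
    refine ⟨Nat.find hex, Nat.find_spec hex, fun j hj => ?_⟩
    have := Nat.find_min hex hj
    have h2 := (Nat.find_spec hex).1
    by_contra h
    exact this ⟨by omega, h⟩
  have hin : ∀ j, N - k ≤ j → j < N → τ j = κ := by
    intro j h1 h2
    have := hmin (N - 1 - j) (by omega)
    rwa [show N - 1 - (N - 1 - j) = j by omega] at this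
  have hit : ∀ j ≤ k, u (N - k + j) = κ.target^[j] (u (N - k)) := fun j hj =>
    hu.iterate (by omega) fun i h1 h2 => hin i h1 (by omega)
  have hstep := hu.step (N - 1 - k) (by omega)
  rw [show N - 1 - k + 1 = N - k by omega] at hstep
  have hNc : κ.centre (u N) = κ.centre (u (N - k)) := by
    have := hit k le_rfl
    rw [show N - k + k = N by omega] at this
    rw [this, Triangle.centre_iterate]
  refine ⟨k, hkN, ?_, hk, hmin, hit, fun j hj h => ?_⟩
  · exact hu.lt_four hm hn (Ne.symm hk) (a := N - k) (by omega) fun j h1 h2 => hin j h1 (by omega)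
  · by_contra hjk
    have h1 : κ.centre (u (N - 1 - k)) = κ.centre (u N) := by
      rcases Nat.lt_or_ge j (N - 1 - k) with h' | h'
      · rw [hu.stays κ j (N - 1 - k) N h' (by omega) le_rfl h, h]
      · rwa [show N - 1 - k = j by omega]
    rw [hNc, hstep] at h1
    exact Triangle.centre_target_ne hm hn hk _ h1.symm

section Products

variable {M : Type*} [Monoid M] {κ : Triangle}

/-- A site factor and a ribbon triangle can fail to commute only if they start at the same site, or
if the triangle arrives across or along the arrow of that factor. These are the two ways of sharing
an arrow. -/
theorem IsStrongPath.commute_or (hu : IsStrongPath u τ N) {v : Site m n} {p f : ℕ → M}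
    (hcomm : ∀ j t, j < N → t < 4 → u j ≠ κ.target^[t] v →
      (τ j = κ ∨ (u j).arrow ≠ (κ.target^[t] v).arrow) → Commute (p t) (f j))
    {j t : ℕ} (hj : j < N) (ht : t < 4) : Commute (p t) (f j) ∨ u j = κ.target^[t] v ∨
      (τ j ≠ κ ∧ u (j + 1) = κ.target^[t + 1] v) := by
  by_cases h1 : u j = κ.target^[t] v
  · exact .inr (.inl h1)
  by_cases h2 : τ j = κ ∨ (u j).arrow ≠ (κ.target^[t] v).arrow
  · exact .inl (hcomm j t hj ht h1 h2)
  · push Not at h2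
    refine .inr (.inr ⟨h2.1, ?_⟩)
    rw [hu.step j hj, Function.iterate_succ_apply']
    exact ((Site.eq_of_arrow_eq h2.2).resolve_left h1).1 _ _ h2.1

/-- Since the centre is visited only during the first `k` triangles, the `j`-th triangle can
interact with the `j`-th site factor alone, by staying or, for j = k, by leaving. -/
theorem IsStrongPath.pathProd_start (hm : m ≠ 1) (hn : n ≠ 1) (hu : IsStrongPath u τ N)
    (hne : κ.centre (u 0) ≠ κ.centre (u N)) {p f : ℕ → M} {i : M}
    (hcomm : ∀ j t, j < N → t < 4 → u j ≠ κ.target^[t] (u 0) →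
      (τ j = κ ∨ (u j).arrow ≠ (κ.target^[t] (u 0)).arrow) → Commute (p t) (f j))
    (hstay : ∀ j, j < N → j < 4 → τ j = κ → u j = κ.target^[j] (u 0) →
      p j * f j * i = i * f j * p j)
    (hstart : ∀ j, j < N → j < 4 → τ j ≠ κ → (∀ l < j, τ l = κ) → u j = κ.target^[j] (u 0) →
      p j * f j = i * f j * p j) :
    pathProd p 0 4 * pathProd f 0 N = i * pathProd f 0 N * pathProd p 0 4 := by
  obtain ⟨k, hkN, hk4, hk, hin, hit, hcen⟩ := hu.exists_start hm hn hne
  refine HopfKitaev.pathProd_start (k := k) hk4 hkN (fun j _ hj => ?_) ?_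
    fun j t _ hj _ ht h => ?_
  · rw [zero_add] at hj
    exact hstay j (by omega) (by omega) (hin j hj) (hit j hj.le)
  · rw [zero_add]
    exact hstart k hkN hk4 hk hin (hit k le_rfl)
  · rw [zero_add] at hj ht h
    rcases hu.commute_or hcomm hj ht with hc | hc | ⟨hc, hc'⟩
    · exact hc
    · have hjk := hcen j hj.le (by rw [hc, Triangle.centre_iterate])
      exact absurd ⟨κ.iterate_injective (u 0) (by omega) ht ((hit j hjk).symm.trans hc), hjk⟩ h
    · have hjk := hcen (j + 1) hj (by rw [hc', Triangle.centre_iterate])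
      exact absurd (hin j hjk) hc

/-- The site factors start at the final site, whereas the ribbon reaches the centre `k` triangles
earlier. As four steps close the loop, triangle `j` meets the factor `t` with j + 4 = N + t. -/
theorem IsStrongPath.pathProd_end (hm : m ≠ 1) (hn : n ≠ 1) (hu : IsStrongPath u τ N)
    (hne : κ.centre (u 0) ≠ κ.centre (u N)) {p f : ℕ → M} {i : M}
    (hcomm : ∀ j t, j < N → t < 4 → u j ≠ κ.target^[t] (u N) →
      (τ j = κ ∨ (u j).arrow ≠ (κ.target^[t] (u N)).arrow) → Commute (p t) (f j))
    (hstay : ∀ j t, j < N → t < 4 → j + 4 = N + t → τ j = κ → u j = κ.target^[t] (u N) →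
      p t * f j * i = i * f j * p t)
    (hend : ∀ j t, j < N → t < 4 → j + 4 = N + t → τ j ≠ κ → (∀ l, j < l → l < N → τ l = κ) →
      κ.centre (u (j + 1)) = κ.centre (u N) → (u j).arrow = (κ.target^[t] (u N)).arrow →
      ((u j).Outward ↔ ¬ (κ.target^[t] (u N)).Outward) → f j * p t = p t * f j * i) :
    pathProd f 0 N * pathProd p 0 4 = pathProd p 0 4 * pathProd f 0 N * i := by
  obtain ⟨k, hkN, hk4, hk, hin, hit, hcen⟩ := hu.exists_end hm hn hne
  have huN : u N = κ.target^[k] (u (N - k)) := by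
    rw [← hit k le_rfl, show N - k + k = N by omega]
  have hstep := hu.step (N - 1 - k) (by omega)
  rw [show N - 1 - k + 1 = N - k by omega] at hstep
  -- Going back j + 1 steps along the loop is the same as going forward 3 - j steps.
  have hback : ∀ j < k, u (N - 1 - j) = κ.target^[4 - 1 - j] (u N) := by
    intro j hj
    rw [huN, ← Function.iterate_add_apply, show 4 - 1 - j + k = (k - 1 - j) + 4 by omega,
      Function.iterate_add_apply, Triangle.iterate_four, ← hit _ (by omega)]
    congr 1
    omega
  have hb0 : u (N - k) = κ.target^[4 - k] (u N) := by
    rw [huN, ← Function.iterate_add_apply, show 4 - k + k = 4 by omega, Triangle.iterate_four]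
  refine HopfKitaev.pathProd_end (k := k) hk4 hkN (fun j hj => ?_) ?_ fun j t hj ht h => ?_
  · exact hstay _ _ (by omega) (by omega) (by omega) (hin j hj) (hback j hj)
  -- The arriving triangle ends where the κ-triangle of the site factor number 3 - k ends. Triangles
  -- of different kinds with the same end share their arrow, seen from its opposite ends.
  · have h1 : (τ (N - 1 - k)).target (u (N - 1 - k)) =
        κ.target (κ.target^[4 - 1 - k] (u N)) := by
      rw [← hstep, hb0, ← Function.iterate_succ_apply' (f := κ.target)]
      congr 1
      omega
    obtain ⟨h2, h3⟩ := Site.arrow_eq_of_target_eq hk h1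
    refine hend _ _ (by omega) (by omega) (by omega) hk (fun l h1 h2 => ?_) ?_ h2 h3
    · rw [← hin (N - 1 - l) (by omega)]
      congr 1
      omega
    · rw [show N - 1 - k + 1 = N - k by omega, hb0, Triangle.centre_iterate]
  · rcases hu.commute_or hcomm (j := N - 1 - j) (t := 4 - 1 - t) (by omega) (by omega) with
      hc | hc | ⟨hc, hc'⟩
    · exact hc
    · have hjk := hcen (N - 1 - j) (by omega) (by rw [hc, Triangle.centre_iterate])
      have := κ.iterate_injective (u N) (by omega) (by omega) ((hback j (by omega)).symm.trans hc)
      exact absurd ⟨by omega, by omega⟩ h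
    · have hjk := hcen (N - 1 - j + 1) (by omega) (by rw [hc', Triangle.centre_iterate])
      have hj' : ¬ j < k := fun h' => hc (hin j h')
      have hjk' : j = k := by omega
      subst hjk'
      rw [show N - 1 - j + 1 = N - j by omega, hb0] at hc'
      rw [show 4 - 1 - t + 1 = 4 - t by omega] at hc'
      have ht0 : t = j := by
        by_cases hj0 : j = 0
        · subst hj0
          by_contra ht0
          have := κ.iterate_injective (u N) (t := 0) (t' := 4 - t) (by omega) (by omega)
            (by rw [← hc', Nat.sub_zero, Triangle.iterate_four]; rfl)
          omega
        · by_cases ht0 : t = 0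
          · subst ht0
            have := κ.iterate_injective (u N) (t := 4 - j) (t' := 0) (by omega) (by omega)
              (by rw [hc', Nat.sub_zero, Triangle.iterate_four]; rfl)
            omega
          · have := κ.iterate_injective (u N) (t := 4 - j) (t' := 4 - t) (by omega) (by omega) hc'
            omega
      exact absurd ⟨ht0.symm, le_rfl⟩ h

/-- The path is cut at its first visit `b` to the centre of `v`, with the loop started at `u b`. The
tail is then a path leaving its initial centre, and the head arrives there with its last triangle
and never stays. If there is no visit, no triangle interacts with the loop. -/
theorem IsStrongPath.pathProd_middle (hm : m ≠ 1) (hn : n ≠ 1) (hu : IsStrongPath u τ N)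
    {v : Site m n} (h0 : κ.centre v ≠ κ.centre (u 0)) (hN : κ.centre v ≠ κ.centre (u N))
    {P : Site m n → M} {f : ℕ → M} {i : M}
    (hcomm : ∀ j s, j < N → u j ≠ s → (τ j = κ ∨ (u j).arrow ≠ s.arrow) → Commute (P s) (f j))
    (hstay : ∀ j, j < N → τ j = κ → P (u j) * f j * i = i * f j * P (u j))
    (hstart : ∀ j, j < N → τ j ≠ κ → P (u j) * f j = i * f j * P (u j))
    (hend : ∀ j s, j < N → τ j ≠ κ → (u j).arrow = s.arrow → ((u j).Outward ↔ ¬ s.Outward) →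
      f j * P s = P s * f j * i) :
    (∀ t j, j < N → Commute (P (κ.target^[t] v)) (f j)) ∨
    ∃ b ≤ N, κ.centre (u b) = κ.centre v ∧
      pathProd (fun t => P (κ.target^[t] (u b))) 0 4 * pathProd f b (N - b) =
        i * pathProd f b (N - b) * pathProd (fun t => P (κ.target^[t] (u b))) 0 4 ∧
      pathProd f 0 b * pathProd (fun t => P (κ.target^[t] (u b))) 0 4 =
        pathProd (fun t => P (κ.target^[t] (u b))) 0 4 * pathProd f 0 b * i := by
  by_cases hv : ∃ b, b ≤ N ∧ κ.centre (u b) = κ.centre v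
  · right
    classical
    obtain ⟨b, ⟨hbN, hb⟩, hmin⟩ : ∃ b, (b ≤ N ∧ κ.centre (u b) = κ.centre v) ∧
        ∀ j < b, κ.centre (u j) ≠ κ.centre v := by
      refine ⟨Nat.find hv, Nat.find_spec hv, fun j hj => ?_⟩
      have := Nat.find_min hv hj
      have h2 := (Nat.find_spec hv).1
      exact fun h => this ⟨by omega, h⟩
    refine ⟨b, hbN, hb, ?_, ?_⟩
    · have := (hu.shift hbN).pathProd_start (κ := κ) hm hn (p := fun t => P (κ.target^[t] (u b)))
        (f := fun j => f (j + b)) (i := i)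
        (by simp only [zero_add, Nat.sub_add_cancel hbN]; rwa [hb])
        (fun j t hj ht h1 h2 => by
          rw [zero_add] at h1 h2
          exact hcomm _ _ (by omega) h1 h2)
        (fun j hj _ h1 h2 => by
          rw [zero_add] at h2
          rw [← h2]
          exact hstay _ (by omega) h1)
        (fun j hj _ h1 _ h2 => by
          rw [zero_add] at h2
          rw [← h2]
          exact hstart _ (by omega) h1)
      rw [pathProd_shift, zero_add] at this
      exact this
    · have hb0 : b ≠ 0 := by
        rintro rfl
        exact h0 hb.symm
      have hst := hu.step (b - 1) (by omega)
      rw [show b - 1 + 1 = b by omega] at hst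
      have hb1 : τ (b - 1) ≠ κ := fun h => hmin (b - 1) (by omega) (by
        rw [← hb, hst, h, Triangle.centre_target])
      -- Minimality of `b` excludes staying triangles in the head. Its last triangle meets the last
      -- loop factor, number 3, which closes the loop at `u b`.
      refine HopfKitaev.pathProd_end (k := 0) (by omega) (by omega) (fun j hj => by omega) ?_
        fun j t hj ht h => ?_
      · obtain ⟨h1, h2⟩ := Site.arrow_eq_of_target_eq (s := κ.target^[3] (u b)) hb1 (by
          rw [← hst, ← Function.iterate_succ_apply' (f := κ.target), Triangle.iterate_four])
        exact hend _ _ (by omega) hb1 h1 h2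
      · have hne : u (b - 1 - j) ≠ κ.target^[4 - 1 - t] (u b) := fun h' =>
          hmin (b - 1 - j) (by omega) (by rw [h', Triangle.centre_iterate, hb])
        rcases hu.commute_or (κ := κ) (v := u b) (p := fun t => P (κ.target^[t] (u b))) (f := f)
          (fun j t hj _ h1 h2 => hcomm j _ hj h1 h2) (j := b - 1 - j) (t := 4 - 1 - t)
          (by omega) (by omega) with hc | hc | ⟨hc, hc'⟩
        · exact hc
        · exact absurd hc hne
        · have hj0 : j = 0 := by
            by_contra hj0
            exact hmin (b - 1 - j + 1) (by omega) (by rw [hc', Triangle.centre_iterate, hb])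
          subst hj0
          rw [Nat.sub_zero, show b - 1 + 1 = b by omega] at hc'
          by_cases ht0 : t = 0
          · exact absurd ⟨ht0.symm, le_rfl⟩ h
          · have := κ.iterate_injective (u b) (t := 0) (by omega) (by omega) hc'
            omega
  · left
    push Not at hv
    intro t j hj
    have hne : u j ≠ κ.target^[t] v := fun h => hv j hj.le (by rw [h, Triangle.centre_iterate])
    by_cases h2 : τ j = κ ∨ (u j).arrow ≠ (κ.target^[t] v).arrow
    · exact hcomm j _ hj hne h2
    · push Not at h2
      refine absurd ?_ (hv (j + 1) hj)
      rw [hu.step j hj, ((Site.eq_of_arrow_eq h2.2).resolve_left hne).1 _ _ h2.1,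
        Triangle.centre_target, Triangle.centre_iterate]

end Products

theorem Ribbon.site_succ (ξ : Ribbon m n) {j : ℕ} (hj : j < ξ.length) :
    ξ.site (j + 1) = (ξ.triangles.getD j .dual).target (ξ.site j) := by
  have hj' : j < ξ.triangles.length := hj
  rw [Ribbon.site, List.take_succ_eq_append_getElem hj', List.foldl_append]
  simp [Ribbon.site, hj']

theorem Ribbon.StronglyOpen.isStrongPath {ξ : Ribbon m n} (h : ξ.StronglyOpen) :
    IsStrongPath ξ.site (fun j => ξ.triangles.getD j .dual) ξ.length where
  step _ hj := ξ.site_succ hj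
  stays κ i l j hil hlj hj := by
    cases κ
    · exact (h.2 i l j hil hlj hj).2
    · exact (h.2 i l j hil hlj hj).1

theorem Ribbon.StronglyOpen.centre_ne {ξ : Ribbon m n} (h : ξ.StronglyOpen) (κ : Triangle) :
    κ.centre (ξ.site 0) ≠ κ.centre (ξ.site ξ.length) := by
  cases κ
  · exact h.1.2
  · exact h.1.1

end Paths

/-! ### Algebra behind products of four triangle operators. -/

section SiteAlgebra

attribute [local instance] hopfDualCoalgebra doubleDualCoalgebra

variable {k H V : Type*} [Field k] [Ring H] [HopfAlgebra k H] [FiniteDimensional k H]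
  [AddCommGroup V] [Module k V]

theorem map_pathProd {M M' : Type*} [Monoid M] [Monoid M'] (g : M →* M') (f : ℕ → M) (a n : ℕ) :
    g (pathProd f a n) = pathProd (fun j => g (f j)) a n := by
  induction n generalizing a with
  | zero => exact map_one g
  | succ n ih => rw [pathProd_succ, pathProd_succ, map_mul, ih]

/-- Passing the factors `p` along a closed loop of four triangles. -/
theorem pathProd_loop {M : Type*} [Monoid M] {p f : ℕ → M} {i : M}
    (hstart : p 0 * f 0 = i * f 0 * p 0) (hend : f 3 * p 3 = p 3 * f 3 * i)
    (hcomm : ∀ j t, j < 4 → t < 4 → ¬ (j = 0 ∧ t = 0) → ¬ (j = 3 ∧ t = 3) →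
      Commute (p t) (f j)) :
    pathProd p 0 4 * pathProd f 0 4 * i = i * pathProd f 0 4 * pathProd p 0 4 := by
  have hP : pathProd p 0 4 = p 0 * (pathProd p 1 2 * p 3) := by simp [pathProd, mul_assoc]
  have hF : pathProd f 0 4 = f 0 * (pathProd f 1 2 * f 3) := by simp [pathProd, mul_assoc]
  have c1 : Commute (pathProd p 1 2) (f 0) := (commute_pathProd fun t _ _ =>
    (hcomm 0 t (by omega) (by omega) (by omega) (by omega)).symm).symm
  have c2 : Commute (p 3) (f 0) := hcomm 0 3 (by omega) (by omega) (by omega) (by omega)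
  have c3 : Commute (p 3) (pathProd f 1 2) := commute_pathProd fun j _ _ =>
    hcomm j 3 (by omega) (by omega) (by omega) (by omega)
  have c4 : Commute (pathProd p 1 2) (pathProd f 1 2) := commute_pathProd fun j _ _ =>
    (commute_pathProd fun t _ _ =>
      (hcomm j t (by omega) (by omega) (by omega) (by omega)).symm).symm
  have c5 : Commute (pathProd p 1 2) (f 3) := (commute_pathProd fun t _ _ =>
    (hcomm 3 t (by omega) (by omega) (by omega) (by omega)).symm).symm
  have c6 : Commute (p 0) (pathProd f 1 2 * f 3) := (commute_pathProd fun j _ _ =>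
    hcomm j 0 (by omega) (by omega) (by omega) (by omega)).mul_right
      (hcomm 3 0 (by omega) (by omega) (by omega) (by omega))
  have c7 : Commute (pathProd p 1 2 * p 3) (f 0) := c1.mul_left c2
  have c8 : Commute (pathProd p 1 2) (pathProd f 1 2 * f 3) := c4.mul_right c5
  rw [hP, hF]
  calc _ = p 0 * ((pathProd p 1 2 * p 3) * f 0) * (pathProd f 1 2 * f 3) * i := by
        simp only [mul_assoc]
    _ = (p 0 * f 0) * pathProd p 1 2 * (p 3 * pathProd f 1 2) * f 3 * i := by
        rw [c7.eq]; simp only [mul_assoc]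
    _ = i * f 0 * p 0 * pathProd p 1 2 * pathProd f 1 2 * (p 3 * f 3 * i) := by
        rw [hstart, c3.eq]; simp only [mul_assoc]
    _ = i * f 0 * p 0 * (pathProd p 1 2 * (pathProd f 1 2 * f 3)) * p 3 := by
        rw [← hend]; simp only [mul_assoc]
    _ = i * f 0 * (p 0 * (pathProd f 1 2 * f 3)) * pathProd p 1 2 * p 3 := by
        rw [c8.eq]; simp only [mul_assoc]
    _ = _ := by rw [c6.eq]; simp only [mul_assoc]

theorem convComp_apply {K : Type*} [AddCommGroup K] [Module k K] [Coalgebra k K]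
    (F'' F' : K →ₗ[k] Module.End k V) {c : K} {ι : Type*} (r : Repr k c ι) :
    convComp comul F'' F' c = ∑ i ∈ r.index, F'' (r.right i) * F' (r.left i) := by
  simp [convComp, ← r.eq]

theorem commute_convComp {K : Type*} [AddCommGroup K] [Module k K] [Coalgebra k K]
    {F'' F' : K →ₗ[k] Module.End k V} {x : Module.End k V} (h'' : ∀ c, Commute x (F'' c))
    (h' : ∀ c, Commute x (F' c)) (c : K) : Commute x (convComp comul F'' F' c) := by
  rw [convComp_apply _ _ (ℛ k c)]
  exact Commute.sum_right _ _ _ fun i _ => (h'' _).mul_right (h' _)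

/-- Multiplicativity survives convolution-composition because Δ is multiplicative and the two maps
have commuting values. -/
theorem convComp_mul {F'' F' : H →ₗ[k] Module.End k V}
    (h'' : ∀ x y, F'' (x * y) = F'' x * F'' y) (h' : ∀ x y, F' (x * y) = F' x * F' y)
    (hc : ∀ x y, Commute (F'' x) (F' y)) (x y : H) :
    convComp comul F'' F' (x * y) = convComp comul F'' F' x * convComp comul F'' F' y := by
  rw [convComp_apply _ _ (ℛ k x), convComp_apply _ _ (ℛ k y), convComp, LinearMap.comp_apply,
    LinearMap.comp_apply, LinearMap.comp_apply, Bialgebra.comul_mul]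
  conv_lhs => rw [← (ℛ k x).eq, ← (ℛ k y).eq]
  simp only [Finset.sum_mul, Finset.mul_sum, Algebra.TensorProduct.tmul_mul_tmul, map_sum,
    LinearEquiv.coe_coe, TensorProduct.comm_tmul, TensorProduct.map_tmul, LinearMap.mul'_apply,
    h'', h']
  refine Finset.sum_congr rfl fun i _ => Finset.sum_congr rfl fun j _ => ?_
  rw [mul_assoc, mul_assoc, ← mul_assoc (F'' _) (F' _), (hc _ _).eq, mul_assoc]

theorem convComp_one {F'' F' : H →ₗ[k] Module.End k V} (h'' : F'' 1 = 1) (h' : F' 1 = 1) :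
    convComp comul F'' F' 1 = 1 := by
  simp [convComp, h'', h', Algebra.TensorProduct.one_def]

/-- The dual coproduct is multiplicative, being dual to the multiplicativity of Δ on `H`. Face
actions need it as vertex actions need the latter. -/
theorem comul_dualMul (a b : Module.Dual k H) {ι κ : Type*} (r : Repr k a ι) (q : Repr k b κ) :
    comul (R := k) (dualMul k H (a ⊗ₜ b)) = ∑ i ∈ r.index, ∑ j ∈ q.index,
      dualMul k H (r.left i ⊗ₜ q.left j) ⊗ₜ dualMul k H (r.right i ⊗ₜ q.right j) := by
  apply evalLeft_ext
  intro x
  ext y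
  have e : evalLeft x (comul (R := k) (dualMul k H (a ⊗ₜ b))) =
      dualMul k H (a ⊗ₜ b) ∘ₗ LinearMap.mul' k H ∘ₗ TensorProduct.mk k H H x :=
    evalLeft_dualComul _ _ _
  have hr : ∀ x y : H, a (x * y) = ∑ i ∈ r.index, r.left i x * r.right i y := fun x y => by
    have := congrArg (fun f => f y) (dual_sum_left r x)
    simpa using this.symm
  have hq : ∀ x y : H, b (x * y) = ∑ i ∈ q.index, q.left i x * q.right i y := fun x y => by
    have := congrArg (fun f => f y) (dual_sum_left q x)
    simpa using this.symm
  rw [e]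
  simp only [LinearMap.comp_apply, TensorProduct.mk_apply, LinearMap.mul'_apply, map_sum,
    evalLeft_tmul, LinearMap.sum_apply, LinearMap.smul_apply, smul_eq_mul]
  simp only [dualMul_tmul_apply _ _ (ℛ k x), dualMul_tmul_apply _ _ (ℛ k y)]
  rw [dualMul_apply, Bialgebra.comul_mul]
  conv_lhs => rw [← (ℛ k x).eq, ← (ℛ k y).eq]
  simp only [Finset.sum_mul_sum, Algebra.TensorProduct.tmul_mul_tmul, map_sum,
    TensorProduct.dualDistrib_apply, hr, hq]
  conv_rhs =>
    enter [2, i]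
    rw [Finset.sum_comm]
  conv_rhs => rw [Finset.sum_comm]
  refine Finset.sum_congr rfl fun u _ => ?_
  conv_rhs =>
    enter [2, i]
    rw [Finset.sum_comm]
  conv_rhs => rw [Finset.sum_comm]
  refine Finset.sum_congr rfl fun v _ => Finset.sum_congr rfl fun i _ =>
    Finset.sum_congr rfl fun j _ => ?_
  ring

theorem convComp_dualMul {F'' F' : Module.Dual k H →ₗ[k] Module.End k V}
    (h'' : ∀ a b, F'' (dualMul k H (a ⊗ₜ b)) = F'' b * F'' a)
    (h' : ∀ a b, F' (dualMul k H (a ⊗ₜ b)) = F' b * F' a)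
    (hc : ∀ x y, Commute (F'' x) (F' y)) (a b : Module.Dual k H) :
    convComp comul F'' F' (dualMul k H (a ⊗ₜ b)) =
      convComp comul F'' F' b * convComp comul F'' F' a := by
  rw [convComp_apply _ _ (ℛ k a), convComp_apply _ _ (ℛ k b), convComp, LinearMap.comp_apply,
    LinearMap.comp_apply, LinearMap.comp_apply, comul_dualMul a b (ℛ k a) (ℛ k b)]
  simp only [Finset.sum_mul, Finset.mul_sum, map_sum,
    LinearEquiv.coe_coe, TensorProduct.comm_tmul, TensorProduct.map_tmul, LinearMap.mul'_apply,
    h'', h']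
  refine Finset.sum_congr rfl fun i _ => Finset.sum_congr rfl fun j _ => ?_
  rw [mul_assoc, mul_assoc, ← mul_assoc (F'' _) (F' _), (hc _ _).eq, mul_assoc]

theorem comul_dual_counit :
    comul (R := k) (counit (R := k) (A := H)) = counit (R := k) (A := H) ⊗ₜ[k] counit := by
  apply evalLeft_ext
  intro x
  have e : evalLeft x (comul (R := k) (counit (R := k) (A := H))) =
      counit ∘ₗ LinearMap.mul' k H ∘ₗ TensorProduct.mk k H H x := evalLeft_dualComul _ _ _
  rw [e]
  ext y
  simp

theorem convComp_counit {F'' F' : Module.Dual k H →ₗ[k] Module.End k V} (h'' : F'' counit = 1)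
    (h' : F' counit = 1) : convComp comul F'' F' (counit (R := k) (A := H)) = 1 := by
  simp only [convComp, LinearMap.comp_apply]
  rw [comul_dual_counit]
  simp [h'', h']

/-- Restriction to ε ⊗ `H` is comultiplicative because h ↦ ε ⊗ h is multiplicative. Hence a face
action, too, is a product of ribbon factors. -/
theorem comul_dualRight_counit (φ : Module.Dual k (Double k H)) :
    comul (R := k) (dualRight counit φ) = TensorProduct.map (dualRight counit) (dualRight counit)
      (comul (R := k) (A := Module.Dual k (Double k H)) φ) := by
  apply evalLeft_ext
  intro x
  have e1 : evalLeft x (comul (R := k) (dualRight counit φ)) =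
      dualRight counit φ ∘ₗ LinearMap.mul' k H ∘ₗ TensorProduct.mk k H H x :=
    evalLeft_dualComul _ _ _
  have e2 : evalLeft (C := Double k H) (counit ⊗ₜ x)
      (comul (R := k) (A := Module.Dual k (Double k H)) φ) = lmulDual (counit ⊗ₜ x) φ :=
    evalLeft_dualComul _ _ _
  have e3 : ∀ t : Module.Dual k (Double k H) ⊗[k] Module.Dual k (Double k H),
      evalLeft x (TensorProduct.map (dualRight counit) (dualRight counit) t) =
        dualRight counit (evalLeft (C := Double k H) (counit ⊗ₜ x) t) := by
    intro t
    induction t with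
    | zero => simp
    | add a b ha hb => simp only [map_add, ha, hb]
    | tmul a b => simp
  rw [e1, e3, e2, dualRight_counit_lmulDual]
  ext y
  simp

theorem directElt_convComp (T'' T' : Module.Dual k H →ₗ[k] Module.End k V) :
    directElt (convComp comul T'' T') = directElt T' * directElt T'' := by
  refine conv_ext fun φ => ?_
  rw [conv_apply _ _ (ℛ k φ), directElt_apply, convComp, LinearMap.comp_apply,
    LinearMap.comp_apply, LinearMap.comp_apply, comul_dualRight_counit, ← (ℛ k φ).eq]
  simp [directElt_apply]

/-- The transpose of S⁻¹ is the antipode for `H^*` with the opposite product. The cancellation used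
on `H` is x₂ S⁻¹(x₁) = ε(x) 1. -/
theorem dual_antipInv_left {a : Module.Dual k H} {ι : Type*} (r : Repr k a ι) :
    ∑ i ∈ r.index, dualMul k H ((r.right i ∘ₗ antipInv k H) ⊗ₜ r.left i) = a 1 • counit := by
  ext x
  have e : ∀ y z : H, ∑ i ∈ r.index, r.right i y * r.left i z = a (z * y) := fun y z => by
    have := congrArg (fun f => f z) (dual_sum_right r y)
    simpa using this
  simp only [LinearMap.sum_apply, dualMul_tmul_apply _ _ (ℛ k x), LinearMap.comp_apply]
  rw [Finset.sum_comm]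
  simp only [e, ← map_sum]
  have h : ∑ i ∈ (ℛ k x).index, (ℛ k x).right i * antipInv k H ((ℛ k x).left i) =
      counit (R := k) x • 1 := by
    apply antip_injective (k := k)
    have := HopfAlgebra.sum_mul_antipode_eq_smul (R := k) (ℛ k x)
    simp only [map_sum, antip_mul, antip_antipInv, map_smul, antip_one]
    exact this
  rw [h]
  simp [mul_comm]

theorem dual_antipInv_right {a : Module.Dual k H} {ι : Type*} (r : Repr k a ι) :
    ∑ i ∈ r.index, dualMul k H (r.right i ⊗ₜ (r.left i ∘ₗ antipInv k H)) = a 1 • counit := by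
  ext x
  have e : ∀ y z : H, ∑ i ∈ r.index, r.right i y * r.left i z = a (z * y) := fun y z => by
    have := congrArg (fun f => f z) (dual_sum_right r y)
    simpa using this
  simp only [LinearMap.sum_apply, dualMul_tmul_apply _ _ (ℛ k x), LinearMap.comp_apply]
  rw [Finset.sum_comm]
  simp only [e, ← map_sum]
  have h : ∑ i ∈ (ℛ k x).index, antipInv k H ((ℛ k x).right i) * (ℛ k x).left i =
      counit (R := k) x • 1 := by
    apply antip_injective (k := k)
    have := HopfAlgebra.sum_antipode_mul_eq_smul (R := k) (ℛ k x)
    simp only [map_sum, antip_mul, antip_antipInv, map_smul, antip_one]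
    exact this
  rw [h]
  simp [mul_comm]

end SiteAlgebra

/-! ### Site actions as words of triangle factors. -/

section SiteActions

attribute [local instance] hopfDualCoalgebra doubleDualCoalgebra

variable {k H : Type*} [Field k] [Ring H] [HopfAlgebra k H] [FiniteDimensional k H] {m n : ℕ}

section Generic

variable {V K : Type*} [AddCommGroup V] [Module k V] [AddCommGroup K] [Module k K] [Coalgebra k K]

/-- The constants of the convolution ring on `K` with values in the convolution ring of ribbon
operators. -/
abbrev constElt (K : Type*) [AddCommGroup K] [Module k K] [Coalgebra k K] (X : DoubleConv k H V) :
    WithConv (K →ₗ[k] DoubleConv k H V) := convConst k K X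

variable (H) in
/-- Linear maps `K → End V` in the convolution ring on `K` with values in the convolution ring of
ribbon operators. -/
abbrev actElt (F : K →ₗ[k] Module.End k V) : WithConv (K →ₗ[k] DoubleConv k H V) :=
  constOp (Module.Dual k (Double k H)) F

theorem commute_actElt_constElt {F : K →ₗ[k] Module.End k V}
    {G : Module.Dual k (Double k H) →ₗ[k] Module.End k V} (h : ∀ c φ, Commute (F c) (G φ)) :
    Commute (actElt H F) (constElt K (toOp G)) := by
  refine conv_ext fun c => conv_ext fun φ => ?_
  rw [mul_convConst_apply, convConst_mul_apply, constOp_mul_apply, mul_constOp_apply, toOp_apply,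
    ← op_mul, ← op_mul, (h c φ).eq]

theorem constElt_pathProd (f : ℕ → DoubleConv k H V) (a N : ℕ) :
    constElt K (pathProd f a N) = pathProd (fun j => constElt K (f j)) a N :=
  map_pathProd (convConst k K : _ →ₐ[k] _).toRingHom.toMonoidHom f a N

theorem pathProd_four {M : Type*} [Monoid M] (a b c d : M) :
    a * b * c * d = a * (b * (c * (d * 1))) := by
  simp only [mul_one, mul_assoc]

theorem actElt_convComp_four (F₀ F₁ F₂ F₃ : K →ₗ[k] Module.End k V)
    {p : ℕ → WithConv (K →ₗ[k] DoubleConv k H V)} (h0 : p 0 = actElt H F₀) (h1 : p 1 = actElt H F₁)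
    (h2 : p 2 = actElt H F₂) (h3 : p 3 = actElt H F₃) :
    actElt H (convComp comul F₃ (convComp comul F₂ (convComp comul F₁ F₀))) = pathProd p 0 4 := by
  rw [actElt, constOp_convComp, constOp_convComp, constOp_convComp]
  simp only [pathProd]
  rw [h0, h1, h2, h3]
  exact pathProd_four (actElt H F₀) (actElt H F₁) (actElt H F₂) (actElt H F₃)

end Generic

/-! ### Relations between the triangles of a site action and other triangles -/

theorem dualTriangle_commute_of_ne (ς ς' : Sgn) {s u : Site m n} (h : s ≠ u) (x y : H) :
    Commute (dualTriangle k H ς s x) (dualTriangle k H ς' u y) := by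
  by_cases ha : s.arrow = u.arrow
  · exact dualTriangle_commute_of_opposite ς ς' ((Site.eq_of_arrow_eq ha).resolve_left h).2 x y
  · exact onArrow_commute ha _ _

theorem directTriangle_commute_of_ne {s u : Site m n} (h : s ≠ u) (x y : Module.Dual k H) :
    Commute (directTriangle k H s x) (directTriangle k H u y) := by
  by_cases ha : s.arrow = u.arrow
  · exact directTriangle_commute_of_opposite ((Site.eq_of_arrow_eq ha).resolve_left h).2 x y
  · exact onArrow_commute ha _ _

theorem commute_vertex_triangle (ς ς' : Sgn) {τ : Triangle} {s u : Site m n} (hne : u ≠ s)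
    (h : τ = .dual ∨ u.arrow ≠ s.arrow) :
    Commute (actElt H (dualTriangle k H ς s))
      (constElt H (toOp (triangleRibbon k H ς' τ u))) := by
  cases τ
  · rw [toOp_triangleRibbon_direct]
    refine commute_actElt_constElt fun c φ => ?_
    exact dualTriangle_commute_directTriangle ς (h.resolve_left (by simp)).symm c _
  · rw [toOp_triangleRibbon_dual]
    exact commute_actElt_constElt fun c φ => dualTriangle_commute_of_ne _ _ hne.symm _ _

theorem commute_face_triangle (ς' : Sgn) {τ : Triangle} {s u : Site m n} (hne : u ≠ s)
    (h : τ = .direct ∨ u.arrow ≠ s.arrow) :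
    Commute (actElt H (directTriangle k H s))
      (constElt (Module.Dual k H) (toOp (triangleRibbon k H ς' τ u))) := by
  cases τ
  · rw [toOp_triangleRibbon_direct]
    exact commute_actElt_constElt fun c φ => directTriangle_commute_of_ne hne.symm _ _
  · rw [toOp_triangleRibbon_dual]
    refine commute_actElt_constElt fun c φ => ?_
    exact (dualTriangle_commute_directTriangle ς' (h.resolve_left (by simp)) _ c).symm

theorem vertex_stay {ς ς' : Sgn} {s : Site m n}
    (h : ¬ s.Outward → antipSgn k H ς' = antipSgn k H ς) :
    actElt H (dualTriangle k H ς s) * constElt H (toOp (triangleRibbon k H ς' .dual s)) *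
        vertexEmb k H _ =
      vertexEmb k H _ * constElt H (toOp (triangleRibbon k H ς' .dual s)) *
        actElt H (dualTriangle k H ς s) := by
  rw [toOp_triangleRibbon_dual, dualTriangle_congr h]
  exact stay_vertex (dualTriangle_mul ς s)

theorem face_stay (ς' : Sgn) (s : Site m n) :
    actElt H (directTriangle k H s) *
        constElt (Module.Dual k H) (toOp (triangleRibbon k H ς' .direct s)) * faceEmb k H _ =
      faceEmb k H _ * constElt (Module.Dual k H) (toOp (triangleRibbon k H ς' .direct s)) *
        actElt H (directTriangle k H s) := by
  rw [toOp_triangleRibbon_direct]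
  exact stay_face (directTriangle_dualMul s)

theorem vertex_start {ς : Sgn} (ς' : Sgn) {s : Site m n}
    (h : ¬ s.Outward → antipSgn k H ς = antipInv k H) :
    actElt H (dualTriangle k H ς s) * constElt H (toOp (triangleRibbon k H ς' .direct s)) =
      vertexEmb k H _ * constElt H (toOp (triangleRibbon k H ς' .direct s)) *
        actElt H (dualTriangle k H ς s) := by
  rw [toOp_triangleRibbon_direct]
  exact (startRel_triangle h).vertex

theorem face_start {ς' : Sgn} {s : Site m n}
    (h : ¬ s.Outward → antipSgn k H ς' = antipInv k H) :
    actElt H (directTriangle k H s) *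
        constElt (Module.Dual k H) (toOp (triangleRibbon k H ς' .dual s)) =
      faceEmb k H _ * constElt (Module.Dual k H) (toOp (triangleRibbon k H ς' .dual s)) *
        actElt H (directTriangle k H s) := by
  rw [toOp_triangleRibbon_dual]
  exact (startRel_triangle h).face

theorem vertex_end {ς : Sgn} (ς' : Sgn) {s u : Site m n} (ha : u.arrow = s.arrow)
    (ho : u.Outward ↔ ¬ s.Outward) (h : ¬ s.Outward → antipSgn k H ς = antip k H) :
    constElt H (toOp (triangleRibbon k H ς' .direct u)) * actElt H (dualTriangle k H ς s) =
      actElt H (dualTriangle k H ς s) * constElt H (toOp (triangleRibbon k H ς' .direct u)) *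
        vertexEmb k H _ := by
  rw [toOp_triangleRibbon_direct]
  exact (endRel_triangle ha ho h).vertex

theorem face_end {ς' : Sgn} {s u : Site m n} (ha : u.arrow = s.arrow)
    (ho : u.Outward ↔ ¬ s.Outward) (h : ¬ u.Outward → antipSgn k H ς' = antip k H) :
    constElt (Module.Dual k H) (toOp (triangleRibbon k H ς' .dual u)) *
        actElt H (directTriangle k H s) =
      actElt H (directTriangle k H s) *
        constElt (Module.Dual k H) (toOp (triangleRibbon k H ς' .dual u)) * faceEmb k H _ := by
  rw [toOp_triangleRibbon_dual]
  exact (endRel_triangle ha.symm ⟨fun h1 h2 => ho.1 h2 h1, fun h1 => not_not.1 (mt ho.2 h1)⟩ h).face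

/-! ### The site actions as products -/

/-- The sign at the `t`-th arrow of a vertex action. -/
def signAt (ε : Fin 4 → Sgn) (t : ℕ) : Sgn := ε (Fin.ofNat 4 t)

theorem signAt_coe (ε : Fin 4 → Sgn) (i : Fin 4) : signAt ε i = ε i := by
  simp [signAt]

theorem actElt_vertexAction (ε : Fin 4 → Sgn) (s : Site m n) :
    actElt H (vertexAction k H ε s) = pathProd (fun t => actElt H
      (dualTriangle k H (signAt ε t) (Triangle.dual.target^[t] s))) 0 4 :=
  actElt_convComp_four _ _ _ _ rfl rfl rfl rfl

theorem actElt_faceAction (s : Site m n) :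
    actElt H (faceAction k H s) = pathProd (fun t => actElt H
      (directTriangle k H (Triangle.direct.target^[t] s))) 0 4 :=
  actElt_convComp_four _ _ _ _ rfl rfl rfl rfl

theorem directElt_faceAction (s : Site m n) :
    directElt (faceAction k H s) =
      pathProd (fun t => directElt (directTriangle k H (Triangle.direct.target^[t] s))) 0 4 := by
  have h : directElt (faceAction k H s) = directElt (directTriangle k H s) *
      directElt (directTriangle k H s.move) * directElt (directTriangle k H s.move.move) *
      directElt (directTriangle k H s.move.move.move) := by
    rw [← directElt_convComp, ← directElt_convComp, ← directElt_convComp]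
    rfl
  rw [h]
  exact pathProd_four _ _ _ _

theorem iterate_ne (κ : Triangle) (s : Site m n) {t t' : ℕ} (ht : t < 4) (ht' : t' < 4)
    (h : t ≠ t') : κ.target^[t] s ≠ κ.target^[t'] s :=
  fun e => h (κ.iterate_injective s ht ht' e)

theorem vertexAction_mul (ε : Fin 4 → Sgn) (s : Site m n) (x y : H) :
    vertexAction k H ε s (x * y) = vertexAction k H ε s x * vertexAction k H ε s y := by
  have c : ∀ (t t' : ℕ), t < 4 → t' < 4 → t ≠ t' → ∀ (ς ς' : Sgn) (x y : H),
      Commute (dualTriangle k H ς (Triangle.dual.target^[t] s) x)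
        (dualTriangle k H ς' (Triangle.dual.target^[t'] s) y) := fun t t' ht ht' h ς ς' x y =>
    dualTriangle_commute_of_ne _ _ (iterate_ne _ s ht ht' h) _ _
  refine convComp_mul (dualTriangle_mul _ _) (fun x y => convComp_mul (dualTriangle_mul _ _)
    (fun x y => convComp_mul (dualTriangle_mul _ _) (dualTriangle_mul _ _) (fun x y => ?_) _ _)
    (fun x y => commute_convComp (fun z => ?_) (fun z => ?_) _) _ _)
    (fun x y => commute_convComp (fun z => ?_)
      (commute_convComp (fun z => ?_) (fun z => ?_)) _) _ _
  · exact c 1 0 (by decide) (by decide) (by decide) _ _ _ _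
  · exact c 2 1 (by decide) (by decide) (by decide) _ _ _ _
  · exact c 2 0 (by decide) (by decide) (by decide) _ _ _ _
  · exact c 3 2 (by decide) (by decide) (by decide) _ _ _ _
  · exact c 3 1 (by decide) (by decide) (by decide) _ _ _ _
  · exact c 3 0 (by decide) (by decide) (by decide) _ _ _ _

theorem vertexAction_one (ε : Fin 4 → Sgn) (s : Site m n) : vertexAction k H ε s 1 = 1 :=
  convComp_one (dualTriangle_one _ _) (convComp_one (dualTriangle_one _ _)
    (convComp_one (dualTriangle_one _ _) (dualTriangle_one _ _)))

theorem faceAction_dualMul (s : Site m n) (x y : Module.Dual k H) :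
    faceAction k H s (dualMul k H (x ⊗ₜ y)) = faceAction k H s y * faceAction k H s x := by
  have c : ∀ (t t' : ℕ), t < 4 → t' < 4 → t ≠ t' → ∀ (x y : Module.Dual k H),
      Commute (directTriangle k H (Triangle.direct.target^[t] s) x)
        (directTriangle k H (Triangle.direct.target^[t'] s) y) := fun t t' ht ht' h x y =>
    directTriangle_commute_of_ne (iterate_ne _ s ht ht' h) _ _
  refine convComp_dualMul (directTriangle_dualMul _) (fun x y => convComp_dualMul
    (directTriangle_dualMul _) (fun x y => convComp_dualMul (directTriangle_dualMul _)
      (directTriangle_dualMul _) (fun x y => ?_) _ _)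
    (fun x y => commute_convComp (fun z => ?_) (fun z => ?_) _) _ _)
    (fun x y => commute_convComp (fun z => ?_)
      (commute_convComp (fun z => ?_) (fun z => ?_)) _) _ _
  · exact c 1 0 (by decide) (by decide) (by decide) _ _
  · exact c 2 1 (by decide) (by decide) (by decide) _ _
  · exact c 2 0 (by decide) (by decide) (by decide) _ _
  · exact c 3 2 (by decide) (by decide) (by decide) _ _
  · exact c 3 1 (by decide) (by decide) (by decide) _ _
  · exact c 3 0 (by decide) (by decide) (by decide) _ _

theorem faceAction_counit (s : Site m n) : faceAction k H s (counit (R := k) (A := H)) = 1 :=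
  convComp_counit (directTriangle_counit _) (convComp_counit (directTriangle_counit _)
    (convComp_counit (directTriangle_counit _) (directTriangle_counit _)))

/-! ### The site action is an action of the double -/

/-- The face action is the ribbon operator of a closed path that leaves the vertex with its first
triangle and returns with its last. Leaving uses ε₀ = −, arriving uses ε₃ = +, and the intermediate
signs never matter: this is the meaning of admissibility. -/
theorem vertexAction_loop (hm : m ≠ 1) (hn : n ≠ 1) {ε : Fin 4 → Sgn} (hε : AdmissibleSigns ε)
    (s : Site m n) :
    actElt H (vertexAction k H ε s) * constElt H (directElt (faceAction k H s)) *
        vertexEmb k H _ =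
      vertexEmb k H _ * constElt H (directElt (faceAction k H s)) *
        actElt H (vertexAction k H ε s) := by
  rw [actElt_vertexAction, directElt_faceAction, constElt_pathProd]
  refine pathProd_loop ?_ ?_ fun j t hj ht h0 h3 => ?_
  · have := vertex_start (k := k) (H := H) (ς := signAt ε 0) .plus (s := s) fun _ => by
      rw [show signAt ε 0 = .minus from hε.1]; rfl
    rwa [toOp_triangleRibbon_direct] at this
  · have h3 : Triangle.direct.target (Triangle.direct.target^[3] s) =
        Triangle.dual.target (Triangle.dual.target^[3] s) := by
      rw [← Function.iterate_succ_apply' (f := Triangle.direct.target), Triangle.iterate_four,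
        ← Function.iterate_succ_apply' (f := Triangle.dual.target), Triangle.iterate_four]
    obtain ⟨h1, h2⟩ := Site.arrow_eq_of_target_eq (by decide) h3
    have := vertex_end (k := k) (H := H) (ς := signAt ε 3) .plus h1 h2 fun _ => by
      rw [show signAt ε 3 = .plus from hε.2]; rfl
    rwa [toOp_triangleRibbon_direct] at this
  -- Among the arrows at the vertex and those around the face, only the two adjacent to the site
  -- coincide, and these belong to the excluded pairs (0, 0) and (3, 3).
  · have h : (Triangle.direct.target^[j] s).arrow ≠ (Triangle.dual.target^[t] s).arrow := by
      intro h
      rcases Site.eq_of_arrow_eq h with e | ⟨e, -⟩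
      · exact h0 (Triangle.iterate_eq_iterate hm hn (by decide) s hj ht e)
      · have e := e .direct .dual (by decide)
        rw [← Function.iterate_succ_apply' (f := Triangle.direct.target),
          ← Function.iterate_succ_apply' (f := Triangle.dual.target)] at e
        by_cases hj3 : j = 3
        · subst hj3
          rw [Triangle.iterate_four] at e
          by_cases ht3 : t = 3
          · exact h3 ⟨rfl, ht3⟩
          · have := Triangle.iterate_injective .dual s (t := 0) (by omega) (by omega) e
            omega
        · by_cases ht3 : t = 3
          · subst ht3
            rw [Triangle.iterate_four] at e
            have := Triangle.iterate_injective .direct s (t' := 0) (by omega) (by omega) e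
            omega
          · have := Triangle.iterate_eq_iterate hm hn (by decide) s (by omega) (by omega) e
            omega
    have := commute_vertex_triangle (k := k) (H := H) (signAt ε t) .plus (τ := .direct)
      (fun e => h (congrArg _ e)) (.inr h)
    rwa [toOp_triangleRibbon_direct] at this

end SiteActions

/-! ### The site action on the double, and sandwich identities. -/

section ModuleMaps

attribute [local instance] hopfDualCoalgebra doubleDualCoalgebra

variable {k H V : Type*} [Field k] [Ring H] [HopfAlgebra k H] [FiniteDimensional k H]
  [AddCommGroup V] [Module k V] {m n : ℕ}

theorem eq_of_loop {M : Type*} [Monoid M] {w x i j : M} (e : w * x * i = i * x * w)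
    (h : j * i = 1) : j * (w * x * i) = x * w := by
  rw [e, ← mul_assoc, ← mul_assoc, h, one_mul]

/-- The loop relation, multiplied by the inverse of the first factor i, becomes (i ∘ S) w x i = x w.
Its value at h and φ is the straightening rule of the double. -/
theorem doubleRep_coadjoint {B : Module.Dual k H →ₗ[k] Module.End k V} {W : H →ₗ[k] Module.End k V}
    (e : actElt H W * constElt H (directElt B) * vertexEmb k H V =
      vertexEmb k H V * constElt H (directElt B) * actElt H W)
    (a : Module.Dual k H) (h : H) :
    doubleRep B W (coadjoint k H (antip k H) LinearMap.id (a ⊗ₜ h)) = W h * B a := by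
  obtain ⟨φ, rfl⟩ := exists_dualRight a
  let r := ℛ k h
  let r' := fun i => ℛ k (r.right i)
  have e0 : toConv ((vertexEmb k H V).ofConv ∘ₗ antip k H) *
      (actElt H W * constElt H (directElt B) * vertexEmb k H V) =
        constElt H (directElt B) * actElt H W :=
    eq_of_loop (M := WithConv (H →ₗ[k] DoubleConv k H V)) e antip_conv_vertexEmb
  have e1 := DFunLike.congr_fun (congrArg ofConv e0) h
  have e2 := DFunLike.congr_fun (congrArg ofConv e1) φ
  rw [convConst_mul_apply, mul_constOp_apply, conv_apply _ _ r] at e2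
  simp only [conv_apply _ _ (r' _), Finset.mul_sum, ofConv_sum, LinearMap.sum_apply,
    mul_convConst_apply] at e2
  apply op_injective
  rw [op_mul, ← directElt_apply]
  refine Eq.trans ?_ e2
  rw [coadjoint_tmul _ _ _ r r']
  simp only [map_sum, Finset.op_sum, doubleRep_tmul, op_mul]
  refine Finset.sum_congr rfl fun i _ => Finset.sum_congr rfl fun j _ => ?_
  have h1 : toConv ((vertexEmb k H V).ofConv ∘ₗ antip k H) (r.left i) =
      vertexEmb k H V (antip k H (r.left i)) := rfl
  rw [h1, vertexEmb_mul_apply, mul_vertexEmb_apply, constOp_mul_apply, directElt_apply,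
    dualRight_counit_rmulDual, dualRight_counit_lmulDual]
  rfl

theorem siteAction_eq (ε : Fin 4 → Sgn) (s : Site m n) :
    siteAction k H ε s = doubleRep (faceAction k H s) (vertexAction k H ε s) := rfl

/-- The site action is multiplicative on the double, so the antipode can be evaluated from its
factorisation (ε ⊗ S h)(S⁻¹a ⊗ 1). This makes the vertex and face parts separable in the module map
identities. -/
theorem siteAction_doubleAntip (hm : m ≠ 1) (hn : n ≠ 1) {ε : Fin 4 → Sgn}
    (hε : AdmissibleSigns ε) (s : Site m n) (a : Module.Dual k H) (h : H) :
    siteAction k H ε s (doubleAntip k H (a ⊗ₜ h)) =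
      vertexAction k H ε s (antip k H h) * faceAction k H s (a ∘ₗ antipInv k H) := by
  rw [siteAction_eq, doubleAntip_tmul, doubleRep_doubleMul _ _ (faceAction_dualMul s)
    (vertexAction_mul ε s) (doubleRep_coadjoint (vertexAction_loop hm hn hε s)), doubleRep_tmul,
    doubleRep_tmul, faceAction_counit, vertexAction_one, one_mul, mul_one]

theorem doubleComul_tmul (a : Module.Dual k H) (h : H) {ι κ : Type*} (r : Repr k a ι)
    (q : Repr k h κ) : doubleComul k H (a ⊗ₜ h) = ∑ i ∈ r.index, ∑ j ∈ q.index,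
      (r.left i ⊗ₜ q.left j) ⊗ₜ[k] (r.right i ⊗ₜ q.right j) := by
  have e : dualComul (LinearMap.mul' k H) a = ∑ i ∈ r.index, r.left i ⊗ₜ[k] r.right i := r.eq.symm
  simp only [doubleComul, LinearMap.comp_apply, TensorProduct.map_tmul, e, ← q.eq,
    TensorProduct.sum_tmul, TensorProduct.tmul_sum, map_sum, LinearEquiv.coe_coe,
    TensorProduct.tensorTensorTensorComm_tmul]
  exact Finset.sum_comm

/-! ### Sandwich identities for actions -/

variable {W : H →ₗ[k] Module.End k V} {B : Module.Dual k H →ₗ[k] Module.End k V}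

theorem actElt_mul (hW : ∀ x y, W (x * y) = W x * W y) (x y : H) :
    actElt H W y * actElt H W x = actElt H W (x * y) := by
  simp only [constOp_apply]
  rw [← map_mul, ← op_mul, hW]

theorem actElt_one {K : Type*} [AddCommGroup K] [Module k K] [Coalgebra k K]
    {W : K →ₗ[k] Module.End k V} {c : K} (hW : W c = 1) : actElt H W c = 1 := by
  rw [constOp_apply, hW, op_one, map_one]

theorem actElt_dualMul (hB : ∀ a b, B (dualMul k H (a ⊗ₜ b)) = B b * B a)
    (a b : Module.Dual k H) :
    actElt H B a * actElt H B b = actElt H B (dualMul k H (a ⊗ₜ b)) := by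
  simp only [constOp_apply]
  rw [← map_mul, ← op_mul, hB]

/-- In the opposite ring, W(S h₂) on the left and W(h₁) on the right of `X` stand for W(h₁) ∘ X ∘
W(S h₂). -/
theorem vertex_sandwich_left (hW : ∀ x y, W (x * y) = W x * W y) (hW1 : W 1 = 1)
    {X : DoubleConv k H V}
    (e : actElt H W * constElt H X = vertexEmb k H V * constElt H X * actElt H W) {h : H}
    (r : Repr k h (H × H)) :
    ∑ j ∈ r.index, actElt H W (antip k H (r.right j)) * X * actElt H W (r.left j) =
      vertexEmb k H V (antip k H h) * X := by
  refine sum_sandwich_left (constOp_commute_vertexEmb W) antip_conv_vertexEmb (fun c q => ?_) e r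
  have := HopfAlgebra.sum_mul_antipode_eq_smul (R := k) q
  simp only [actElt_mul hW]
  rw [← map_sum]
  erw [this]
  rw [map_smul, actElt_one hW1, Algebra.algebraMap_eq_smul_one]

theorem vertex_sandwich_right (hW : ∀ x y, W (x * y) = W x * W y) (hW1 : W 1 = 1)
    {X : DoubleConv k H V}
    (e : constElt H X * actElt H W = actElt H W * constElt H X * vertexEmb k H V) {h : H}
    (r : Repr k h (H × H)) :
    ∑ j ∈ r.index, actElt H W (r.right j) * X * actElt H W (antip k H (r.left j)) =
      X * vertexEmb k H V (antip k H h) := by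
  refine sum_sandwich_right (constOp_commute_vertexEmb W) conv_antip_vertexEmb (fun c q => ?_) e r
  have := HopfAlgebra.sum_antipode_mul_eq_smul (R := k) q
  simp only [actElt_mul hW]
  rw [← map_sum]
  erw [this]
  rw [map_smul, actElt_one hW1, Algebra.algebraMap_eq_smul_one]

theorem antip_conv_faceEmb :
    toConv ((faceEmb k H V).ofConv ∘ₗ (antipInv k H).dualMap) * faceEmb k H V = 1 := by
  refine conv_ext fun a => ?_
  rw [conv_apply _ _ (ℛ k a)]
  have h : ∀ i, toConv ((faceEmb k H V).ofConv ∘ₗ (antipInv k H).dualMap) ((ℛ k a).left i) *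
      faceEmb k H V ((ℛ k a).right i) = faceEmb k H V
        (dualMul k H ((ℛ k a).right i ⊗ₜ ((ℛ k a).left i ∘ₗ antipInv k H))) := fun i =>
    (faceEmb_mul _ _).symm
  simp only [h]
  rw [← map_sum, dual_antipInv_right, map_smul, faceEmb_counit]
  rfl

theorem conv_antip_faceEmb :
    faceEmb k H V * toConv ((faceEmb k H V).ofConv ∘ₗ (antipInv k H).dualMap) = 1 := by
  refine conv_ext fun a => ?_
  rw [conv_apply _ _ (ℛ k a)]
  have h : ∀ i, faceEmb k H V ((ℛ k a).left i) *
      toConv ((faceEmb k H V).ofConv ∘ₗ (antipInv k H).dualMap) ((ℛ k a).right i) = faceEmb k H V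
        (dualMul k H (((ℛ k a).right i ∘ₗ antipInv k H) ⊗ₜ (ℛ k a).left i)) := fun i =>
    (faceEmb_mul _ _).symm
  simp only [h]
  rw [← map_sum, dual_antipInv_left, map_smul, faceEmb_counit]
  rfl

theorem face_sandwich_left (hB : ∀ a b, B (dualMul k H (a ⊗ₜ b)) = B b * B a)
    (hB1 : B counit = 1) {X : DoubleConv k H V}
    (e : actElt H B * constElt (Module.Dual k H) X =
      faceEmb k H V * constElt (Module.Dual k H) X * actElt H B) {a : Module.Dual k H}
    (r : Repr k a (Module.Dual k H × Module.Dual k H)) :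
    ∑ j ∈ r.index, actElt H B (r.right j ∘ₗ antipInv k H) * X * actElt H B (r.left j) =
      faceEmb k H V (a ∘ₗ antipInv k H) * X := by
  refine sum_sandwich_left (s := (antipInv k H).dualMap) (constOp_commute_faceEmb B)
    antip_conv_faceEmb (fun c q => ?_) e r
  have h : ∀ i, actElt H B ((antipInv k H).dualMap (q.right i)) * actElt H B (q.left i) =
      actElt H B (dualMul k H ((q.right i ∘ₗ antipInv k H) ⊗ₜ q.left i)) := fun i =>
    actElt_dualMul hB _ _
  simp only [h]
  rw [← map_sum, dual_antipInv_left, map_smul, actElt_one hB1, Algebra.algebraMap_eq_smul_one]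
  rfl

theorem face_sandwich_right (hB : ∀ a b, B (dualMul k H (a ⊗ₜ b)) = B b * B a)
    (hB1 : B counit = 1) {X : DoubleConv k H V}
    (e : constElt (Module.Dual k H) X * actElt H B =
      actElt H B * constElt (Module.Dual k H) X * faceEmb k H V) {a : Module.Dual k H}
    (r : Repr k a (Module.Dual k H × Module.Dual k H)) :
    ∑ j ∈ r.index, actElt H B (r.right j) * X * actElt H B (r.left j ∘ₗ antipInv k H) =
      X * faceEmb k H V (a ∘ₗ antipInv k H) := by
  refine sum_sandwich_right (s := (antipInv k H).dualMap) (constOp_commute_faceEmb B)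
    conv_antip_faceEmb (fun c q => ?_) e r
  have h : ∀ i, actElt H B (q.right i) * actElt H B ((antipInv k H).dualMap (q.left i)) =
      actElt H B (dualMul k H (q.right i ⊗ₜ (q.left i ∘ₗ antipInv k H))) := fun i =>
    actElt_dualMul hB _ _
  simp only [h]
  rw [← map_sum, dual_antipInv_right, map_smul, actElt_one hB1, Algebra.algebraMap_eq_smul_one]
  rfl

end ModuleMaps

/-! ### Ribbon operators as module maps at the two ends. -/

section RibbonModuleMaps

attribute [local instance] hopfDualCoalgebra doubleDualCoalgebra

variable {k H : Type*} [Field k] [Ring H] [HopfAlgebra k H] [FiniteDimensional k H] {m n : ℕ}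

theorem antip_eq_antipInv
    (h : ∀ h : H, HopfAlgebra.antipode k (HopfAlgebra.antipode k h) = h) :
    antip k H = antipInv k H := by
  ext x
  apply antip_injective (k := k)
  rw [antip_antipInv]
  exact h x

theorem antipSgn_congr (h : antip k H = antipInv k H) (ς ς' : Sgn) :
    antipSgn k H ς = antipSgn k H ς' := by
  cases ς <;> cases ς' <;> simp [antipSgn, h]

theorem Ribbon.isDual_of_getD {ξ : Ribbon m n} {j : ℕ} (hj : j < ξ.length)
    (h : ξ.triangles.getD j .dual = .dual) : ξ.IsDual j := by
  have hj' : j < ξ.triangles.length := hj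
  simpa [Ribbon.IsDual, hj'] using h

theorem Ribbon.isDirect_of_getD {ξ : Ribbon m n} {j : ℕ}
    (h : ξ.triangles.getD j .dual ≠ .dual) : ξ.IsDirect j := by
  rw [List.getD_eq_getElem?_getD] at h
  rw [Ribbon.IsDirect]
  rcases h' : ξ.triangles[j]? with _ | (_ | _)
  · simp [h'] at h
  · rfl
  · simp [h'] at h

theorem Ribbon.not_isDual_of_getD {ξ : Ribbon m n} {j : ℕ}
    (h : ξ.triangles.getD j .dual ≠ .dual) : ¬ ξ.IsDual j := fun h' => by
  rw [List.getD_eq_getElem?_getD, h'] at h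
  exact h rfl

theorem Triangle.ne_direct {τ : Triangle} (h : τ ≠ .direct) : τ = .dual := by
  cases τ
  · exact absurd rfl h
  · rfl

theorem Triangle.ne_dual {τ : Triangle} (h : τ ≠ .dual) : τ = .direct := by
  cases τ
  · rfl
  · exact absurd rfl h

variable (ξ : Ribbon m n) (σ : ℕ → Sgn)

theorem constElt_ribbonOp (K : Type*) [AddCommGroup K] [Module k K] [Coalgebra k K] :
    constElt K (toOp (ribbonOp k H σ ξ)) =
      pathProd (fun j => constElt K (triangleElt k H σ ξ j)) 0 ξ.length := by
  rw [toOp_ribbonOp, constElt_pathProd]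

variable {ξ σ}

theorem signAt_of_lt (ε : Fin 4 → Sgn) {t : ℕ} (ht : t < 4) : signAt ε t = ε ⟨t, ht⟩ :=
  signAt_coe ε ⟨t, ht⟩

/-- The compatibility conditions enter triangle by triangle: equal signs for the dual triangles at
the initial vertex, and S⁻¹ in the site action at the arrow along which the ribbon leaves. If S² =
id, all choices coincide. -/
theorem vertexAction_source (hm : m ≠ 1) (hn : n ≠ 1) (hξ : ξ.StronglyOpen) {ε : Fin 4 → Sgn}
    (h : antip k H = antipInv k H ∨ ξ.LeftCompatible σ ε) :
    actElt H (vertexAction k H ε ξ.source) * constElt H (toOp (ribbonOp k H σ ξ)) =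
      vertexEmb k H _ * constElt H (toOp (ribbonOp k H σ ξ)) *
        actElt H (vertexAction k H ε ξ.source) := by
  rw [actElt_vertexAction, constElt_ribbonOp]
  refine hξ.isStrongPath.pathProd_start (κ := .dual) hm hn (hξ.centre_ne _)
    (fun j t hj ht h1 h2 => commute_vertex_triangle _ _ h1 h2) (fun j hj hj4 h1 h2 => ?_)
    fun j hj hj4 h1 h2 h3 => ?_
  · have hv : (ξ.site j).vertex = ξ.source.vertex := by
      have := Triangle.centre_iterate .dual (ξ.site 0) j
      rw [← h2] at this
      exact this
    have := vertex_stay (k := k) (H := H) (ς := signAt ε j) (ς' := σ j) (s := ξ.site j)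
      fun ho => by
        rcases h with h | h
        · exact antipSgn_congr h _ _
        · rw [signAt_of_lt ε hj4, (h.2 ⟨j, hj4⟩ hv ho).1 (Ribbon.isDual_of_getD hj h1)]
    rw [triangleElt, h1]
    rwa [h2] at this ⊢
  · have hv : (ξ.site j).vertex = ξ.source.vertex := by
      have := Triangle.centre_iterate .dual (ξ.site 0) j
      rw [← h3] at this
      exact this
    have := vertex_start (k := k) (H := H) (ς := signAt ε j) (σ j) (s := ξ.site j)
      fun ho => by
        rcases h with h | h
        · exact antipSgn_congr h _ .minus
        · rw [signAt_of_lt ε hj4, (h.2 ⟨j, hj4⟩ hv ho).2 (Ribbon.isDirect_of_getD h1)]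
          rfl
    rw [triangleElt, Triangle.ne_dual h1]
    rwa [h3] at this ⊢

/-- Direct triangles around the face involve no signs. The face is left by the first dual triangle
of the ribbon, which is why that one must use S⁻¹. -/
theorem faceAction_source (hm : m ≠ 1) (hn : n ≠ 1) (hξ : ξ.StronglyOpen) {ε : Fin 4 → Sgn}
    (h : antip k H = antipInv k H ∨ ξ.LeftCompatible σ ε) :
    actElt H (faceAction k H ξ.source) *
        constElt (Module.Dual k H) (toOp (ribbonOp k H σ ξ)) =
      faceEmb k H _ * constElt (Module.Dual k H) (toOp (ribbonOp k H σ ξ)) *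
        actElt H (faceAction k H ξ.source) := by
  rw [actElt_faceAction, constElt_ribbonOp]
  refine hξ.isStrongPath.pathProd_start (κ := .direct) hm hn (hξ.centre_ne _)
    (fun j t hj ht h1 h2 => commute_face_triangle _ h1 h2) (fun j hj hj4 h1 h2 => ?_)
    fun j hj hj4 h1 h2 h3 => ?_
  · have := face_stay (k := k) (H := H) (σ j) (ξ.site j)
    rw [triangleElt, h1]
    rwa [h2] at this ⊢
  · have := face_start (k := k) (H := H) (ς' := σ j) (s := ξ.site j)
      fun ho => by
        rcases h with h | h
        · exact antipSgn_congr h _ .minus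
        · rw [h.1 j (Ribbon.isDual_of_getD hj (Triangle.ne_direct h1))
            (fun l hl => Ribbon.not_isDual_of_getD (by rw [h2 l hl]; decide)) ho]
          rfl
    rw [triangleElt, Triangle.ne_direct h1]
    rwa [h3] at this ⊢

theorem vertexAction_target (hm : m ≠ 1) (hn : n ≠ 1) (hξ : ξ.StronglyOpen) {ε : Fin 4 → Sgn}
    (h : antip k H = antipInv k H ∨ ξ.RightCompatible σ ε) :
    constElt H (toOp (ribbonOp k H σ ξ)) * actElt H (vertexAction k H ε ξ.target) =
      actElt H (vertexAction k H ε ξ.target) * constElt H (toOp (ribbonOp k H σ ξ)) *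
        vertexEmb k H _ := by
  rw [actElt_vertexAction, constElt_ribbonOp]
  refine hξ.isStrongPath.pathProd_end (κ := .dual) hm hn (hξ.centre_ne _)
    (fun j t hj ht h1 h2 => commute_vertex_triangle _ _ h1 h2) (fun j t hj ht hjt h1 h2 => ?_)
    fun j t hj ht hjt h1 _ h2 h3 h4 => ?_
  · have hv : (ξ.site (j + 1)).vertex = ξ.target.vertex := by
      rw [ξ.site_succ hj, h1]
      have := Triangle.centre_iterate .dual ξ.target t
      rw [← Triangle.centre_target] at this
      exact (congrArg (fun s => Triangle.dual.centre (Triangle.dual.target s)) h2).trans this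
    have := vertex_stay (k := k) (H := H) (ς := signAt ε t) (ς' := σ j) (s := ξ.site j)
      fun ho => by
        rcases h with h | h
        · exact antipSgn_congr h _ _
        · rw [signAt_of_lt ε ht, (h.2 j ⟨t, ht⟩ hjt hv).1 (Ribbon.isDual_of_getD hj h1) ho]
    rw [triangleElt, h1]
    change actElt H (dualTriangle k H _ (Triangle.dual.target^[t] (ξ.site ξ.length))) * _ * _ = _
    rwa [h2] at this ⊢
  · rw [triangleElt, Triangle.ne_dual h1]
    refine vertex_end _ h3 h4 fun ho => ?_
    rcases h with h | h
    · exact antipSgn_congr h _ .plus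
    · rw [signAt_of_lt ε ht, (h.2 j ⟨t, ht⟩ hjt h2).2 (Ribbon.isDirect_of_getD h1) (h4.2 ho)]
      rfl

/-- The triangle reaching the final face is the last dual one, all later ones being direct. Hence it
must use S when its arrow is inward. -/
theorem faceAction_target (hm : m ≠ 1) (hn : n ≠ 1) (hξ : ξ.StronglyOpen) {ε : Fin 4 → Sgn}
    (h : antip k H = antipInv k H ∨ ξ.RightCompatible σ ε) :
    constElt (Module.Dual k H) (toOp (ribbonOp k H σ ξ)) * actElt H (faceAction k H ξ.target) =
      actElt H (faceAction k H ξ.target) *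
        constElt (Module.Dual k H) (toOp (ribbonOp k H σ ξ)) * faceEmb k H _ := by
  rw [actElt_faceAction, constElt_ribbonOp]
  refine hξ.isStrongPath.pathProd_end (κ := .direct) hm hn (hξ.centre_ne _)
    (fun j t hj ht h1 h2 => commute_face_triangle _ h1 h2) (fun j t hj ht hjt h1 h2 => ?_)
    fun j t hj ht hjt h1 h5 h2 h3 h4 => ?_
  · have := face_stay (k := k) (H := H) (σ j) (ξ.site j)
    rw [triangleElt, h1]
    change actElt H (directTriangle k H (Triangle.direct.target^[t] (ξ.site ξ.length))) * _ * _ = _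
    rwa [h2] at this ⊢
  · rw [triangleElt, Triangle.ne_direct h1]
    refine face_end h3 h4 fun ho => ?_
    rcases h with h | h
    · exact antipSgn_congr h _ .plus
    · rw [h.1 j (Ribbon.isDual_of_getD hj (Triangle.ne_direct h1)) (fun l hl => ?_) ho]
      · rfl
      · rcases Nat.lt_or_ge l ξ.length with hlN | hlN
        · exact Ribbon.not_isDual_of_getD (by rw [h5 l hl hlN]; decide)
        -- Beyond the end of the ribbon `IsDual` fails, because it reads the optional entry and not
        -- the default value `.dual`.
        · intro h'
          have h'' : ξ.triangles.length ≤ l := hlN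
          rw [Ribbon.IsDual, List.getElem?_eq_none h''] at h'
          exact absurd h' (by simp)

theorem constOp_sandwich_apply {V K K' : Type*} [AddCommGroup V] [Module k V] [AddCommGroup K]
    [Module k K] [Coalgebra k K] [AddCommGroup K'] [Module k K'] [Coalgebra k K'] (F : K →ₗ[k] Module.End k V)
    (G : K' →ₗ[k] Module.End k V) (X : DoubleConv k H V) (c c' : K) (d d' : K')
    (φ : Module.Dual k (Double k H)) :
    (constOp (Module.Dual k (Double k H)) F c * (constOp (Module.Dual k (Double k H)) G d * X *
      constOp (Module.Dual k (Double k H)) G d') * constOp (Module.Dual k (Double k H)) F c') φ =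
      op (F c) * (op (G d) * X φ * op (G d')) * op (F c') := by
  rw [mul_constOp_apply, constOp_mul_apply, mul_constOp_apply, constOp_mul_apply]

theorem mul_conj_of_commute {M : Type*} [Monoid M] {v b : M} (h : Commute b v) (x b' : M) :
    v * (b * x * b') = b * (v * x) * b' := by
  rw [← mul_assoc, ← mul_assoc, ← h.eq, mul_assoc b]

theorem conj_mul_of_commute {M : Type*} [Monoid M] {v b : M} (h : Commute b v) (x b' : M) :
    b' * x * b * v = b' * (x * v) * b := by
  rw [mul_assoc, h.eq, ← mul_assoc, mul_assoc b']

theorem ribbonOp_coregLeft (hm : m ≠ 1) (hn : n ≠ 1) (hξ : ξ.StronglyOpen) {ε : Fin 4 → Sgn}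
    (hε : AdmissibleSigns ε) (h : antip k H = antipInv k H ∨ ξ.LeftCompatible σ ε)
    (d : Double k H) (φ : Module.Dual k (Double k H)) :
    ribbonOp k H σ ξ (coregLeft d φ) =
      endLeft (siteAction k H ε ξ.source) d (ribbonOp k H σ ξ φ) := by
  induction d using TensorProduct.induction_on with
  | zero => simp [coregLeft, endLeft]
  | add x y hx hy =>
    have h1 : coregLeft (x + y) φ = coregLeft x φ + coregLeft y φ := by
      simp only [coregLeft, map_add, LinearMap.comp_add]
    rw [h1, map_add, hx, hy, endLeft, endLeft, endLeft, map_add, map_add, map_add]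
  | tmul a g =>
    apply op_injective
    rw [endLeft, doubleComul_tmul a g (ℛ k a) (ℛ k g)]
    simp only [map_sum, TensorProduct.map_tmul, LinearMap.mul'_apply, LinearMap.comp_apply,
      LinearMap.mulLeft_apply, siteAction_doubleAntip hm hn hε, Finset.op_sum]
    simp only [siteAction_eq, doubleRep_tmul, op_mul]
    set X := toOp (ribbonOp k H σ ξ) with hX
    have e1 := vertex_sandwich_left (vertexAction_mul ε ξ.source) (vertexAction_one ε ξ.source)
      (vertexAction_source hm hn hξ h) (ℛ k g)
    have e2 := face_sandwich_left (faceAction_dualMul ξ.source) (faceAction_counit ξ.source)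
      (faceAction_source hm hn hξ h) (ℛ k a)
    -- S(a ⊗ g) factors as (ε ⊗ S g)(S⁻¹a ⊗ 1), so the coregular action is multiplication by two
    -- embedded elements, each supplied by one of the sandwich identities.
    have e3 : X (coregLeft (a ⊗ₜ g) φ) =
        (vertexEmb k H (Hilb k H m n) (antip k H g) * (faceEmb k H (Hilb k H m n) (a ∘ₗ antipInv k H) * X)) φ := by
      rw [← mul_assoc, vertexEmb_apply, faceEmb_apply,
        ← dualEmb_mul (C := Double k H) (μ := doubleMul k H) comul_doubleDual, ← doubleAntip_tmul,
        dualEmb_double_mul_apply]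
      rfl
    change X (coregLeft (a ⊗ₜ g) φ) = _
    rw [e3, ← e2, Finset.mul_sum, ofConv_sum, LinearMap.sum_apply]
    refine Finset.sum_congr rfl fun i _ => ?_
    -- The vertex embedding has scalar values and commutes with the face operator on the left, so it
    -- reaches `X`, where the vertex sandwich applies.
    have e4 := mul_conj_of_commute (M := DoubleConv k H (Hilb k H m n))
      (constOp_commute_vertexEmb (faceAction k H ξ.source) ((ℛ k a).right i ∘ₗ antipInv k H)
        (antip k H g)) X (actElt H (faceAction k H ξ.source) ((ℛ k a).left i))
    refine (DFunLike.congr_fun (congrArg ofConv e4) φ).trans ?_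
    rw [← e1, Finset.mul_sum, Finset.sum_mul, ofConv_sum, LinearMap.sum_apply]
    refine Finset.sum_congr rfl fun j _ => ?_
    refine (constOp_sandwich_apply (faceAction k H ξ.source) (vertexAction k H ε ξ.source) X
      _ _ _ _ φ).trans ?_
    rw [hX, toOp_apply]
    simp only [mul_assoc]

theorem ribbonOp_coregRight (hm : m ≠ 1) (hn : n ≠ 1) (hξ : ξ.StronglyOpen) {ε : Fin 4 → Sgn}
    (hε : AdmissibleSigns ε) (h : antip k H = antipInv k H ∨ ξ.RightCompatible σ ε)
    (d : Double k H) (φ : Module.Dual k (Double k H)) :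
    ribbonOp k H σ ξ (coregRight φ d) =
      endRight (siteAction k H ε ξ.target) (ribbonOp k H σ ξ φ) d := by
  induction d using TensorProduct.induction_on with
  | zero => simp [coregRight, endRight]
  | add x y hx hy =>
    have h1 : coregRight φ (x + y) = coregRight φ x + coregRight φ y := by
      simp only [coregRight, map_add, LinearMap.comp_add]
    rw [h1, map_add, hx, hy, endRight, endRight, endRight, map_add, map_add, map_add]
  | tmul a g =>
    apply op_injective
    rw [endRight, doubleComul_tmul a g (ℛ k a) (ℛ k g)]
    simp only [map_sum, TensorProduct.map_tmul, LinearMap.mul'_apply, LinearMap.comp_apply,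
      LinearMap.mulLeft_apply, siteAction_doubleAntip hm hn hε, Finset.op_sum]
    simp only [siteAction_eq, doubleRep_tmul, op_mul]
    set X := toOp (ribbonOp k H σ ξ) with hX
    have e1 := vertex_sandwich_right (vertexAction_mul ε ξ.target) (vertexAction_one ε ξ.target)
      (vertexAction_target hm hn hξ h) (ℛ k g)
    have e2 := face_sandwich_right (faceAction_dualMul ξ.target) (faceAction_counit ξ.target)
      (faceAction_target hm hn hξ h) (ℛ k a)
    have e3 : X (coregRight φ (a ⊗ₜ g)) =
        ((X * vertexEmb k H (Hilb k H m n) (antip k H g)) * faceEmb k H (Hilb k H m n) (a ∘ₗ antipInv k H)) φ := by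
      rw [mul_assoc, vertexEmb_apply, faceEmb_apply,
        ← dualEmb_mul (C := Double k H) (μ := doubleMul k H) comul_doubleDual, ← doubleAntip_tmul,
        mul_dualEmb_double_apply]
      rfl
    change X (coregRight φ (a ⊗ₜ g)) = _
    -- On the right, the vertex sandwich is the outer one: the order of the two embedded factors is
    -- the same, but now they follow `X`.
    rw [e3, ← e1, Finset.sum_mul, ofConv_sum, LinearMap.sum_apply, Finset.sum_comm]
    refine Finset.sum_congr rfl fun j _ => ?_
    have e4 := conj_mul_of_commute (M := DoubleConv k H (Hilb k H m n))
      (constOp_commute_faceEmb (vertexAction k H ε ξ.target) (antip k H ((ℛ k g).left j))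
        (a ∘ₗ antipInv k H)) X (actElt H (vertexAction k H ε ξ.target) ((ℛ k g).right j))
    refine (DFunLike.congr_fun (congrArg ofConv e4) φ).trans ?_
    rw [← e2, Finset.mul_sum, Finset.sum_mul, ofConv_sum, LinearMap.sum_apply]
    refine Finset.sum_congr rfl fun i _ => ?_
    refine (constOp_sandwich_apply (vertexAction k H ε ξ.target) (faceAction k H ξ.target) X
      _ _ _ _ φ).trans ?_
    rw [hX, toOp_apply]
    simp only [mul_assoc]

end RibbonModuleMaps

/-! ### Cocommutative integrals force the antipode to be involutive. -/

section Integrals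

variable {k H : Type*} [Field k] [Ring H] [HopfAlgebra k H]

variable (k H) in
theorem conv_includeLeft_includeRight :
    toConv (Algebra.TensorProduct.includeLeft : H →ₐ[k] H ⊗[k] H).toLinearMap *
      toConv (Algebra.TensorProduct.includeRight : H →ₐ[k] H ⊗[k] H).toLinearMap =
        toConv (comul : H →ₗ[k] H ⊗[k] H) := by
  ext h
  rw [conv_apply _ _ (ℛ k h)]
  refine Eq.trans (Finset.sum_congr rfl fun i _ => ?_) (ℛ k h).eq
  simp

/-- `S(h₁) h₂ ⊗ h₃ = 1 ⊗ h`. -/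
theorem sum_antip_tmul_mul_comul (h : H) :
    ∑ i ∈ (ℛ k h).index, (antip k H ((ℛ k h).left i) ⊗ₜ[k] (1 : H)) * comul ((ℛ k h).right i) =
      (1 : H) ⊗ₜ[k] h := by
  have e := antip_conv (k := k) (Algebra.TensorProduct.includeLeft : H →ₐ[k] H ⊗[k] H)
  have e' := congrArg (· * toConv (Algebra.TensorProduct.includeRight :
    H →ₐ[k] H ⊗[k] H).toLinearMap) e
  simp only [one_mul] at e'
  rw [mul_assoc, conv_includeLeft_includeRight] at e'
  have := DFunLike.congr_fun (congrArg ofConv e') h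
  rw [conv_apply _ _ (ℛ k h)] at this
  exact this

/-- `h₁ ⊗ h₂ S(h₃) = h ⊗ 1`. -/
theorem sum_comul_mul_tmul_antip (h : H) :
    ∑ i ∈ (ℛ k h).index, comul ((ℛ k h).left i) * ((1 : H) ⊗ₜ[k] antip k H ((ℛ k h).right i)) =
      h ⊗ₜ[k] (1 : H) := by
  have e := conv_antip (k := k) (Algebra.TensorProduct.includeRight : H →ₐ[k] H ⊗[k] H)
  have e' := congrArg (toConv (Algebra.TensorProduct.includeLeft :
    H →ₐ[k] H ⊗[k] H).toLinearMap * ·) e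
  simp only [mul_one] at e'
  rw [← mul_assoc, conv_includeLeft_includeRight] at e'
  have := DFunLike.congr_fun (congrArg ofConv e') h
  rw [conv_apply _ _ (ℛ k h)] at this
  exact this

theorem comm_mul (x y : H ⊗[k] H) : TensorProduct.comm k H H (x * y) =
    TensorProduct.comm k H H x * TensorProduct.comm k H H y :=
  map_mul (Algebra.TensorProduct.comm k H H) x y

/-- Replace S(h) ⊗ 1 by (S(h₁) ⊗ 1) ε(h₂), absorb ε(h₂) into Λ as h₂ Λ, and use S(h₁) h₂ ⊗ h₃ = 1 ⊗
h. -/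
theorem left_integral_comul {Λ : H} (hΛ : ∀ h : H, h * Λ = counit (R := k) h • Λ) (h : H) :
    (antip k H h ⊗ₜ[k] (1 : H)) * comul Λ = ((1 : H) ⊗ₜ[k] h) * comul Λ := by
  rw [← sum_antip_tmul_mul_comul h, Finset.sum_mul]
  have : antip k H h ⊗ₜ[k] (1 : H) = ∑ i ∈ (ℛ k h).index,
      counit (R := k) ((ℛ k h).right i) • (antip k H ((ℛ k h).left i) ⊗ₜ[k] (1 : H)) := by
    simp only [TensorProduct.smul_tmul', ← TensorProduct.sum_tmul, ← map_smul, ← map_sum]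
    have := congrArg (TensorProduct.rid k H) (sum_tmul_counit_eq (R := k) (ℛ k h))
    simp only [map_sum, TensorProduct.rid_tmul, one_smul] at this
    rw [this]
  rw [this, Finset.sum_mul]
  refine Finset.sum_congr rfl fun i _ => ?_
  rw [mul_assoc, ← Bialgebra.comul_mul, hΛ, map_smul, mul_smul_comm, smul_mul_assoc]

theorem right_integral_comul {Λ : H} (hΛ : ∀ h : H, Λ * h = counit (R := k) h • Λ) (h : H) :
    comul Λ * (1 : H) ⊗ₜ[k] (antip k H h) = comul Λ * (h ⊗ₜ[k] (1 : H)) := by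
  rw [← sum_comul_mul_tmul_antip h, Finset.mul_sum]
  have : (1 : H) ⊗ₜ[k] (antip k H h) = ∑ i ∈ (ℛ k h).index,
      counit (R := k) ((ℛ k h).left i) • ((1 : H) ⊗ₜ[k] antip k H ((ℛ k h).right i)) := by
    simp only [← TensorProduct.tmul_smul, ← TensorProduct.tmul_sum, ← map_smul, ← map_sum]
    rw [sum_counit_smul]
  rw [this, Finset.mul_sum]
  refine Finset.sum_congr rfl fun i _ => ?_
  rw [← mul_assoc, ← Bialgebra.comul_mul, hΛ, map_smul, mul_smul_comm, smul_mul_assoc]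

/-- Multiply u Λ₁ by S(Λ₂) on the right while keeping Λ₃: what remains is u ⊗ Λ. -/
theorem tmul_eq_zero_of_mul_comul {u Λ : H} (h : (u ⊗ₜ[k] (1 : H)) * comul Λ = 0) :
    u ⊗ₜ[k] Λ = 0 := by
  let E := (Algebra.TensorProduct.includeLeft : H →ₐ[k] H ⊗[k] H)
  let F := toConv (Algebra.TensorProduct.includeRight : H →ₐ[k] H ⊗[k] H).toLinearMap
  let G := toConv (E.toLinearMap ∘ₗ antip k H) * F
  have e : toConv E.toLinearMap * G = F := by
    rw [← mul_assoc, conv_antip E, one_mul]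
  have e1 := DFunLike.congr_fun (congrArg ofConv e) Λ
  rw [conv_apply _ _ (ℛ k Λ)] at e1
  have e2 := congrArg (LinearMap.mul' k _ ∘ₗ TensorProduct.map E.toLinearMap G.ofConv) h
  rw [← (ℛ k Λ).eq, Finset.mul_sum, map_sum, map_zero] at e2
  have e3 : u ⊗ₜ[k] Λ = (u ⊗ₜ[k] (1 : H)) * F Λ := by
    simp [F]
  rw [e3, ← e1, Finset.mul_sum, ← e2]
  refine Finset.sum_congr rfl fun i _ => ?_
  simp only [Algebra.TensorProduct.tmul_mul_tmul, one_mul, LinearMap.comp_apply,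
    TensorProduct.map_tmul, LinearMap.mul'_apply]
  refine Eq.trans ?_ (congrArg (· * _) (map_mul E u ((ℛ k Λ).left i))).symm
  rw [mul_assoc]
  rfl

theorem tmul_eq_zero_of_comul_mul {u Λ : H} (h : comul Λ * ((1 : H) ⊗ₜ[k] u) = 0) :
    Λ ⊗ₜ[k] u = 0 := by
  let E := (Algebra.TensorProduct.includeRight : H →ₐ[k] H ⊗[k] H)
  let F := toConv (Algebra.TensorProduct.includeLeft : H →ₐ[k] H ⊗[k] H).toLinearMap
  let G := F * toConv (E.toLinearMap ∘ₗ antip k H)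
  have e : G * toConv E.toLinearMap = F := by
    rw [mul_assoc, antip_conv E, mul_one]
  have e1 := DFunLike.congr_fun (congrArg ofConv e) Λ
  rw [conv_apply _ _ (ℛ k Λ)] at e1
  have e2 := congrArg (LinearMap.mul' k _ ∘ₗ TensorProduct.map G.ofConv E.toLinearMap) h
  rw [← (ℛ k Λ).eq, Finset.sum_mul, map_sum, map_zero] at e2
  have e3 : Λ ⊗ₜ[k] u = F Λ * ((1 : H) ⊗ₜ[k] u) := by
    simp [F]
  rw [e3, ← e1, Finset.sum_mul, ← e2]
  refine Finset.sum_congr rfl fun i _ => ?_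
  simp only [Algebra.TensorProduct.tmul_mul_tmul, mul_one, LinearMap.comp_apply,
    TensorProduct.map_tmul, LinearMap.mul'_apply]
  refine Eq.trans ?_ (congrArg (_ * ·) (map_mul E ((ℛ k Λ).right i) u)).symm
  rw [← mul_assoc]
  rfl

theorem eq_zero_of_tmul_eq_zero {x y : H} (h : x ⊗ₜ[k] y = 0) : x = 0 ∨ y = 0 := by
  by_contra! h'
  obtain ⟨f, hf⟩ : ∃ f : Module.Dual k H, f y ≠ 0 := by
    by_contra! hf
    exact h'.2 ((Module.forall_dual_apply_eq_zero_iff k y).1 hf)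
  have := congrArg (fun t => TensorProduct.rid k H (f.lTensor H t)) h
  simp [h'.1, hf] at this

/-- The square of the antipode is the identity as soon as there is a nonzero cocommutative
integral. -/
theorem antip_antip_of_integral {Λ : H} (hΛ : IsIntegralElement (k := k) Λ)
    (hc : IsCocommutativeElement (k := k) comul Λ) (h0 : Λ ≠ 0) (h : H) :
    antip k H (antip k H h) = h := by
  rcases hΛ with hΛ | hΛ
  -- S²(h) moves from the left leg to the right one as S(h). By cocommutativity the flipped relation
  -- moves it back as h.
  · have e : (antip k H (antip k H h) ⊗ₜ[k] (1 : H)) * comul Λ = (h ⊗ₜ[k] (1 : H)) * comul Λ := by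
      rw [left_integral_comul hΛ]
      have := congrArg (TensorProduct.comm k H H) (left_integral_comul hΛ h)
      rw [comm_mul, comm_mul, hc] at this
      exact this
    have e1 := tmul_eq_zero_of_mul_comul (k := k) (u := antip k H (antip k H h) - h) (Λ := Λ)
      (by rw [TensorProduct.sub_tmul, sub_mul, e, sub_self])
    exact sub_eq_zero.1 ((eq_zero_of_tmul_eq_zero e1).resolve_right h0)
  · have e : comul Λ * ((1 : H) ⊗ₜ[k] antip k H (antip k H h)) = comul Λ * ((1 : H) ⊗ₜ[k] h) := by
      rw [right_integral_comul hΛ]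
      have := congrArg (TensorProduct.comm k H H) (right_integral_comul hΛ h)
      rw [comm_mul, comm_mul, hc] at this
      exact this
    have e1 := tmul_eq_zero_of_comul_mul (k := k) (u := antip k H (antip k H h) - h) (Λ := Λ)
      (by rw [TensorProduct.tmul_sub, mul_sub, e, sub_self])
    exact sub_eq_zero.1 ((eq_zero_of_tmul_eq_zero e1).resolve_left h0)

/-! ### Integrals in the dual -/

/-- `x ⊗ y ↦ x I(y)`. -/
def evalRightFactor (I : Module.Dual k H) : H ⊗[k] H →ₗ[k] H :=
  (TensorProduct.rid k H).toLinearMap ∘ₗ I.lTensor H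

/-- `x ⊗ y ↦ I(x) y`. -/
def evalLeftFactor (I : Module.Dual k H) : H ⊗[k] H →ₗ[k] H :=
  (TensorProduct.lid k H).toLinearMap ∘ₗ I.rTensor H

@[simp] theorem evalRightFactor_tmul (I : Module.Dual k H) (x y : H) :
    evalRightFactor I (x ⊗ₜ y) = I y • x := by simp [evalRightFactor]

@[simp] theorem evalLeftFactor_tmul (I : Module.Dual k H) (x y : H) :
    evalLeftFactor I (x ⊗ₜ y) = I x • y := by simp [evalLeftFactor]

theorem evalRightFactor_mul (I : Module.Dual k H) (x : H) (t : H ⊗[k] H) :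
    evalRightFactor I ((x ⊗ₜ 1) * t) = x * evalRightFactor I t := by
  induction t using TensorProduct.induction_on with
  | zero => simp
  | add a b ha hb => rw [mul_add, map_add, ha, hb, map_add, mul_add]
  | tmul a b => simp

theorem evalLeftFactor_mul (I : Module.Dual k H) (x : H) (t : H ⊗[k] H) :
    evalLeftFactor I (t * (1 ⊗ₜ x)) = evalLeftFactor I t * x := by
  induction t using TensorProduct.induction_on with
  | zero => simp
  | add a b ha hb => rw [add_mul, map_add, ha, hb, map_add, add_mul]
  | tmul a b => simp

variable {I : Module.Dual k H}

theorem evalRightFactor_comm (hI : ∀ x y, I (x * y) = I (y * x)) (x : H) (t : H ⊗[k] H) :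
    evalRightFactor I (t * (1 ⊗ₜ x)) = evalRightFactor I ((1 ⊗ₜ x) * t) := by
  induction t using TensorProduct.induction_on with
  | zero => simp
  | add a b ha hb => rw [add_mul, map_add, ha, hb, mul_add, map_add]
  | tmul a b => simp [hI b x]

theorem evalLeftFactor_comm (hI : ∀ x y, I (x * y) = I (y * x)) (x : H) (t : H ⊗[k] H) :
    evalLeftFactor I (t * (x ⊗ₜ 1)) = evalLeftFactor I ((x ⊗ₜ 1) * t) := by
  induction t using TensorProduct.induction_on with
  | zero => simp
  | add a b ha hb => rw [add_mul, map_add, ha, hb, mul_add, map_add]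
  | tmul a b => simp [hI a x]

/-- This says x₁ I(y x₂) = S(y₁ I(x y₂)): write 1 ⊗ y as (S(y₁) ⊗ 1) Δ(y₂), use invariance of I on
y₂ x, and the trace property. Exchanging the roles of x and y a second time produces S². -/
theorem evalRightFactor_antip (hI : ∀ x y, I (x * y) = I (y * x))
    (h : ∀ x, evalRightFactor I (comul x) = I x • (1 : H)) (x y : H) :
    evalRightFactor I ((1 ⊗ₜ y) * comul x) =
      antip k H (evalRightFactor I ((1 ⊗ₜ x) * comul y)) := by
  rw [← sum_antip_tmul_mul_comul y, Finset.sum_mul, map_sum, ← evalRightFactor_comm hI,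
    ← (ℛ k y).eq, Finset.sum_mul, map_sum, map_sum]
  refine Finset.sum_congr rfl fun i _ => ?_
  rw [mul_assoc, evalRightFactor_mul, ← Bialgebra.comul_mul, h]
  simp

theorem evalLeftFactor_antip (hI : ∀ x y, I (x * y) = I (y * x))
    (h : ∀ x, evalLeftFactor I (comul x) = I x • (1 : H)) (x y : H) :
    evalLeftFactor I (comul x * (y ⊗ₜ 1)) =
      antip k H (evalLeftFactor I (comul y * (x ⊗ₜ 1))) := by
  rw [← sum_comul_mul_tmul_antip y, Finset.mul_sum, map_sum, evalLeftFactor_comm hI,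
    ← (ℛ k y).eq, Finset.mul_sum, map_sum, map_sum]
  refine Finset.sum_congr rfl fun i _ => ?_
  rw [← mul_assoc, evalLeftFactor_mul, ← Bialgebra.comul_mul, h]
  simp

/-- The square of the antipode is the identity as soon as there is a nonzero integral in the dual
which is a trace. -/
theorem antip_antip_of_integral_dual (hI : IsIntegralFunctional I)
    (hc : ∀ x y, I (x * y) = I (y * x)) (h0 : I ≠ 0) (z : H) :
    antip k H (antip k H z) = z := by
  obtain ⟨w, hw⟩ : ∃ w, I w ≠ 0 := by
    by_contra! h
    exact h0 (LinearMap.ext h)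
  -- With I(w) ≠ 0, every z is up to a scalar a sum of elements on which the exchange relation can
  -- be used twice. Each of these is fixed by S².
  suffices h : antip k H (antip k H (I w • z)) = I w • z by
    rw [map_smul, map_smul] at h
    exact smul_right_injective H hw h
  rcases hI with hI | hI
  · have e : I w • z = ∑ i ∈ (ℛ k z).index, evalLeftFactor I
        (comul ((ℛ k z).right i) * ((w * antip k H ((ℛ k z).left i)) ⊗ₜ 1)) := by
      have : I w • z = evalLeftFactor I ((w ⊗ₜ 1) * (1 ⊗ₜ z)) := by simp
      rw [this, ← sum_antip_tmul_mul_comul z, Finset.mul_sum, map_sum]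
      refine Finset.sum_congr rfl fun i _ => ?_
      rw [evalLeftFactor_comm hc, ← mul_assoc, Algebra.TensorProduct.tmul_mul_tmul, mul_one]
    rw [e, map_sum, map_sum]
    refine Finset.sum_congr rfl fun i _ => ?_
    rw [← evalLeftFactor_antip hc hI, ← evalLeftFactor_antip hc hI]
  · have e : I w • z = ∑ i ∈ (ℛ k z).index, evalRightFactor I
        ((1 ⊗ₜ (antip k H ((ℛ k z).right i) * w)) * comul ((ℛ k z).left i)) := by
      have : I w • z = evalRightFactor I ((z ⊗ₜ 1) * (1 ⊗ₜ w)) := by simp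
      rw [this, ← sum_comul_mul_tmul_antip z, Finset.sum_mul, map_sum]
      refine Finset.sum_congr rfl fun i _ => ?_
      rw [← evalRightFactor_comm hc, mul_assoc, Algebra.TensorProduct.tmul_mul_tmul, mul_one]
    rw [e, map_sum, map_sum]
    refine Finset.sum_congr rfl fun i _ => ?_
    rw [← evalRightFactor_antip hc hI, ← evalRightFactor_antip hc hI]

theorem IsCocommutativeElement.apply_mul_comm [FiniteDimensional k H]
    (hc : IsCocommutativeElement (dualComul (LinearMap.mul' k H)) I) (x y : H) :
    I (x * y) = I (y * x) := by
  have h1 := dualDistrib_dualComul (LinearMap.mul' k H) I (x ⊗ₜ y)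
  have h2 := dualDistrib_dualComul (LinearMap.mul' k H) I (y ⊗ₜ x)
  rw [LinearMap.mul'_apply] at h1 h2
  rw [← h1, ← h2]
  nth_rw 1 [← hc]
  induction dualComul (LinearMap.mul' k H) I using TensorProduct.induction_on with
  | zero => simp
  | add a b ha hb => simp only [map_add, LinearMap.add_apply, ha, hb]
  | tmul a b => simp [mul_comm]

end Integrals

/-! ### Rotating and cancelling factors at cocommutative elements. -/

section CocommutativeElements

variable {k K A : Type*} [Field k] [AddCommGroup K] [Module k K] [Coalgebra k K]
  [Ring A] [Algebra k A]

theorem commute_conv_apply {a : A} {f g : WithConv (K →ₗ[k] A)} (hf : ∀ y, Commute a (f y))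
    (hg : ∀ y, Commute a (g y)) (y : K) : Commute a ((f * g) y) := by
  rw [conv_apply _ _ (ℛ k y)]
  exact Commute.sum_right _ _ _ fun i _ => (hf _).mul_right (hg _)

theorem commute_pathProd_apply {a : A} {p : ℕ → WithConv (K →ₗ[k] A)} {b n : ℕ}
    (h : ∀ j, b ≤ j → j < b + n → ∀ y, Commute a (p j y)) (y : K) :
    Commute a (pathProd p b n y) := by
  induction n generalizing b y with
  | zero => exact (Algebra.commutes (R := k) (counit (R := k) y) a).symm
  | succ n ih =>
    exact commute_conv_apply (h b le_rfl (by omega))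
      (fun y => ih (fun j hj hj' => h j (by omega) (by omega)) y) y

/-- A product of commuting factors may be rotated at a cocommutative element. -/
theorem pathProd_rotate_apply {c : K} (hc : IsCocommutativeElement (k := k) comul c)
    {p : ℕ → WithConv (K →ₗ[k] A)} {n : ℕ} (hp : p n = p 0)
    (h : ∀ j, 1 ≤ j → j < n → ∀ x y, Commute (p 0 x) (p j y)) (hn : n ≠ 0) :
    pathProd (fun j => p (j + 1)) 0 n c = pathProd p 0 n c := by
  obtain ⟨n, rfl⟩ := Nat.exists_eq_add_one_of_ne_zero hn
  rw [pathProd_shift, zero_add, pathProd_add]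
  have e : pathProd p (1 + n) 1 = p 0 := by
    rw [pathProd_succ, pathProd, mul_one, Nat.add_comm, hp]
  rw [e, pathProd_succ p 0, zero_add]
  exact (conv_comm_apply hc _ _ fun x y => commute_pathProd_apply
    (fun j hj hj' z => h j hj (by omega) x z) y).symm

/-- An element passing from the middle of a product to both of its ends, up to a factor `i` which
cancels, commutes with the product at cocommutative elements. -/
theorem commute_apply_of_middle {c : K} (hc : IsCocommutativeElement (k := k) comul c)
    {w i j : WithConv (K →ₗ[k] A)} {Y Z : A}
    (hz : w * convConst k K Z = i * convConst k K Z * w)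
    (hy : convConst k K Y * w = w * convConst k K Y * i) (hij : i * j = 1) (hji : j * i = 1)
    (hw : ∀ x y, Commute (w x) (j y)) : Commute (w c) (Y * Z) := by
  have e1 : w * convConst k K Y = convConst k K Y * (w * j) := by
    rw [← mul_assoc, hy, mul_assoc, hij, mul_one]
  have e2 : convConst k K Z * w = j * w * convConst k K Z := by
    rw [mul_assoc, hz, ← mul_assoc, ← mul_assoc, hji, one_mul]
  have e3 : w c * Y = Y * (w * j) c := by
    rw [← convConst_mul_apply, ← e1, mul_convConst_apply]
  have e4 : Z * w c = (j * w) c * Z := by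
    rw [← mul_convConst_apply, ← e2, convConst_mul_apply]
  rw [Commute, SemiconjBy, ← mul_assoc, e3, conv_comm_apply hc _ _ hw, mul_assoc, ← e4, mul_assoc]

end CocommutativeElements

/-! ### Commutation of ribbon operators with loops at intermediate sites. -/

section RibbonIntegrals

attribute [local instance] hopfDualCoalgebra doubleDualCoalgebra

variable {k H : Type*} [Field k] [Ring H] [HopfAlgebra k H] [FiniteDimensional k H] {m n : ℕ}

variable {κ : Triangle} {V K : Type*} [AddCommGroup V] [Module k V] [AddCommGroup K] [Module k K]
  [Coalgebra k K] {F : Site m n → K →ₗ[k] Module.End k V}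

variable (κ F) in
/-- The convolution product of the triangle operators `F` about the centre of a site. -/
def loopElt (s : Site m n) : WithConv (K →ₗ[k] DoubleConv k H V) :=
  pathProd (fun t => actElt H (F (κ.target^[t] s))) 0 4

theorem commute_actElt_apply (hF : ∀ s u, s ≠ u → ∀ x y, Commute (F s x) (F u y))
    {s u : Site m n} (h : s ≠ u) (x y : K) : Commute (actElt H (F s) x) (actElt H (F u) y) := by
  rw [constOp_apply, constOp_apply, Commute, SemiconjBy, ← map_mul, ← map_mul, ← op_mul, ← op_mul,
    (hF s u h x y).eq]

/-- Starting one triangle later moves the first factor to the end of the word. Different factors of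
a loop commute, so at a cocommutative element this changes nothing. -/
theorem loopElt_target (hF : ∀ s u, s ≠ u → ∀ x y, Commute (F s x) (F u y)) {c : K}
    (hc : IsCocommutativeElement (k := k) comul c) (s : Site m n) :
    loopElt (H := H) κ F (κ.target s) c = loopElt (H := H) κ F s c := by
  refine pathProd_rotate_apply hc (p := fun t => actElt H (F (κ.target^[t] s)))
    (by rw [Triangle.iterate_four]; rfl) (fun j hj hj4 x y => ?_) (by decide)
  exact commute_actElt_apply hF (fun h =>
    absurd (κ.iterate_injective s (t := 0) (by omega) hj4 h) (by omega)) x y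

theorem loopElt_eq_of_centre_eq (hF : ∀ s u, s ≠ u → ∀ x y, Commute (F s x) (F u y)) {c : K}
    (hc : IsCocommutativeElement (k := k) comul c) {s u : Site m n}
    (h : κ.centre u = κ.centre s) :
    loopElt (H := H) κ F u c = loopElt (H := H) κ F s c := by
  obtain ⟨t, -, rfl⟩ := κ.exists_iterate_eq h
  clear h
  induction t with
  | zero => rfl
  | succ t ih => rw [Function.iterate_succ_apply', loopElt_target hF hc, ih]

/-- Where the path meets the centre, the loop is rotated to start at the first visit. Its relations
with the head and the tail produce the factor i on opposite sides, and these cancel at a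
cocommutative element. -/
theorem IsStrongPath.commute_loopElt (hm : m ≠ 1) (hn : n ≠ 1) {u : ℕ → Site m n}
    {τ : ℕ → Triangle} {N : ℕ} (hu : IsStrongPath u τ N)
    (hF : ∀ s u, s ≠ u → ∀ x y, Commute (F s x) (F u y))
    {v : Site m n} (h0 : κ.centre v ≠ κ.centre (u 0)) (hN : κ.centre v ≠ κ.centre (u N))
    {f : ℕ → DoubleConv k H V} {i j : WithConv (K →ₗ[k] DoubleConv k H V)}
    (hij : i * j = 1) (hji : j * i = 1) (hj : ∀ s x y, Commute (actElt H (F s) x) (j y))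
    (hcomm : ∀ j s, j < N → u j ≠ s → (τ j = κ ∨ (u j).arrow ≠ s.arrow) →
      Commute (actElt H (F s)) (constElt K (f j)))
    (hstay : ∀ j, j < N → τ j = κ → actElt H (F (u j)) * constElt K (f j) * i =
      i * constElt K (f j) * actElt H (F (u j)))
    (hstart : ∀ j, j < N → τ j ≠ κ → actElt H (F (u j)) * constElt K (f j) =
      i * constElt K (f j) * actElt H (F (u j)))
    (hend : ∀ j s, j < N → τ j ≠ κ → (u j).arrow = s.arrow → ((u j).Outward ↔ ¬ s.Outward) →
      constElt K (f j) * actElt H (F s) = actElt H (F s) * constElt K (f j) * i)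
    {c : K} (hc : IsCocommutativeElement (k := k) comul c) :
    Commute (loopElt κ F v c) (pathProd f 0 N) := by
  rcases hu.pathProd_middle hm hn h0 hN (P := fun s => actElt H (F s))
    (f := fun j => constElt K (f j)) hcomm hstay hstart hend with h | ⟨b, hb, hbv, h1, h2⟩
  · have e : Commute (loopElt κ F v) (constElt K (pathProd f 0 N)) := by
      rw [constElt_pathProd]
      exact commute_pathProd fun j _ hj => (commute_pathProd fun t _ _ =>
        (h t j (by omega)).symm).symm
    have e' := DFunLike.congr_fun (congrArg ofConv e.eq) c
    rwa [mul_convConst_apply, convConst_mul_apply] at e'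
  · rw [← loopElt_eq_of_centre_eq hF hc hbv, ← Nat.add_sub_cancel' hb, pathProd_add, zero_add]
    rw [← constElt_pathProd] at h1 h2
    exact commute_apply_of_middle hc h1 h2 hij hji fun x y =>
      (commute_pathProd_apply (fun t _ _ z => (hj _ z y).symm) x).symm

theorem commute_of_actElt {W : K →ₗ[k] Module.End k V}
    {G : Module.Dual k (Double k H) →ₗ[k] Module.End k V} {c : K}
    (h : Commute (actElt H W c) (toOp G)) (φ : Module.Dual k (Double k H)) :
    Commute (G φ) (W c) := by
  have e := DFunLike.congr_fun (congrArg ofConv h.eq) φ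
  rw [mul_constOp_apply, constOp_mul_apply, toOp_apply, ← op_mul, ← op_mul] at e
  exact op_injective e

variable {ξ : Ribbon m n}

theorem ribbonOp_commute_vertexAction (hm : m ≠ 1) (hn : n ≠ 1) (hξ : ξ.StronglyOpen)
    (σ : ℕ → Sgn) (ε : Fin 4 → Sgn) {Λ : H} (hΛ : IsIntegralElement (k := k) Λ)
    (hc : IsCocommutativeElement (k := k) comul Λ) {t : Site m n} (h0 : t.Disjoint ξ.source)
    (hN : t.Disjoint ξ.target) (φ : Module.Dual k (Double k H)) :
    Commute (ribbonOp k H σ ξ φ) (vertexAction k H ε t Λ) := by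
  by_cases hΛ0 : Λ = 0
  · rw [hΛ0, map_zero]
    exact Commute.zero_right _
  -- From here on S = S⁻¹, so the signs of the loop can be made uniform. This is necessary for
  -- rotating it, because rotation shifts the positions to which signs are attached.
  have hS := antip_eq_antipInv (antip_antip_of_integral hΛ hc hΛ0)
  refine commute_of_actElt ?_ φ
  rw [toOp_ribbonOp]
  have e : actElt H (vertexAction k H ε t) = loopElt .dual (dualTriangle k H .plus) t := by
    rw [actElt_vertexAction]
    exact pathProd_congr fun j _ _ => by rw [dualTriangle_congr fun _ => antipSgn_congr hS _ .plus]
  rw [e]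
  exact hξ.isStrongPath.commute_loopElt (κ := .dual) (F := dualTriangle k H .plus)
    (f := triangleElt k H σ ξ) (i := vertexEmb k H _)
    (j := toConv ((vertexEmb k H _).ofConv ∘ₗ antip k H)) hm hn
    (fun s u h x y => dualTriangle_commute_of_ne _ _ h x y) h0.1 hN.1
    conv_antip_vertexEmb antip_conv_vertexEmb
    (fun s x y => constOp_commute_vertexEmb _ x (antip k H y))
    (fun j s _ h1 h2 => commute_vertex_triangle _ _ h1 h2)
    (fun j _ h1 => by
      have := vertex_stay (k := k) (H := H) (ς := .plus) (ς' := σ j) (s := ξ.site j)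
        fun _ => antipSgn_congr hS _ _
      rw [triangleElt, h1]
      exact this)
    (fun j _ h1 => by
      rw [triangleElt, Triangle.ne_dual h1]
      exact vertex_start (σ j) fun _ => antipSgn_congr hS _ .minus)
    (fun j s _ h1 h2 h3 => by
      rw [triangleElt, Triangle.ne_dual h1]
      exact vertex_end (σ j) h2 h3 fun _ => antipSgn_congr hS _ .plus)
    hc

theorem ribbonOp_commute_faceAction (hm : m ≠ 1) (hn : n ≠ 1) (hξ : ξ.StronglyOpen)
    (σ : ℕ → Sgn) {I : Module.Dual k H} (hI : IsIntegralFunctional I)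
    (hc : IsCocommutativeElement (dualComul (LinearMap.mul' k H)) I) {t : Site m n}
    (h0 : t.Disjoint ξ.source) (hN : t.Disjoint ξ.target) (φ : Module.Dual k (Double k H)) :
    Commute (ribbonOp k H σ ξ φ) (faceAction k H t I) := by
  by_cases hI0 : I = 0
  · rw [hI0, map_zero]
    exact Commute.zero_right _
  -- The face operator carries no signs, but a dual triangle of the ribbon may both enter and leave
  -- intermediate faces, which would require S and S⁻¹ at different places.
  have hS := antip_eq_antipInv (antip_antip_of_integral_dual hI hc.apply_mul_comm hI0)
  refine commute_of_actElt ?_ φ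
  rw [toOp_ribbonOp]
  have e : actElt H (faceAction k H t) = loopElt .direct (directTriangle k H) t :=
    actElt_faceAction t
  rw [e]
  exact hξ.isStrongPath.commute_loopElt (κ := .direct) (F := directTriangle k H)
    (f := triangleElt k H σ ξ) (i := faceEmb k H _)
    (j := toConv ((faceEmb k H _).ofConv ∘ₗ (antipInv k H).dualMap)) hm hn
    (fun s u h x y => directTriangle_commute_of_ne h x y) h0.2 hN.2
    conv_antip_faceEmb antip_conv_faceEmb
    (fun s x y => constOp_commute_faceEmb _ x (y ∘ₗ antipInv k H))
    (fun j s _ h1 h2 => commute_face_triangle _ h1 h2)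
    (fun j _ h1 => by
      rw [triangleElt, h1]
      exact face_stay (σ j) (ξ.site j))
    (fun j _ h1 => by
      rw [triangleElt, Triangle.ne_direct h1]
      exact face_start fun _ => antipSgn_congr hS _ .minus)
    (fun j s _ h1 h2 h3 => by
      rw [triangleElt, Triangle.ne_direct h1]
      exact face_end h2 h3 fun _ => antipSgn_congr hS _ .plus)
    hc

end RibbonIntegrals

end HopfKitaev
end

theorem mainTheorem9 {k H : Type*} [Field k] [Ring H] [HopfAlgebra k H] [FiniteDimensional k H]
    (m n : ℕ) (hm : m ≠ 1) (hn : n ≠ 1)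
    (ξ : HopfKitaev.Ribbon m n) (hξ : ξ.StronglyOpen) (σ : ℕ → HopfKitaev.Sgn) :
    -- left module map for the action at the initial site
    (∀ ε : Fin 4 → HopfKitaev.Sgn, HopfKitaev.AdmissibleSigns ε →
      ((∀ h : H, HopfAlgebra.antipode k (HopfAlgebra.antipode k h) = h) ∨
        ξ.LeftCompatible σ ε) →
      ∀ (d : HopfKitaev.Double k H) (φ : Module.Dual k (HopfKitaev.Double k H)),
        HopfKitaev.ribbonOp k H σ ξ (HopfKitaev.coregLeft d φ) =
          HopfKitaev.endLeft (HopfKitaev.siteAction k H ε ξ.source) d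
            (HopfKitaev.ribbonOp k H σ ξ φ)) ∧
    -- right module map for the action at the final site
    (∀ ε : Fin 4 → HopfKitaev.Sgn, HopfKitaev.AdmissibleSigns ε →
      ((∀ h : H, HopfAlgebra.antipode k (HopfAlgebra.antipode k h) = h) ∨
        ξ.RightCompatible σ ε) →
      ∀ (d : HopfKitaev.Double k H) (φ : Module.Dual k (HopfKitaev.Double k H)),
        HopfKitaev.ribbonOp k H σ ξ (HopfKitaev.coregRight φ d) =
          HopfKitaev.endRight (HopfKitaev.siteAction k H ε ξ.target)
            (HopfKitaev.ribbonOp k H σ ξ φ) d) ∧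
    -- commutation with `A(t)` and `B(t)` for cocommutative integrals
    (∀ (Λ : H) (I : Module.Dual k H),
      HopfKitaev.IsIntegralElement (k := k) Λ → HopfKitaev.IsIntegralFunctional I →
      HopfKitaev.IsCocommutativeElement (k := k) Coalgebra.comul Λ →
      HopfKitaev.IsCocommutativeElement (HopfKitaev.dualComul (LinearMap.mul' k H)) I →
      ∀ ε : Fin 4 → HopfKitaev.Sgn, HopfKitaev.AdmissibleSigns ε →
      ∀ t : HopfKitaev.Site m n, t.Disjoint ξ.source → t.Disjoint ξ.target →
      ∀ φ : Module.Dual k (HopfKitaev.Double k H),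
        Commute (HopfKitaev.ribbonOp k H σ ξ φ) (HopfKitaev.vertexAction k H ε t Λ) ∧
        Commute (HopfKitaev.ribbonOp k H σ ξ φ) (HopfKitaev.faceAction k H t I)) := by
  refine ⟨fun ε hε h d φ => ?_, fun ε hε h d φ => ?_, fun Λ I hΛ hI hΛc hIc ε _ t h0 hN φ => ⟨?_, ?_⟩⟩
  · exact HopfKitaev.ribbonOp_coregLeft hm hn hξ hε (h.imp_left HopfKitaev.antip_eq_antipInv) d φ
  · exact HopfKitaev.ribbonOp_coregRight hm hn hξ hε (h.imp_left HopfKitaev.antip_eq_antipInv) d φ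
  · exact HopfKitaev.ribbonOp_commute_vertexAction hm hn hξ σ ε hΛ hΛc h0 hN φ
  · exact HopfKitaev.ribbonOp_commute_faceAction hm hn hξ σ hI hIc h0 hN φ
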